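/- **Notation.** Let $|q|<1$, $(q)_n=\prod_{k=1}^n(1-q^k)$, $(q)_\infty=\prod_{k\ge 1}(1-q^k)$, and for an integer $b\ge 1$ $$h_b(q)=\sum_{n\in\mathbb Z}\epsilon_b(n)\,q^{\frac{bn(n+1)}2-n},\qquad \epsilon_b(n)=(-1)^n\ (b\text{ odd}),\quad \epsilon_b(n)=1\ (b\text{ even},\,n\ge 0),\quad \epsilon_b(n)=-1\ (b\text{ even},\,n<0).$$ **The multisum.** Let $D$ be an alternating diagram of a knot with $c$ crossings, regarded as a 4-valent plane graph with edge set $E(D)$ (the arcs), set of faces $R$ and exterior face $X$. The faces are checkerboard coloured: a face is of colour $A$ if it is swept out by rotating the overpassing strands counterclockwise at its corners, and of colour $B$ otherwise; $R=R_A\sqcup R_B$. Let $e(F)$ be the number of edges of a face $F$, and $cv(F,G)$, $ce(F,G)$ the numbers of common vertices and common edges of $F$ and $G$. Put $L(F)=1$ for $F\in R_B$ and $L(F)=\frac{e(F)}2-1$ for $F\in R_A$; put $Q(F,F)=0$ for $F\in R_B$, $Q(F,F)=e(F)$ for $F\in R_A$, and for $F\ne G$ put $Q(F,G)=0$ if both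 are in $R_A$, $Q(F,G)=cv(F,G)$ if both are in $R_B$, $Q(F,G)=ce(F,G)$ if they have different colours. For $s:R\to\mathbb Z$ let $L'(s)=\sum_F L(F)s(F)$, $Q'(s)=\frac12\sum_{F,G}Q(F,G)s(F)s(G)$, and for $e\in E(D)$ let $s(e)$ be the sum of the values of $s$ on the two faces adjacent to $e$. Let $F^*$ be a face of the colour opposite to that of $X$ which shares an edge with the maximal number of faces of the colour of $X$ and, among those, with the maximal number of such faces different from $X$; any such face may be chosen. With $\Lambda=\{s: s(X)=0,\ s(F^*)=0,\ s(e)\ge 0\ \forall e\in E(D)\}$ set $$\Phi_D(q)=(q)_\infty^{\,c}\sum_{s\in\Lambda}(-1)^{2L'(s)}\frac{q^{Q'(s)+L'(s)}}{\prod_{e\in E(D)}(q)_{s(e)}} .$$ For a knot $K$ with one of the diagrams $D$ below, all of which have $X\in R_A$, let $\Phi_K=\Phi_D$ and $\Phi_{-K}=\Phi_{-D}$, where $-D$ is $D$ with over and under exchanged at all crossings (so that the colours $A$ and $B$ are exchanged and $X$ is kept). **The diagrams.** $T(2,2p+1)$, $p>0$, is the left-handed torus knot with its standard diagram: $2p+1$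 crossings on a circle, consecutive ones bounding a bigon of colour $B$; the exterior and the central face have colour $A$. The twist knot $K_p$ is given by the diagram obtained from such a circular chain of $m+1$ crossings ($m=2p-1$ for $p>0$, $m=2|p|$ for $p<0$) by replacing one crossing by a clasp, that is, by two crossings on the same radius which bound a bigon of colour $A$. The knots $3_1,5_1,7_1$ are $T(2,3),T(2,5),T(2,7)$, and $4_1,5_2,6_1,7_2,8_1$ are $K_{-1},K_2,K_{-2},K_3,K_{-3}$, with these diagrams. The other knots have the following diagrams, where the arcs are numbered along the knot from $0$ and $X[i,j,k,l]$ lists the arcs at a crossing counterclockwise from the incoming underpassing arc: - $6_2$: $X[0,3,1,4],\ X[2,8,3,7],\ X[4,9,5,10],\ X[6,11,7,0],\ X[8,2,9,1],\ X[10,5,11,6]$; the exterior face is bounded by the arcs $2,5,7,9,11$. - $6_3$: $X[0,4,1,3],\ X[2,8,3,7],\ X[4,9,5,10],\ X[6,2,7,1],\ X[8,11,9,0],\ X[10,5,11,6]$; the exterior face is bounded by the arcs $1,4,6,10$. - $7_3$: $X[0,5,1,6],\ X[2,9,3,10],\ X[4,11,5,12],\ X[6,13,7,0],\ X[8,1,9,2],\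 X[10,3,11,4],\ X[12,7,13,8]$; the exterior face is bounded by the arcs $1,3,5,9,11$. - $7_4$: $X[0,6,1,5],\ X[2,10,3,9],\ X[4,12,5,11],\ X[6,0,7,13],\ X[8,4,9,3],\ X[10,2,11,1],\ X[12,8,13,7]$; the exterior face is bounded by the arcs $1,3,6,8,10,13$. - $7_5$: $X[0,7,1,8],\ X[2,11,3,12],\ X[4,13,5,0],\ X[6,9,7,10],\ X[8,1,9,2],\ X[10,5,11,6],\ X[12,3,13,4]$; the exterior face is bounded by the arcs $0,2,4,8,12$. - $7_6$: $X[0,3,1,4],\ X[2,11,3,12],\ X[4,10,5,9],\ X[6,13,7,0],\ X[8,6,9,5],\ X[10,1,11,2],\ X[12,7,13,8]$; the exterior face is bounded by the arcs $2,5,8,10,12$. - $7_7$: $X[0,3,1,4],\ X[2,10,3,9],\ X[4,7,5,8],\ X[6,12,7,11],\ X[8,13,9,0],\ X[10,2,11,1],\ X[12,6,13,5]$; the exterior face is bounded by the arcs $2,6,9,11,13$. - $8_2$: $X[0,3,1,4],\ X[2,10,3,9],\ X[4,11,5,12],\ X[6,13,7,14],\ X[8,15,9,0],\ X[10,2,11,1],\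 X[12,5,13,6],\ X[14,7,15,8]$; the exterior face is bounded by the arcs $2,5,7,9,11,13,15$. - $8_3$: $X[0,6,1,5],\ X[2,11,3,12],\ X[4,9,5,10],\ X[6,0,7,15],\ X[8,14,9,13],\ X[10,3,11,4],\ X[12,1,13,2],\ X[14,8,15,7]$; the exterior face is bounded by the arcs $1,6,8,13,15$. - $8_4$: $X[0,5,1,6],\ X[2,12,3,11],\ X[4,10,5,9],\ X[6,15,7,0],\ X[8,13,9,14],\ X[10,2,11,1],\ X[12,4,13,3],\ X[14,7,15,8]$; the exterior face is bounded by the arcs $1,5,10$. - $8_5$: $X[0,5,1,6],\ X[2,10,3,9],\ X[4,15,5,0],\ X[6,11,7,12],\ X[8,13,9,14],\ X[10,2,11,1],\ X[12,7,13,8],\ X[14,3,15,4]$; the exterior face is bounded by the arcs $0,4,6,8,12,14$. **Theorem.** For every choice of $F^*$ and every complex $q$ with $|q|<1$ the multisums converge absolutely and | $K$ | $\Phi_K(q)$ | $\Phi_{-K}(q)$ | |---|---|---| | $3_1$ | $h_3$ | $1$ | | $4_1$ | $h_3$ | $h_3$ | | $5_1$ | $h_5$ | $1$ | | $5_2$ |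 $h_4$ | $h_3$ | | $6_1$ | $h_5$ | $h_3$ | | $6_2$ | $h_3h_4$ | $h_3$ | | $6_3$ | $h_3^2$ | $h_3^2$ | | $7_1$ | $h_7$ | $1$ | | $7_2$ | $h_6$ | $h_3$ | | $7_3$ | $h_5$ | $h_4$ | | $7_4$ | $h_4^2$ | $h_3$ | | $7_5$ | $h_3h_4$ | $h_4$ | | $7_6$ | $h_3h_4$ | $h_3^2$ | | $7_7$ | $h_3^3$ | $h_3^2$ | | $8_1$ | $h_7$ | $h_3$ | | $8_2$ | $h_3h_6$ | $h_3$ | | $8_3$ | $h_5$ | $h_5$ | | $8_4$ | $h_3$ | $h_4h_5$ | | $8_5$ | (no claim) | $h_3$ | | $K_p$, $p>0$ | $h_{2p}$ | $h_3$ | | $K_p$, $p<0$ | $h_{2\lvert p\rvert+1}$ | $h_3$ | | $T(2,2p+1)$, $p>0$ | $h_{2p+1}$ | $1$ | -/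

import Mathlib

noncomputable section

/-! ### Alternating knot diagrams -/

/-- At a crossing the four arc ends are numbered `0, 1, 2, 3` counterclockwise and the corner `k`
lies between the ends `k` and `k + 1`.  Keeping a face on the right, one leaves the corner `(x, k)`
along the arc at the end `k + 1` of `x`; if the other end of that arc is the end `l` of `y`, the
next corner of the same face is `(y, l)`. -/
def CornerStep {C E : Type} (pd : C → Fin 4 → E) (d e : C × Fin 4) : Prop :=
  pd d.1 (d.2 + 1) = pd e.1 e.2 ∧ (d.1, d.2 + 1) ≠ e

/-- Two arcs are consecutive on the knot if they occupy opposite ends of a crossing. -/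
def ArcStep {C E : Type} (pd : C → Fin 4 → E) (a b : E) : Prop :=
  ∃ x k, pd x k = a ∧ pd x (k + 2) = b

/-- An alternating knot diagram in the plane, given by a planar diagram code: `pd x k` is the arc at
the `k`-th end of the crossing `x` (counterclockwise), where the ends `0, 2` belong to the
underpassing strand and the ends `1, 3` to the overpassing strand. -/
structure AlternatingKnotDiagram where
  Crossing : Type
  Arc : Type
  /-- the faces of the diagram -/
  Region : Type
  [fintypeCrossing : Fintype Crossing]
  [fintypeArc : Fintype Arc]
  [fintypeRegion : Fintype Region]
  [decEqCrossing : DecidableEq Crossing]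
  [decEqArc : DecidableEq Arc]
  [decEqRegion : DecidableEq Region]
  pd : Crossing → Fin 4 → Arc
  /-- the face containing the `k`-th corner of a crossing -/
  corner : Crossing → Fin 4 → Region
  /-- the unbounded face -/
  exterior : Region
  /-- alternation: every arc has one underpassing and one overpassing end -/
  under_end : ∀ a, ∃! e : Crossing × Fin 4, (e.2 = 0 ∨ e.2 = 2) ∧ pd e.1 e.2 = a
  over_end : ∀ a, ∃! e : Crossing × Fin 4, (e.2 = 1 ∨ e.2 = 3) ∧ pd e.1 e.2 = a
  /-- there is only one component -/
  knot : ∀ a b, Relation.EqvGen (ArcStep pd) a b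
  corner_surjective : ∀ F, ∃ x k, corner x k = F
  /-- the faces are the closed walks of `CornerStep` -/
  corner_eq_iff : ∀ d e : Crossing × Fin 4,
    corner d.1 d.2 = corner e.1 e.2 ↔ Relation.EqvGen (CornerStep pd) d e
  /-- the diagram lies in the plane (Euler's formula) -/
  planar : Fintype.card Region = Fintype.card Crossing + 2

namespace AlternatingKnotDiagram

attribute [instance] fintypeCrossing fintypeArc fintypeRegion decEqCrossing decEqArc decEqRegion

/-- The mirror image: the same plane projection with over and under exchanged at all crossings. -/
def mirror (D : AlternatingKnotDiagram) : AlternatingKnotDiagram where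
  Crossing := D.Crossing
  Arc := D.Arc
  Region := D.Region
  pd x k := D.pd x (k + 1)
  corner x k := D.corner x (k + 1)
  exterior := D.exterior
  under_end := by
    intro a
    obtain ⟨⟨x, k⟩, ⟨hk, ha⟩, hu⟩ := D.over_end a
    refine ⟨(x, k - 1), ⟨?_, by simpa using ha⟩, ?_⟩
    · revert hk; dsimp only; clear ha hu; revert k; decide
    · rintro ⟨y, l⟩ ⟨hl, hy⟩
      have := hu (y, l + 1) ⟨by revert hl; dsimp only; clear hy; revert l; decide, hy⟩
      simp only [Prod.mk.injEq] at this ⊢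
      exact ⟨this.1, by rw [← this.2]; simp⟩
  over_end := by
    intro a
    obtain ⟨⟨x, k⟩, ⟨hk, ha⟩, hu⟩ := D.under_end a
    refine ⟨(x, k - 1), ⟨?_, by simpa using ha⟩, ?_⟩
    · revert hk; dsimp only; clear ha hu; revert k; decide
    · rintro ⟨y, l⟩ ⟨hl, hy⟩
      have := hu (y, l + 1) ⟨by revert hl; dsimp only; clear hy; revert l; decide, hy⟩
      simp only [Prod.mk.injEq] at this ⊢
      exact ⟨this.1, by rw [← this.2]; simp⟩
  knot := by
    intro a b
    refine (D.knot a b).mono ?_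
    rintro a b ⟨x, k, h, h'⟩
    have e : k - 1 + 2 + 1 = k + 2 := by clear h h'; revert k; decide
    exact ⟨x, k - 1, by simpa using h, by rw [← h', ← e]⟩
  corner_surjective := by
    intro F
    obtain ⟨x, k, h⟩ := D.corner_surjective F
    exact ⟨x, k - 1, by simpa using h⟩
  corner_eq_iff := by
    have key : ∀ (pd pd' : D.Crossing → Fin 4 → D.Arc) (t : Fin 4),
        (∀ x k, pd' x k = pd x (k + t)) → ∀ d e, Relation.EqvGen (CornerStep pd') d e →
          Relation.EqvGen (CornerStep pd) (d.1, d.2 + t) (e.1, e.2 + t) := by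
      intro pd pd' t hpd d e h
      induction h with
      | rel d e h =>
        obtain ⟨h1, h2⟩ := h
        refine .rel _ _ ⟨?_, fun h3 => h2 ?_⟩
        · rw [hpd, hpd] at h1
          rw [← h1]; congr 1; exact add_right_comm _ _ _
        · simp only [Prod.mk.injEq] at h3
          refine Prod.ext h3.1 ?_
          have := h3.2
          rw [add_right_comm] at this
          exact add_right_cancel this
      | refl d => exact .refl _
      | symm d e _ ih => exact .symm _ _ ih
      | trans d e f _ _ ih ih' => exact .trans _ _ _ ih ih'
    intro d e
    rw [D.corner_eq_iff (d.1, d.2 + 1) (e.1, e.2 + 1)]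
    constructor
    · intro h
      have := key (fun x k => D.pd x (k + 1)) D.pd (-1) (by intro x k; simp) _ _ h
      simpa using this
    · exact key _ _ 1 (fun _ _ => rfl) d e
  planar := D.planar

/-! ### The multisum -/

section

variable (D : AlternatingKnotDiagram)

/-- The `A`-coloured faces are those which the overpassing strand sweeps out when it is rotated
counterclockwise; all other faces are coloured `B`.  Along an arc an `A`-face meets a `B`-face. -/
def IsA (F : D.Region) : Prop := ∃ x, D.corner x 1 = F ∨ D.corner x 3 = F

instance : DecidablePred D.IsA := fun F => by unfold IsA; infer_instance

/-- The arc `a` lies on the boundary of the face `F`. -/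
def Bounds (a : D.Arc) (F : D.Region) : Prop :=
  ∃ x k, D.pd x k = a ∧ (D.corner x k = F ∨ D.corner x (k - 1) = F)

instance (a : D.Arc) (F : D.Region) : Decidable (D.Bounds a F) := by
  unfold Bounds; infer_instance

/-- The crossing `x` is a vertex of the face `F`. -/
def Incident (x : D.Crossing) (F : D.Region) : Prop := ∃ k, D.corner x k = F

instance (x : D.Crossing) (F : D.Region) : Decidable (D.Incident x F) := by
  unfold Incident; infer_instance

/-- `e(F)`, the number of edges of a face. -/
def edgeCount (F : D.Region) : ℕ := (Finset.univ.filter fun a => D.Bounds a F).card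

/-- `cv(F, G)`, the number of common vertices. -/
def commonVertices (F G : D.Region) : ℕ :=
  (Finset.univ.filter fun x => D.Incident x F ∧ D.Incident x G).card

/-- `ce(F, G)`, the number of common edges. -/
def commonEdges (F G : D.Region) : ℕ :=
  (Finset.univ.filter fun a => D.Bounds a F ∧ D.Bounds a G).card

/-- `2 L(F)`, where `L(F) = 1` for a `B`-face and `L(F) = e(F) / 2 - 1` for an `A`-face. -/
def twoL (F : D.Region) : ℤ := if D.IsA F then (D.edgeCount F : ℤ) - 2 else 2

/-- The matrix `Q(F, G)`. -/
def Q (F G : D.Region) : ℤ :=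
  if F = G then (if D.IsA F then (D.edgeCount F : ℤ) else 0)
  else if D.IsA F ∧ D.IsA G then 0
  else if ¬ D.IsA F ∧ ¬ D.IsA G then (D.commonVertices F G : ℤ)
  else (D.commonEdges F G : ℤ)

/-- `2 L'(s)`. -/
def twoL' (s : D.Region → ℤ) : ℤ := ∑ F, D.twoL F * s F

/-- `2 Q'(s)`. -/
def twoQ' (s : D.Region → ℤ) : ℤ := ∑ F, ∑ G, D.Q F G * s F * s G

/-- `Q'(s) + L'(s)`; the division by two is exact, see `two_mul_exponent`. -/
def exponent (s : D.Region → ℤ) : ℤ := (D.twoQ' s + D.twoL' s) / 2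

/-- `s(a)`, the sum of the variables of the two faces adjacent to the arc `a`. -/
def edgeValue (s : D.Region → ℤ) (a : D.Arc) : ℤ :=
  ∑ F ∈ Finset.univ.filter (fun F => D.Bounds a F), s F

/-- The number of faces of the colour of the exterior that share an edge with `F`. -/
def neighbours (F : D.Region) : ℕ :=
  (Finset.univ.filter fun G => (D.IsA G ↔ D.IsA D.exterior) ∧ 0 < D.commonEdges F G).card

/-- The same number, not counting the exterior. -/
def innerNeighbours (F : D.Region) : ℕ :=
  (Finset.univ.filter fun G => G ≠ D.exterior ∧ (D.IsA G ↔ D.IsA D.exterior) ∧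
    0 < D.commonEdges F G).card

/-- The faces that are allowed as the choice `F*`: of the colour opposite to the exterior, with the
maximal number of neighbours and, among those, with the maximal number of inner neighbours. -/
def IsBase (F : D.Region) : Prop :=
  ¬ (D.IsA F ↔ D.IsA D.exterior) ∧
    ∀ G, ¬ (D.IsA G ↔ D.IsA D.exterior) →
      D.neighbours G < D.neighbours F ∨
        (D.neighbours G = D.neighbours F ∧ D.innerNeighbours G ≤ D.innerNeighbours F)

/-- The index set `Λ` of the multisum, for a chosen face `F*`. -/
def Lam (Fstar : D.Region) : Set (D.Region → ℤ) :=
  {s | s D.exterior = 0 ∧ s Fstar = 0 ∧ ∀ a, 0 ≤ D.edgeValue s a}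

end

end AlternatingKnotDiagram

/-- `(q)_n = (1 - q) (1 - q²) ⋯ (1 - qⁿ)`. -/
def qPoch (q : ℂ) (n : ℕ) : ℂ := ∏ k ∈ Finset.range n, (1 - q ^ (k + 1))

/-- `(q)_∞`. -/
def qPochInf (q : ℂ) : ℂ := ∏' k : ℕ, (1 - q ^ (k + 1))

/-- The sign `ε_b(n)`. -/
def epsilon (b : ℕ) (n : ℤ) : ℂ :=
  if Odd b then (-1) ^ n else if 0 ≤ n then 1 else -1

/-- `h_b(q) = ∑_{n ∈ ℤ} ε_b(n) q ^ (b n (n + 1) / 2 - n)`. -/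
def hSeries (b : ℕ) (q : ℂ) : ℂ := ∑' n : ℤ, epsilon b n * q ^ ((b : ℤ) * (n * (n + 1) / 2) - n)

namespace AlternatingKnotDiagram

section

variable (D : AlternatingKnotDiagram)

/-- The summand of the multisum. -/
def term (q : ℂ) (s : D.Region → ℤ) : ℂ :=
  (-1) ^ D.twoL' s * q ^ D.exponent s / ∏ a, qPoch q (D.edgeValue s a).toNat

/-- The `q`-multisum `Φ(q)` of the diagram, for a chosen face `F*`. -/
def Phi (Fstar : D.Region) (q : ℂ) : ℂ :=
  qPochInf q ^ Fintype.card D.Crossing * ∑' s : D.Lam Fstar, D.term q s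

/-- For every allowed choice of `F*` and every `|q| < 1` the multisum converges absolutely and
`Φ(q) = f(q)`. -/
def PhiEq (f : ℂ → ℂ) : Prop :=
  ∀ Fstar, D.IsBase Fstar → ∀ q : ℂ, ‖q‖ < 1 →
    Summable (fun s : D.Lam Fstar => D.term q s) ∧ D.Phi Fstar q = f q

theorem Q_symm (F G : D.Region) : D.Q F G = D.Q G F := by
  unfold Q commonVertices commonEdges
  by_cases hFG : F = G
  · subst hFG; rfl
  · simp only [hFG, Ne.symm hFG, if_false, and_comm]

theorem two_mul_exponent (s : D.Region → ℤ) : 2 * D.exponent s = D.twoQ' s + D.twoL' s := by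
  refine Int.mul_ediv_cancel' ?_
  have h1 : ((D.twoQ' s : ℤ) : ZMod 2) = ∑ F, ((D.Q F F * s F * s F : ℤ) : ZMod 2) := by
    unfold twoQ'
    push_cast
    rw [← Finset.sum_product', ← Finset.sum_filter_add_sum_filter_not _
      (fun p : D.Region × D.Region => p.1 = p.2)]
    have h0 : ∑ p ∈ (Finset.univ ×ˢ Finset.univ).filter
        (fun p : D.Region × D.Region => ¬ p.1 = p.2),
        ((D.Q p.1 p.2 : ZMod 2) * (s p.1 : ZMod 2) * (s p.2 : ZMod 2)) = 0 := by
      refine Finset.sum_involution (fun p _ => (p.2, p.1)) ?_ ?_ ?_ ?_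
      · rintro ⟨F, G⟩ _
        dsimp only
        rw [D.Q_symm G F, mul_right_comm]
        exact CharTwo.add_self_eq_zero _
      · rintro ⟨F, G⟩ hp _ h
        simp only [Finset.mem_filter] at hp
        exact hp.2 (Prod.mk.inj h).2
      · rintro ⟨F, G⟩ hp
        simp only [Finset.mem_filter, Finset.mem_product, Finset.mem_univ, true_and] at hp ⊢
        exact fun h => hp h.symm
      · rintro ⟨F, G⟩ _; rfl
    rw [h0, add_zero]
    refine (Finset.sum_bij (fun F _ => (F, F)) ?_ ?_ ?_ ?_).symm
    · intro F _; simp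
    · intro F _ G _ h; exact (Prod.mk.inj h).1
    · rintro ⟨F, G⟩ h
      simp only [Finset.mem_filter] at h
      exact ⟨F, Finset.mem_univ _, by rw [h.2]⟩
    · intro F _; rfl
  have h2 : (((D.twoQ' s + D.twoL' s : ℤ)) : ZMod 2) = 0 := by
    rw [Int.cast_add, h1]
    unfold twoL'
    rw [Int.cast_sum, ← Finset.sum_add_distrib]
    refine Finset.sum_eq_zero fun F _ => ?_
    rw [← Int.cast_add]
    refine (ZMod.intCast_zmod_eq_zero_iff_dvd _ 2).2 (even_iff_two_dvd.1 ?_)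
    unfold Q twoL
    by_cases hF : D.IsA F
    · simp only [hF, if_true]
      have : (D.edgeCount F : ℤ) * s F * s F + ((D.edgeCount F : ℤ) - 2) * s F
          = D.edgeCount F * (s F * (s F + 1)) - 2 * s F := by ring
      rw [this]
      exact ((Int.even_mul_succ_self _).mul_left _).sub (even_two_mul _)
    · simp [hF]
  exact_mod_cast (ZMod.intCast_zmod_eq_zero_iff_dvd _ 2).1 h2

end

/-! ### The diagrams -/

/-- The other end of the arc after a corner, by search through a finite code. -/
def nextCorner {c n : ℕ} (pd : Fin c → Fin 4 → Fin n) (d : Fin c × Fin 4) : Fin c × Fin 4 :=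
  (((List.finRange c).product (List.finRange 4)).find?
    (fun e => decide (pd d.1 (d.2 + 1) = pd e.1 e.2 ∧ (d.1, d.2 + 1) ≠ e))).getD d

/-- Decidable conditions under which a finite code with labelled faces is a knot diagram. -/
def IsPD {c n r : ℕ} [NeZero n] (pd : Fin c → Fin 4 → Fin n) (corner : Fin c → Fin 4 → Fin r) :
    Prop :=
  (∀ a, ∃ e : Fin c × Fin 4, ((e.2 = 0 ∨ e.2 = 2) ∧ pd e.1 e.2 = a) ∧
    ∀ e' : Fin c × Fin 4, ((e'.2 = 0 ∨ e'.2 = 2) ∧ pd e'.1 e'.2 = a) → e' = e) ∧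
  (∀ a, ∃ e : Fin c × Fin 4, ((e.2 = 1 ∨ e.2 = 3) ∧ pd e.1 e.2 = a) ∧
    ∀ e' : Fin c × Fin 4, ((e'.2 = 1 ∨ e'.2 = 3) ∧ pd e'.1 e'.2 = a) → e' = e) ∧
  (∀ a : Fin n, ∃ x k, pd x k = a ∧ pd x (k + 2) = a + 1) ∧
  (∀ d e : Fin c × Fin 4, pd d.1 (d.2 + 1) = pd e.1 e.2 ∧ (d.1, d.2 + 1) ≠ e →
    corner d.1 d.2 = corner e.1 e.2) ∧
  (∀ d : Fin c × Fin 4, pd d.1 (d.2 + 1) = pd (nextCorner pd d).1 (nextCorner pd d).2 ∧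
    (d.1, d.2 + 1) ≠ nextCorner pd d) ∧
  (∀ F : Fin r, ∃ d : Fin c × Fin 4, corner d.1 d.2 = F ∧
    ∀ e : Fin c × Fin 4, corner e.1 e.2 = F → ∃ m : Fin r, (nextCorner pd)^[m] d = e) ∧
  r = c + 2

instance {c n r : ℕ} [NeZero n] (pd : Fin c → Fin 4 → Fin n) (corner : Fin c → Fin 4 → Fin r) :
    Decidable (IsPD pd corner) := by
  unfold IsPD
  repeat' refine @instDecidableAnd _ _ ?_ ?_
  all_goals infer_instance

/-- The diagram of a finite code whose arcs are numbered along the knot. -/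
def ofPD {c n r : ℕ} [NeZero n] (pd : Fin c → Fin 4 → Fin n) (corner : Fin c → Fin 4 → Fin r)
    (exterior : Fin r) (hpd : IsPD pd corner) : AlternatingKnotDiagram where
  Crossing := Fin c
  Arc := Fin n
  Region := Fin r
  pd := pd
  corner := corner
  exterior := exterior
  under_end := hpd.1
  over_end := hpd.2.1
  knot := by
    have h3 := hpd.2.2.1
    have h0 : ∀ (m : ℕ) (a : Fin n), a.val = m → Relation.EqvGen (ArcStep pd) 0 a := by
      intro m
      induction m with
      | zero =>
        intro a ha
        have : a = 0 := Fin.ext (by simpa using ha)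
        rw [this]; exact .refl _
      | succ m ih =>
        intro a ha
        have hm : m < n := by have := a.isLt; omega
        have hb := ih ⟨m, hm⟩ rfl
        obtain ⟨x, k, h, h'⟩ := h3 ⟨m, hm⟩
        refine .trans _ _ _ hb (.rel _ _ ⟨x, k, h, h'.trans ?_⟩)
        have hlt : m + 1 < n := by have := a.isLt; omega
        apply Fin.ext
        rw [ha, Fin.val_add]
        simp only [Fin.val_one']
        rw [Nat.add_mod_mod]
        exact Nat.mod_eq_of_lt hlt
    intro a b
    exact .trans _ _ _ (.symm _ _ (h0 _ a rfl)) (h0 _ b rfl)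
  corner_surjective := fun F => by
    obtain ⟨d, hd, _⟩ := hpd.2.2.2.2.2.1 F
    exact ⟨d.1, d.2, hd⟩
  corner_eq_iff := by
    obtain ⟨_, _, _, h4, h5, h6, _⟩ := hpd
    intro d e
    constructor
    · intro h
      obtain ⟨b, _, hb⟩ := h6 (corner e.1 e.2)
      have reach : ∀ m, Relation.EqvGen (CornerStep pd) b ((nextCorner pd)^[m] b) := by
        intro m
        induction m with
        | zero => exact .refl _
        | succ m ih =>
          rw [Function.iterate_succ_apply']
          exact .trans _ _ _ ih (.rel _ _ (h5 _))
      obtain ⟨m, hm⟩ := hb d h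
      obtain ⟨m', hm'⟩ := hb e rfl
      have r1 := reach m
      have r2 := reach m'
      rw [hm] at r1
      rw [hm'] at r2
      exact .trans _ _ _ (.symm _ _ r1) r2
    · intro h
      induction h with
      | rel d e h => exact h4 d e h
      | refl d => rfl
      | symm d e _ ih => exact ih.symm
      | trans d e f _ _ ih ih' => exact ih.trans ih'
  planar := by simp only [Fintype.card_fin]; exact hpd.2.2.2.2.2.2

end AlternatingKnotDiagram

/-- The standard diagram of the left-handed torus knot `T(2, 2p + 1)`: the crossings lie on a circle,
consecutive crossings `x` and `x + 1` are joined by an outer arc `(x, true)` and an inner arc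
`(x, false)`, which bound the bigon `inr x`; the remaining faces are the exterior `inl true` and the
central face `inl false`. -/
def torusKnot (p : ℕ) : AlternatingKnotDiagram where
  Crossing := ZMod (2 * p + 1)
  Arc := ZMod (2 * p + 1) × Bool
  Region := Bool ⊕ ZMod (2 * p + 1)
  pd x := ![(x - 1, false), (x - 1, true), (x, true), (x, false)]
  corner x := ![.inr (x - 1), .inl true, .inr x, .inl false]
  exterior := .inl true
  under_end := by
    rintro ⟨a, _ | _⟩
    · refine ⟨(a + 1, 0), by simp, ?_⟩
      rintro ⟨x, k⟩ ⟨hk, h⟩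
      dsimp only at hk h
      rcases hk with rfl | rfl
      · simp at h; simp [← h]
      · simp at h
    · refine ⟨(a, 2), by simp, ?_⟩
      rintro ⟨x, k⟩ ⟨hk, h⟩
      dsimp only at hk h
      rcases hk with rfl | rfl
      · simp at h
      · simp at h; simp [← h]
  over_end := by
    rintro ⟨a, _ | _⟩
    · refine ⟨(a, 3), by simp, ?_⟩
      rintro ⟨x, k⟩ ⟨hk, h⟩
      dsimp only at hk h
      rcases hk with rfl | rfl
      · simp at h
      · simp at h; simp [← h]
    · refine ⟨(a + 1, 1), by simp, ?_⟩
      rintro ⟨x, k⟩ ⟨hk, h⟩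
      dsimp only at hk h
      rcases hk with rfl | rfl
      · simp at h; simp [← h]
      · simp at h
  knot := by
    set pd : ZMod (2 * p + 1) → Fin 4 → ZMod (2 * p + 1) × Bool :=
      fun x => ![(x - 1, false), (x - 1, true), (x, true), (x, false)] with hpd
    have step : ∀ x b, ArcStep pd (x, b) (x + 1, !b) := by
      rintro x (_ | _)
      · exact ⟨x + 1, 0, by simp [hpd], by simp [hpd]⟩
      · exact ⟨x + 1, 1, by simp [hpd], by simp [hpd]⟩
    have walk : ∀ (m : ℕ) x b,
        Relation.EqvGen (ArcStep pd) (x, b) (x + m, (Nat.bodd m).xor b) := by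
      intro m x b
      induction m with
      | zero => simpa using Relation.EqvGen.refl _
      | succ m ih =>
        refine .trans _ _ _ ih ?_
        have := step (x + m) ((Nat.bodd m).xor b)
        have e1 : x + (m : ZMod (2 * p + 1)) + 1 = x + ((m + 1 : ℕ) : ZMod (2 * p + 1)) := by
          push_cast; ring
        have e2 : (!((Nat.bodd m).xor b)) = (Nat.bodd (m + 1)).xor b := by
          rw [Nat.bodd_succ]; cases Nat.bodd m <;> cases b <;> rfl
        rw [e1, e2] at this
        exact .rel _ _ this
    have flip : ∀ x b, Relation.EqvGen (ArcStep pd) (x, b) (x, !b) := by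
      intro x b
      have := walk (2 * p + 1) x b
      have e : Nat.bodd (2 * p + 1) = true := by simp [Nat.bodd_succ, Nat.bodd_mul]
      rw [e, ZMod.natCast_self, add_zero] at this
      simpa using this
    have same : ∀ x b b', Relation.EqvGen (ArcStep pd) (x, b) (x, b') := by
      intro x b b'
      by_cases hb : b' = b
      · rw [hb]; exact .refl _
      · have : b' = !b := by cases b <;> cases b' <;> simp_all
        rw [this]; exact flip x b
    rintro ⟨a, b⟩ ⟨a', b'⟩
    have h1 := walk (a' - a).val a b
    rw [ZMod.natCast_zmod_val, add_sub_cancel] at h1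
    exact .trans _ _ _ h1 (same _ _ _)
  corner_surjective := by
    rintro ((_ | _) | x)
    · exact ⟨0, 3, rfl⟩
    · exact ⟨0, 1, rfl⟩
    · exact ⟨x, 2, rfl⟩
  corner_eq_iff := by
    set pd : ZMod (2 * p + 1) → Fin 4 → ZMod (2 * p + 1) × Bool :=
      fun x => ![(x - 1, false), (x - 1, true), (x, true), (x, false)] with hpd
    set corner : ZMod (2 * p + 1) → Fin 4 → Bool ⊕ ZMod (2 * p + 1) :=
      fun x => ![.inr (x - 1), .inl true, .inr x, .inl false] with hcorner
    have inv : ∀ d e, Relation.EqvGen (CornerStep pd) d e → corner d.1 d.2 = corner e.1 e.2 := by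
      intro d e h
      induction h with
      | rel d e h =>
        revert h
        obtain ⟨x, k⟩ := d
        obtain ⟨y, l⟩ := e
        rintro ⟨h1, h2⟩
        fin_cases k <;> fin_cases l <;> simp [hpd] at h1 h2 <;> simp [hcorner, h1] <;> simp_all
      | refl d => rfl
      | symm d e _ ih => exact ih.symm
      | trans d e f _ _ ih ih' => exact ih.trans ih'
    have s1 : ∀ x, CornerStep pd (x, 1) (x + 1, 1) := fun x => ⟨by simp [hpd], by simp⟩
    have s2 : ∀ x, CornerStep pd (x, 2) (x + 1, 0) := fun x => ⟨by simp [hpd], by simp⟩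
    have s3 : ∀ x, CornerStep pd (x + 1, 3) (x, 3) := fun x => ⟨by simp [hpd], by simp⟩
    have w1 : ∀ (m : ℕ) x, Relation.EqvGen (CornerStep pd) (x, 1) (x + m, 1) := by
      intro m x
      induction m with
      | zero => simpa using Relation.EqvGen.refl _
      | succ m ih =>
        have := s1 (x + m)
        rw [add_assoc, ← Nat.cast_succ] at this
        exact .trans _ _ _ ih (.rel _ _ this)
    have w3 : ∀ (m : ℕ) x, Relation.EqvGen (CornerStep pd) (x, 3) (x + m, 3) := by
      intro m x
      induction m with
      | zero => simpa using Relation.EqvGen.refl _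
      | succ m ih =>
        have := s3 (x + m)
        rw [add_assoc, ← Nat.cast_succ] at this
        exact .trans _ _ _ ih (.symm _ _ (.rel _ _ this))
    have v1 : ∀ x y, Relation.EqvGen (CornerStep pd) (x, 1) (y, 1) := by
      intro x y
      have := w1 (y - x).val x
      rwa [ZMod.natCast_zmod_val, add_sub_cancel] at this
    have v3 : ∀ x y, Relation.EqvGen (CornerStep pd) (x, 3) (y, 3) := by
      intro x y
      have := w3 (y - x).val x
      rwa [ZMod.natCast_zmod_val, add_sub_cancel] at this
    have v0 : ∀ x, Relation.EqvGen (CornerStep pd) (x - 1, 2) (x, 0) := by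
      intro x
      have := s2 (x - 1)
      rw [sub_add_cancel] at this
      exact .rel _ _ this
    rintro ⟨x, k⟩ ⟨y, l⟩
    constructor
    · intro h
      fin_cases k <;> fin_cases l <;> simp at h
      · subst h; exact .refl _
      · subst h; exact .symm _ _ (v0 x)
      · exact v1 x y
      · subst h; exact v0 y
      · subst h; exact .refl _
      · exact v3 x y
    · exact inv _ _
  planar := by simp [ZMod.card]; ring

/-- The planar diagram code of `twistDiagram`. -/
def twistPD (m : ℕ) : Fin m ⊕ Bool → Fin 4 → (Fin (m + 1) × Bool) ⊕ Bool
  | .inl x => ![.inl (x.castSucc, false), .inl (x.castSucc, true),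
      .inl (x.succ, true), .inl (x.succ, false)]
  | .inr true => ![.inr false, .inl (Fin.last m, true), .inl (0, true), .inr true]
  | .inr false => ![.inl (Fin.last m, false), .inr false, .inr true, .inl (0, false)]

/-- The faces at the corners of `twistDiagram`. -/
def twistCorner (m : ℕ) : Fin m ⊕ Bool → Fin 4 → Fin 3 ⊕ Fin (m + 1)
  | .inl x => ![.inr x.castSucc, .inl 0, .inr x.succ, .inl 1]
  | .inr true => ![.inr (Fin.last m), .inl 0, .inr 0, .inl 2]
  | .inr false => ![.inr (Fin.last m), .inl 2, .inr 0, .inl 1]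

theorem twist_last_ne {m : ℕ} (x : Fin m) : (Fin.last m = x.castSucc) = False :=
  eq_false (Fin.castSucc_lt_last x).ne'

theorem twist_zero_ne {m : ℕ} (x : Fin m) : (0 = x.succ) = False :=
  eq_false (Fin.succ_ne_zero x).symm

theorem twist_corner_of_step (m : ℕ) (d e : (Fin m ⊕ Bool) × Fin 4)
    (h : CornerStep (twistPD m) d e) : twistCorner m d.1 d.2 = twistCorner m e.1 e.2 := by
  revert h
  obtain ⟨x | _ | _, k⟩ := d <;> obtain ⟨y | _ | _, l⟩ := e <;> rintro ⟨h1, h2⟩ <;>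
    fin_cases k <;> fin_cases l <;> simp [twistPD] at h1 h2 <;> simp [twistCorner] <;>
      simp_all [twist_last_ne, twist_zero_ne]

theorem twist_step_of_corner (m : ℕ) (d e : (Fin m ⊕ Bool) × Fin 4)
    (h : twistCorner m d.1 d.2 = twistCorner m e.1 e.2) :
    Relation.EqvGen (CornerStep (twistPD m)) d e := by
  let nx : Bool → Fin (m + 1) → Fin m ⊕ Bool := fun b i =>
    Fin.lastCases (motive := fun _ => Fin m ⊕ Bool) (.inr b) (fun x => .inl x) i
  have nl : ∀ b, nx b (Fin.last m) = .inr b := fun b => Fin.lastCases_last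
  have nc : ∀ b (x : Fin m), nx b x.castSucc = .inl x := fun b x => Fin.lastCases_castSucc x
  have p1 : ∀ i, twistPD m (nx true i) 1 = .inl (i, true) := by
    intro i; induction i using Fin.lastCases <;> simp [nl, nc, twistPD]
  have p0 : ∀ i, twistPD m (nx false i) 0 = .inl (i, false) := by
    intro i; induction i using Fin.lastCases <;> simp [nl, nc, twistPD]
  have q0 : Relation.EqvGen (CornerStep (twistPD m)) (.inr false, 0) (.inr true, 0) :=
    .rel _ _ ⟨by simp [twistPD], by simp⟩
  have n0 : ∀ i, Relation.EqvGen (CornerStep (twistPD m)) (nx false i, 0) (nx true i, 0) := by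
    intro i
    induction i using Fin.lastCases with
    | last => rw [nl, nl]; exact q0
    | cast x => rw [nc, nc]; exact .refl _
  have ext : ∀ i, Relation.EqvGen (CornerStep (twistPD m)) (nx true i, 1) (.inr true, 1) := by
    intro i
    induction i using Fin.induction with
    | zero => exact .symm _ _ (.rel _ _ ⟨by rw [p1]; simp [twistPD], by simp⟩)
    | succ x ih =>
      rw [nc] at ih
      exact .trans _ _ _ (.symm _ _ (.rel _ _ ⟨by rw [p1]; simp [twistPD], by simp⟩)) ih
  have cen : ∀ i, Relation.EqvGen (CornerStep (twistPD m)) (nx false i, 3) (.inr false, 3) := by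
    intro i
    induction i using Fin.induction with
    | zero => exact .rel _ _ ⟨(p0 0).trans (by simp [twistPD]), by simp⟩
    | succ x ih =>
      rw [nc] at ih
      exact .trans _ _ _ (.rel _ _ ⟨(p0 x.succ).trans (by simp [twistPD]), by simp⟩) ih
  have two : Relation.EqvGen (CornerStep (twistPD m)) (.inr false, 2) (nx true 0, 0) :=
    .trans _ _ _ (.rel _ _ ⟨by rw [p0]; simp [twistPD], by simp⟩) (n0 0)
  let rep : Fin 3 ⊕ Fin (m + 1) → (Fin m ⊕ Bool) × Fin 4
    | .inl 0 => (.inr true, 1)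
    | .inl 1 => (.inr false, 3)
    | .inl 2 => (.inr true, 3)
    | .inr i => (nx true i, 0)
  have key : ∀ d, Relation.EqvGen (CornerStep (twistPD m)) d (rep (twistCorner m d.1 d.2)) := by
    rintro ⟨x | _ | _, k⟩ <;> fin_cases k
    · show Relation.EqvGen _ _ (nx true x.castSucc, 0)
      rw [nc]; exact .refl _
    · have := ext x.castSucc
      rwa [nc] at this
    · exact .trans _ _ _ (.rel _ _ ⟨by rw [p0]; simp [twistPD], by simp⟩) (n0 x.succ)
    · have := cen x.castSucc
      rwa [nc] at this
    · show Relation.EqvGen _ _ (nx true (Fin.last m), 0)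
      rw [nl]; exact q0
    · show Relation.EqvGen _ _ (Sum.inr true, 3)
      exact .symm _ _ (.rel _ _ ⟨by simp [twistPD], by simp⟩)
    · exact two
    · exact .refl _
    · show Relation.EqvGen _ _ (nx true (Fin.last m), 0)
      rw [nl]; exact .refl _
    · exact .refl _
    · exact .trans _ _ _ (.rel _ _ ⟨by simp [twistPD], by simp⟩) two
    · exact .refl _
  have h1 := key d
  rw [h] at h1
  exact .trans _ _ _ h1 (.symm _ _ (key e))

/-- A clasp of two crossings closing a chain of `m` crossings.  The diagram arises from a circular
chain of `m + 1` crossings, as in `torusKnot`, by replacing one crossing by two crossings which lie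
on the same radius: `inl 0, …, inl (m - 1)` is the chain, `inr true` and `inr false` are the outer and
the inner crossing of the clasp.  The arcs `inl (i, true)` and `inl (i, false)` are the outer and the
inner arcs between neighbouring crossings of the circle; the two arcs `inr _` join the crossings of
the clasp and bound the bigon `inl 2`.  The faces `inl 0` and `inl 1` are the exterior and the
central face, and `inr i` lies between the arcs `inl (i, true)` and `inl (i, false)`. -/
def twistDiagram (m : ℕ) : AlternatingKnotDiagram where
  Crossing := Fin m ⊕ Bool
  Arc := (Fin (m + 1) × Bool) ⊕ Bool
  Region := Fin 3 ⊕ Fin (m + 1)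
  pd := twistPD m
  corner := twistCorner m
  exterior := .inl 0
  under_end := by
    rintro (⟨i, _ | _⟩ | _ | _)
    · induction i using Fin.lastCases with
      | last =>
        refine ⟨(.inr false, 0), by simp [twistPD], ?_⟩
        rintro ⟨x | _ | _, k⟩ ⟨hk, h⟩ <;> rcases hk with hk | hk <;> simp only at hk <;>
          subst hk <;>
          simp_all [twistPD, twist_last_ne, twist_zero_ne]
      | cast x =>
        refine ⟨(.inl x, 0), by simp [twistPD], ?_⟩
        rintro ⟨x | _ | _, k⟩ ⟨hk, h⟩ <;> rcases hk with hk | hk <;> simp only at hk <;>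
          subst hk <;>
          simp_all [twistPD, twist_last_ne, twist_zero_ne]
    · induction i using Fin.cases with
      | zero =>
        refine ⟨(.inr true, 2), by simp [twistPD], ?_⟩
        rintro ⟨x | _ | _, k⟩ ⟨hk, h⟩ <;> rcases hk with hk | hk <;> simp only at hk <;>
          subst hk <;>
          simp_all [twistPD, twist_last_ne, twist_zero_ne]
      | succ x =>
        refine ⟨(.inl x, 2), by simp [twistPD], ?_⟩
        rintro ⟨x | _ | _, k⟩ ⟨hk, h⟩ <;> rcases hk with hk | hk <;> simp only at hk <;>
          subst hk <;>
          simp_all [twistPD, twist_last_ne, twist_zero_ne]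
    · refine ⟨(.inr true, 0), by simp [twistPD], ?_⟩
      rintro ⟨x | _ | _, k⟩ ⟨hk, h⟩ <;> rcases hk with hk | hk <;> simp only at hk <;>
        subst hk <;>
          simp_all [twistPD, twist_last_ne, twist_zero_ne]
    · refine ⟨(.inr false, 2), by simp [twistPD], ?_⟩
      rintro ⟨x | _ | _, k⟩ ⟨hk, h⟩ <;> rcases hk with hk | hk <;> simp only at hk <;>
        subst hk <;>
          simp_all [twistPD, twist_last_ne, twist_zero_ne]
  over_end := by
    rintro (⟨i, _ | _⟩ | _ | _)
    · induction i using Fin.cases with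
      | zero =>
        refine ⟨(.inr false, 3), by simp [twistPD], ?_⟩
        rintro ⟨x | _ | _, k⟩ ⟨hk, h⟩ <;> rcases hk with hk | hk <;> simp only at hk <;>
          subst hk <;>
          simp_all [twistPD, twist_last_ne, twist_zero_ne]
      | succ x =>
        refine ⟨(.inl x, 3), by simp [twistPD], ?_⟩
        rintro ⟨x | _ | _, k⟩ ⟨hk, h⟩ <;> rcases hk with hk | hk <;> simp only at hk <;>
          subst hk <;>
          simp_all [twistPD, twist_last_ne, twist_zero_ne]
    · induction i using Fin.lastCases with
      | last =>
        refine ⟨(.inr true, 1), by simp [twistPD], ?_⟩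
        rintro ⟨x | _ | _, k⟩ ⟨hk, h⟩ <;> rcases hk with hk | hk <;> simp only at hk <;>
          subst hk <;>
          simp_all [twistPD, twist_last_ne, twist_zero_ne]
      | cast x =>
        refine ⟨(.inl x, 1), by simp [twistPD], ?_⟩
        rintro ⟨x | _ | _, k⟩ ⟨hk, h⟩ <;> rcases hk with hk | hk <;> simp only at hk <;>
          subst hk <;>
          simp_all [twistPD, twist_last_ne, twist_zero_ne]
    · refine ⟨(.inr false, 1), by simp [twistPD], ?_⟩
      rintro ⟨x | _ | _, k⟩ ⟨hk, h⟩ <;> rcases hk with hk | hk <;> simp only at hk <;>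
        subst hk <;>
          simp_all [twistPD, twist_last_ne, twist_zero_ne]
    · refine ⟨(.inr true, 3), by simp [twistPD], ?_⟩
      rintro ⟨x | _ | _, k⟩ ⟨hk, h⟩ <;> rcases hk with hk | hk <;> simp only at hk <;>
        subst hk <;>
          simp_all [twistPD, twist_last_ne, twist_zero_ne]
  knot := by
    have h0 : ∀ i b, Relation.EqvGen (ArcStep (twistPD m)) (.inl (i, b)) (.inr false) := by
      intro i
      induction i using Fin.induction with
      | zero =>
        rintro (_ | _)
        · exact .rel _ _ ⟨.inr false, 3, rfl, rfl⟩
        · exact .rel _ _ ⟨.inr true, 2, rfl, rfl⟩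
      | succ x ih =>
        rintro (_ | _)
        · exact .trans _ _ _ (.rel _ _ ⟨.inl x, 3, rfl, rfl⟩) (ih true)
        · exact .trans _ _ _ (.rel _ _ ⟨.inl x, 2, rfl, rfl⟩) (ih false)
    have h1 : ∀ a, Relation.EqvGen (ArcStep (twistPD m)) a (.inr false) := by
      rintro (⟨i, b⟩ | _ | _)
      · exact h0 i b
      · exact .refl _
      · exact .trans _ _ _ (.rel _ _ ⟨.inr true, 3, rfl, rfl⟩) (h0 (Fin.last m) true)
    intro a b
    exact .trans _ _ _ (h1 a) (.symm _ _ (h1 b))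
  corner_surjective := by
    rintro (i | i)
    · fin_cases i
      · exact ⟨.inr true, 1, rfl⟩
      · exact ⟨.inr false, 3, rfl⟩
      · exact ⟨.inr true, 3, rfl⟩
    · induction i using Fin.lastCases with
      | last => exact ⟨.inr true, 0, rfl⟩
      | cast x => exact ⟨.inl x, 0, rfl⟩
  corner_eq_iff := by
    intro d e
    refine ⟨twist_step_of_corner m d e, fun h => ?_⟩
    induction h with
    | rel d e h => exact twist_corner_of_step m d e h
    | refl d => rfl
    | symm d e _ ih => exact ih.symm
    | trans d e f _ _ ih ih' => exact ih.trans ih'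
  planar := by simp; ring

/-- The twist knot `K_p`, `p ≠ 0`: a clasp and a twist region which has `2p - 1` crossings for
`p > 0` and `2|p|` crossings for `p < 0`. -/
def twistKnot (p : ℤ) : AlternatingKnotDiagram :=
  if 0 < p then twistDiagram (2 * p.natAbs - 1) else twistDiagram (2 * p.natAbs)

/-! The knots `3_1, 5_1, 7_1` are the torus knots `T(2, 3), T(2, 5), T(2, 7)`, and
`4_1, 5_2, 6_1, 7_2, 8_1` are twist knots.  The remaining knots are given by planar diagram codes; the
second table lists the faces at the corners, the `A`-faces first, and face `0` is the exterior. -/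

def knot_3_1 : AlternatingKnotDiagram := torusKnot 1

def knot_4_1 : AlternatingKnotDiagram := twistKnot (-1)

def knot_5_1 : AlternatingKnotDiagram := torusKnot 2

def knot_5_2 : AlternatingKnotDiagram := twistKnot 2

def knot_6_1 : AlternatingKnotDiagram := twistKnot (-2)

def knot_7_1 : AlternatingKnotDiagram := torusKnot 3

def knot_7_2 : AlternatingKnotDiagram := twistKnot 3

def knot_8_1 : AlternatingKnotDiagram := twistKnot (-3)

def knot_6_2 : AlternatingKnotDiagram :=
  AlternatingKnotDiagram.ofPD (c := 6) (n := 12) (r := 8)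
    ![![0, 3, 1, 4], ![2, 8, 3, 7], ![4, 9, 5, 10],
      ![6, 11, 7, 0], ![8, 2, 9, 1], ![10, 5, 11, 6]]
    ![![3, 1, 4, 2], ![5, 1, 3, 0], ![4, 0, 6, 2],
      ![7, 0, 3, 2], ![5, 0, 4, 1], ![6, 0, 7, 2]]
    0 (by decide +kernel)

def knot_6_3 : AlternatingKnotDiagram :=
  AlternatingKnotDiagram.ofPD (c := 6) (n := 12) (r := 8)
    ![![0, 4, 1, 3], ![2, 8, 3, 7], ![4, 9, 5, 10],
      ![6, 2, 7, 1], ![8, 11, 9, 0], ![10, 5, 11, 6]]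
    ![![4, 0, 5, 1], ![6, 1, 5, 2], ![4, 3, 7, 0],
      ![6, 2, 5, 0], ![6, 3, 4, 1], ![7, 3, 6, 0]]
    0 (by decide +kernel)

def knot_7_3 : AlternatingKnotDiagram :=
  AlternatingKnotDiagram.ofPD (c := 7) (n := 14) (r := 9)
    ![![0, 5, 1, 6], ![2, 9, 3, 10], ![4, 11, 5, 12], ![6, 13, 7, 0],
      ![8, 1, 9, 2], ![10, 3, 11, 4], ![12, 7, 13, 8]]
    ![![4, 0, 5, 1], ![6, 0, 7, 2], ![8, 0, 4, 2], ![5, 3, 4, 1],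
      ![5, 0, 6, 2], ![7, 0, 8, 2], ![4, 3, 5, 2]]
    0 (by decide +kernel)

def knot_7_4 : AlternatingKnotDiagram :=
  AlternatingKnotDiagram.ofPD (c := 7) (n := 14) (r := 9)
    ![![0, 6, 1, 5], ![2, 10, 3, 9], ![4, 12, 5, 11], ![6, 0, 7, 13],
      ![8, 4, 9, 3], ![10, 2, 11, 1], ![12, 8, 13, 7]]
    ![![3, 0, 4, 1], ![5, 0, 6, 2], ![7, 1, 4, 2], ![3, 1, 8, 0],
      ![7, 2, 6, 0], ![5, 2, 4, 0], ![7, 0, 8, 1]]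
    0 (by decide +kernel)

def knot_7_5 : AlternatingKnotDiagram :=
  AlternatingKnotDiagram.ofPD (c := 7) (n := 14) (r := 9)
    ![![0, 7, 1, 8], ![2, 11, 3, 12], ![4, 13, 5, 0], ![6, 9, 7, 10],
      ![8, 1, 9, 2], ![10, 5, 11, 6], ![12, 3, 13, 4]]
    ![![4, 1, 5, 0], ![6, 2, 7, 0], ![8, 2, 4, 0], ![6, 1, 4, 3],
      ![5, 1, 6, 0], ![4, 2, 6, 3], ![7, 2, 8, 0]]
    0 (by decide +kernel)

def knot_7_6 : AlternatingKnotDiagram :=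
  AlternatingKnotDiagram.ofPD (c := 7) (n := 14) (r := 9)
    ![![0, 3, 1, 4], ![2, 11, 3, 12], ![4, 10, 5, 9], ![6, 13, 7, 0],
      ![8, 6, 9, 5], ![10, 1, 11, 2], ![12, 7, 13, 8]]
    ![![4, 1, 5, 2], ![6, 1, 4, 0], ![5, 0, 7, 2], ![8, 3, 4, 2],
      ![8, 2, 7, 0], ![5, 1, 6, 0], ![4, 3, 8, 0]]
    0 (by decide +kernel)

def knot_7_7 : AlternatingKnotDiagram :=
  AlternatingKnotDiagram.ofPD (c := 7) (n := 14) (r := 9)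
    ![![0, 3, 1, 4], ![2, 10, 3, 9], ![4, 7, 5, 8], ![6, 12, 7, 11],
      ![8, 13, 9, 0], ![10, 2, 11, 1], ![12, 6, 13, 5]]
    ![![4, 1, 5, 2], ![6, 1, 4, 0], ![5, 3, 7, 2], ![8, 3, 5, 0],
      ![7, 0, 4, 2], ![6, 0, 5, 1], ![8, 0, 7, 3]]
    0 (by decide +kernel)

def knot_8_2 : AlternatingKnotDiagram :=
  AlternatingKnotDiagram.ofPD (c := 8) (n := 16) (r := 10)
    ![![0, 3, 1, 4], ![2, 10, 3, 9], ![4, 11, 5, 12], ![6, 13, 7, 14],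
      ![8, 15, 9, 0], ![10, 2, 11, 1], ![12, 5, 13, 6], ![14, 7, 15, 8]]
    ![![3, 1, 4, 2], ![5, 1, 3, 0], ![4, 0, 6, 2], ![7, 0, 8, 2],
      ![9, 0, 3, 2], ![5, 0, 4, 1], ![6, 0, 7, 2], ![8, 0, 9, 2]]
    0 (by decide +kernel)

def knot_8_3 : AlternatingKnotDiagram :=
  AlternatingKnotDiagram.ofPD (c := 8) (n := 16) (r := 10)
    ![![0, 6, 1, 5], ![2, 11, 3, 12], ![4, 9, 5, 10], ![6, 0, 7, 15],
      ![8, 14, 9, 13], ![10, 3, 11, 4], ![12, 1, 13, 2], ![14, 8, 15, 7]]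
    ![![5, 0, 6, 1], ![7, 2, 6, 3], ![7, 1, 6, 4], ![5, 1, 8, 0],
      ![9, 1, 7, 0], ![6, 2, 7, 4], ![6, 0, 7, 3], ![9, 0, 8, 1]]
    0 (by decide +kernel)

def knot_8_4 : AlternatingKnotDiagram :=
  AlternatingKnotDiagram.ofPD (c := 8) (n := 16) (r := 10)
    ![![0, 5, 1, 6], ![2, 12, 3, 11], ![4, 10, 5, 9], ![6, 15, 7, 0],
      ![8, 13, 9, 14], ![10, 2, 11, 1], ![12, 4, 13, 3], ![14, 7, 15, 8]]
    ![![7, 0, 8, 1], ![9, 2, 8, 3], ![9, 0, 7, 4], ![8, 5, 7, 1],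
      ![8, 4, 7, 6], ![9, 3, 8, 0], ![9, 4, 8, 2], ![7, 5, 8, 6]]
    0 (by decide +kernel)

def knot_8_5 : AlternatingKnotDiagram :=
  AlternatingKnotDiagram.ofPD (c := 8) (n := 16) (r := 10)
    ![![0, 5, 1, 6], ![2, 10, 3, 9], ![4, 15, 5, 0], ![6, 11, 7, 12],
      ![8, 13, 9, 14], ![10, 2, 11, 1], ![12, 7, 13, 8], ![14, 3, 15, 4]]
    ![![3, 1, 4, 0], ![5, 1, 6, 2], ![7, 1, 3, 0], ![4, 2, 8, 0],
      ![9, 2, 6, 0], ![5, 2, 4, 1], ![8, 2, 9, 0], ![6, 1, 7, 0]]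
    0 (by decide +kernel)

end

/-!
The `B`-coloured faces and the crossings are the vertices and edges of a plane graph whose faces are
the `A`-coloured faces. It is assembled from one edge by attaching cells: a polygon adds a path of
`r` new vertices inside a face, a bigon doubles an edge. The edge at the start has `X` and `F^*`, in
one order or the other, as an end and as a face at its side, so that the sum over the variable of
its other end is `∑ q^n / (q)_n = 1 / (q)_∞`.

The summand of the multisum is the product of the weights of the cells, and the sum over the `r + 1`
variables of a polygon is `h_{r+2} / (q)_∞^{r+1}` whatever the values of the other variables.
Indeed, by Euler's first identity each vertex of the path contributes a factor `1 / (q)_∞` and one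
application of a fixed operator on sequences, and the sum over the variable of the face evaluates
the resulting sequence at `0`. The unit Bailey pair expands this evaluation in left eigenvectors of
the operator, and the sum over the eigenvalues is the theta series `h_{r+2}`. A bigon behaves like a
polygon with `r = 0`, and `h_2 = 1`. As the number of crossings is the total exponent of
`1 / (q)_∞`, `Φ_D` is the product of the `h_{r+2}` over the polygons.
-/

noncomputable section

open Filter Topology Finset Asymptotics

/-! ### Elementary `q`-series -/

section QSeries

variable {q : ℂ}

theorem qPoch_succ (q : ℂ) (n : ℕ) : qPoch q (n + 1) = qPoch q n * (1 - q ^ (n + 1)) := by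
  simp [qPoch, prod_range_succ]

@[simp] theorem qPoch_zero (q : ℂ) : qPoch q 0 = 1 := by simp [qPoch]

theorem qPoch_add (q : ℂ) (n j : ℕ) :
    qPoch q (n + j) = qPoch q n * ∏ l ∈ range j, (1 - q ^ (n + 1) * q ^ l) := by
  rw [qPoch, prod_range_add, ← qPoch]
  congr! 3
  ring

theorem one_sub_pow_ne_zero (hq : ‖q‖ < 1) (n : ℕ) : 1 - q ^ (n + 1) ≠ 0 := by
  have hlt : ‖q ^ (n + 1)‖ < 1 := by
    rw [norm_pow]
    exact pow_lt_one₀ (norm_nonneg _) hq n.succ_ne_zero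
  intro h
  simp [← sub_eq_zero.1 h] at hlt

theorem qPoch_ne_zero (hq : ‖q‖ < 1) (n : ℕ) : qPoch q n ≠ 0 :=
  prod_ne_zero_iff.2 fun k _ => one_sub_pow_ne_zero hq k

theorem one_sub_pow_mul_inv_qPoch_succ (hq : ‖q‖ < 1) (n : ℕ) :
    (1 - q ^ (n + 1)) * (qPoch q (n + 1))⁻¹ = (qPoch q n)⁻¹ := by
  rw [qPoch_succ, mul_inv, mul_comm, mul_assoc, inv_mul_cancel₀ (one_sub_pow_ne_zero hq n), mul_one]

theorem summable_norm_pow_succ (hq : ‖q‖ < 1) : Summable fun k : ℕ => ‖q ^ (k + 1)‖ := by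
  simp only [norm_pow]
  exact (summable_nat_add_iff 1).2 (summable_geometric_of_lt_one (norm_nonneg _) hq)

theorem tendsto_qPoch (hq : ‖q‖ < 1) : Tendsto (qPoch q) atTop (𝓝 (qPochInf q)) := by
  have h : Multipliable fun k : ℕ => (1 - q ^ (k + 1)) := by
    simpa [sub_eq_add_neg] using
      multipliable_one_add_of_summable (f := fun k : ℕ => -q ^ (k + 1))
        (by simpa using summable_norm_pow_succ hq)
  exact h.hasProd.tendsto_prod_nat

theorem qPochInf_ne_zero (hq : ‖q‖ < 1) : qPochInf q ≠ 0 := by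
  have h := tprod_one_add_ne_zero_of_summable (f := fun k : ℕ => -q ^ (k + 1))
    (fun k => by simpa [sub_eq_add_neg] using one_sub_pow_ne_zero hq k)
    (by simpa using summable_norm_pow_succ hq)
  simpa [sub_eq_add_neg, qPochInf] using h

theorem tendsto_inv_qPoch (hq : ‖q‖ < 1) :
    Tendsto (fun n => (qPoch q n)⁻¹) atTop (𝓝 (qPochInf q)⁻¹) :=
  (tendsto_qPoch hq).inv₀ (qPochInf_ne_zero hq)

theorem tendsto_qPoch_add (hq : ‖q‖ < 1) (k : ℕ) :
    Tendsto (fun n => qPoch q (k + n)) atTop (𝓝 (qPochInf q)) := by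
  simpa only [add_comm k] using (tendsto_add_atTop_iff_nat k).2 (tendsto_qPoch hq)

/-- The sign-alternating power `(-1)ᵐ q ^ (m (m - 1) / 2)` with triangular exponent. -/
def qTriPred (q : ℂ) (m : ℕ) : ℂ := (-1) ^ m * q ^ m.choose 2

/-- The sign-alternating power `(-1)ᵐ q ^ (m (m + 1) / 2)` with triangular exponent. -/
def qTri (q : ℂ) (m : ℕ) : ℂ := (-1) ^ m * q ^ (m + 1).choose 2

@[simp] theorem qTriPred_zero (q : ℂ) : qTriPred q 0 = 1 := by simp [qTriPred]

@[simp] theorem qTri_zero (q : ℂ) : qTri q 0 = 1 := by simp [qTri]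

theorem qTriPred_succ_eq_neg_qTri (q : ℂ) (m : ℕ) : qTriPred q (m + 1) = -qTri q m := by
  rw [qTriPred, qTri]; ring

theorem qTri_eq (q : ℂ) (m : ℕ) : qTri q m = qTriPred q m * q ^ m := by
  rw [qTri, qTriPred, Nat.choose_succ_succ', Nat.choose_one_right]; ring

theorem qTriPred_succ (q : ℂ) (m : ℕ) : qTriPred q (m + 1) = qTriPred q m * -q ^ m := by
  rw [qTriPred_succ_eq_neg_qTri, qTri_eq]; ring

theorem qTri_succ (q : ℂ) (m : ℕ) : qTri q (m + 1) = qTri q m * -q ^ (m + 1) := by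
  rw [qTri_eq, qTriPred_succ_eq_neg_qTri]; ring

theorem qTriPred_add (q : ℂ) (m n : ℕ) :
    qTriPred q (m + n) = qTriPred q m * (qTriPred q n * q ^ (m * n)) := by
  induction n with
  | zero => simp
  | succ n ih => rw [← add_assoc, qTriPred_succ, ih, qTriPred_succ]; ring

theorem qTri_add (q : ℂ) (m n : ℕ) : qTri q (m + n) = qTri q m * (qTri q n * q ^ (m * n)) := by
  rw [qTri_eq, qTriPred_add, qTri_eq, qTri_eq]; ring

theorem sum_antidiagonal_pascal (hq : ‖q‖ < 1) (g : ℕ → ℂ) (j : ℕ) :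
    (1 - q ^ (j + 1)) * ∑ p ∈ antidiagonal (j + 1), g p.1 * (qPoch q p.1)⁻¹ * (qPoch q p.2)⁻¹ =
      ∑ p ∈ antidiagonal j,
        (g p.1 + q ^ p.2 * g (p.1 + 1)) * (qPoch q p.1)⁻¹ * (qPoch q p.2)⁻¹ := by
  -- `1 - q ^ (i + k) = (1 - q ^ k) + q ^ k * (1 - q ^ i)`
  have hsplit : ∀ p ∈ antidiagonal (j + 1), (1 - q ^ (j + 1)) *
      (g p.1 * (qPoch q p.1)⁻¹ * (qPoch q p.2)⁻¹) =
      g p.1 * (qPoch q p.1)⁻¹ * ((1 - q ^ p.2) * (qPoch q p.2)⁻¹) +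
      q ^ p.2 * g p.1 * ((1 - q ^ p.1) * (qPoch q p.1)⁻¹) * (qPoch q p.2)⁻¹ := by
    intro p hp
    rw [← mem_antidiagonal.1 hp, pow_add]; ring
  rw [mul_sum, sum_congr rfl hsplit, sum_add_distrib, Nat.sum_antidiagonal_succ',
    Nat.sum_antidiagonal_succ]
  simp only [pow_zero, sub_self, zero_mul, mul_zero, zero_add, one_sub_pow_mul_inv_qPoch_succ hq]
  rw [← sum_add_distrib]
  exact sum_congr rfl fun p _ => by ring

/-- The finite `q`-binomial theorem. -/
theorem sum_qTriPred_mul_pow (hq : ‖q‖ < 1) (z : ℂ) (j : ℕ) :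
    ∑ p ∈ antidiagonal j, qTriPred q p.1 * z ^ p.1 * (qPoch q p.1)⁻¹ * (qPoch q p.2)⁻¹ =
      (∏ l ∈ range j, (1 - z * q ^ l)) * (qPoch q j)⁻¹ := by
  induction j with
  | zero => simp
  | succ j ih =>
    have hpascal := sum_antidiagonal_pascal hq (fun i => qTriPred q i * z ^ i) j
    have hfactor : ∀ p ∈ antidiagonal j, (qTriPred q p.1 * z ^ p.1 + q ^ p.2 *
        (qTriPred q (p.1 + 1) * z ^ (p.1 + 1))) * (qPoch q p.1)⁻¹ * (qPoch q p.2)⁻¹ =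
        (1 - z * q ^ j) * (qTriPred q p.1 * z ^ p.1 * (qPoch q p.1)⁻¹ * (qPoch q p.2)⁻¹) := by
      intro p hp
      rw [← mem_antidiagonal.1 hp, qTriPred_succ]; ring
    rw [sum_congr rfl hfactor, ← mul_sum, ih] at hpascal
    refine mul_left_cancel₀ (one_sub_pow_ne_zero hq j) (hpascal.trans ?_)
    rw [prod_range_succ, ← one_sub_pow_mul_inv_qPoch_succ hq j]; ring

theorem sum_qTriPred (hq : ‖q‖ < 1) (n : ℕ) :
    ∑ p ∈ antidiagonal n, qTriPred q p.1 * (qPoch q p.1)⁻¹ * (qPoch q p.2)⁻¹ =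
      if n = 0 then 1 else 0 := by
  have h := sum_qTriPred_mul_pow hq 1 n
  simp only [one_pow, mul_one, one_mul] at h
  rw [h]
  split_ifs with hn
  · simp [hn]
  · rw [prod_eq_zero (mem_range.2 (Nat.pos_of_ne_zero hn)) (by simp), zero_mul]

theorem sum_qTri_mul_pow (hq : ‖q‖ < 1) (n j : ℕ) :
    qPoch q n * ∑ p ∈ antidiagonal j,
      qTri q p.1 * q ^ (n * p.1) * (qPoch q p.1)⁻¹ * (qPoch q p.2)⁻¹ =
      qPoch q (n + j) * (qPoch q j)⁻¹ := by
  rw [qPoch_add, mul_assoc, ← sum_qTriPred_mul_pow hq]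
  congr! 2 with p
  rw [qTri_eq]; ring

/-- A form of the `q`-Chu–Vandermonde summation. -/
theorem sum_qTri_vandermonde (hq : ‖q‖ < 1) (d M : ℕ) : ∀ A : ℕ,
    ∑ p ∈ antidiagonal M, qTri q p.1 * q ^ (p.1 * d) * qPoch q (A + p.1) *
      (qPoch q (A + d + 1 + p.1))⁻¹ * (qPoch q p.1)⁻¹ * (qPoch q p.2)⁻¹ =
      qPoch q A * (qPoch q (A + d + 1 + M))⁻¹ * (qPoch q M)⁻¹ *
        (qPoch q (d + M) * (qPoch q d)⁻¹) := by
  induction M with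
  | zero => intro A; simp [mul_inv_cancel₀ (qPoch_ne_zero hq d)]
  | succ M ih =>
    intro A
    set g : ℕ → ℕ → ℂ := fun A i => qTri q i * q ^ (i * d) * qPoch q (A + i) *
      (qPoch q (A + d + 1 + i))⁻¹ with hg
    have hpascal := sum_antidiagonal_pascal hq (g A) M
    have hsplit : ∀ p ∈ antidiagonal M,
        (g A p.1 + q ^ p.2 * g A (p.1 + 1)) * (qPoch q p.1)⁻¹ * (qPoch q p.2)⁻¹ =
          g A p.1 * (qPoch q p.1)⁻¹ * (qPoch q p.2)⁻¹ -
            q ^ (M + d + 1) * (g (A + 1) p.1 * (qPoch q p.1)⁻¹ * (qPoch q p.2)⁻¹) := by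
      intro p hp
      rw [← mem_antidiagonal.1 hp]
      simp only [hg]
      rw [qTri_succ, show A + (p.1 + 1) = A + 1 + p.1 by ring,
        show A + d + 1 + (p.1 + 1) = A + 1 + d + 1 + p.1 by ring]
      ring
    rw [sum_congr rfl hsplit, sum_sub_distrib, ← mul_sum, ih A, ih (A + 1)] at hpascal
    refine mul_left_cancel₀ (one_sub_pow_ne_zero hq M) (hpascal.trans ?_)
    rw [show A + 1 + d + 1 + M = A + d + 1 + M + 1 by ring,
      show A + d + 1 + (M + 1) = A + d + 1 + M + 1 by ring, show d + (M + 1) = d + M + 1 by ring,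
      qPoch_succ q A, qPoch_succ q (d + M), ← one_sub_pow_mul_inv_qPoch_succ hq M,
      ← one_sub_pow_mul_inv_qPoch_succ hq (A + d + 1 + M)]
    ring

end QSeries

section Growth

variable {q : ℂ}

theorem qPoch_isBigO_one (hq : ‖q‖ < 1) : qPoch q =O[⊤] fun _ => (1 : ℝ) :=
  have ⟨C, hC⟩ := (Metric.isBounded_range_of_tendsto _ (tendsto_qPoch hq)).exists_norm_le
  .of_bound C <| by simpa using hC

theorem inv_qPoch_isBigO_one (hq : ‖q‖ < 1) : (fun n => (qPoch q n)⁻¹) =O[⊤] fun _ => (1 : ℝ) :=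
  have ⟨C, hC⟩ := (Metric.isBounded_range_of_tendsto _ (tendsto_inv_qPoch hq)).exists_norm_le
  .of_bound C <| by simpa using hC

theorem norm_pow_le_one (hq : ‖q‖ < 1) (n : ℕ) : ‖q ^ n‖ ≤ 1 := by
  rw [norm_pow]; exact pow_le_one₀ (norm_nonneg _) hq.le

theorem norm_qTriPred_le_one (hq : ‖q‖ < 1) (m : ℕ) : ‖qTriPred q m‖ ≤ 1 := by
  simpa [qTriPred] using norm_pow_le_one hq (m.choose 2)

theorem norm_qTri_le (hq : ‖q‖ < 1) (m : ℕ) : ‖qTri q m‖ ≤ ‖q‖ ^ m := by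
  rw [qTri_eq, norm_mul, norm_pow]
  exact mul_le_of_le_one_left (by positivity) (norm_qTriPred_le_one hq m)

theorem norm_qTri_le_one (hq : ‖q‖ < 1) (m : ℕ) : ‖qTri q m‖ ≤ 1 :=
  (norm_qTri_le hq m).trans (pow_le_one₀ (norm_nonneg _) hq.le)

theorem isBigO_one_of_norm_le_one {ι : Type*} {f : ι → ℂ} (h : ∀ i, ‖f i‖ ≤ 1) :
    f =O[⊤] fun _ => (1 : ℝ) :=
  .of_bound 1 <| by simpa using h

theorem isBigO_one_mul {ι : Type*} {f g : ι → ℂ} (hf : f =O[⊤] fun _ => (1 : ℝ))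
    (hg : g =O[⊤] fun _ => (1 : ℝ)) : (fun i => f i * g i) =O[⊤] fun _ => (1 : ℝ) := by
  simpa only [mul_one] using hf.mul hg

theorem isBigO_one_mul_pow {f v : ℕ → ℂ} (hf : f =O[⊤] fun _ => (1 : ℝ))
    (hv : v =O[⊤] fun n => ‖q‖ ^ n) : (fun n => f n * v n) =O[⊤] fun n => ‖q‖ ^ n := by
  simpa only [one_mul] using hf.mul hv

theorem isBigO_one_comp {ι κ : Type*} {f : κ → ℂ} (hf : f =O[⊤] fun _ => (1 : ℝ)) (k : ι → κ) :
    (fun i => f (k i)) =O[⊤] fun _ => (1 : ℝ) :=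
  hf.comp_tendsto tendsto_top

theorem isBigO_pow_shift (hq : ‖q‖ < 1) {v : ℕ → ℂ} (hv : v =O[⊤] fun n => ‖q‖ ^ n) (m : ℕ) :
    (fun n => v (m + n)) =O[⊤] fun n => ‖q‖ ^ n := by
  refine (hv.comp_tendsto (k := (m + ·)) tendsto_top).trans (.of_bound' (.of_forall fun n => ?_))
  simpa using pow_le_pow_of_le_one (norm_nonneg q) hq.le (Nat.le_add_left n m)

theorem qTri_isBigO_pow (hq : ‖q‖ < 1) : qTri q =O[⊤] fun n => ‖q‖ ^ n :=
  .of_bound' <| .of_forall fun m => by simpa using norm_qTri_le hq m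

theorem summable_norm_of_isBigO_pow (hq : ‖q‖ < 1) {v : ℕ → ℂ} (hv : v =O[⊤] fun n => ‖q‖ ^ n) :
    Summable fun n => ‖v n‖ :=
  summable_of_isBigO (summable_geometric_of_lt_one (norm_nonneg _) hq) (hv.norm_left.mono le_top)

theorem summable_mul_of_isBigO_pow (hq : ‖q‖ < 1) {A : ℕ × ℕ → ℂ} {v : ℕ → ℂ}
    (hA : A =O[⊤] fun _ => (1 : ℝ)) (hv : v =O[⊤] fun n => ‖q‖ ^ n) :
    Summable fun p : ℕ × ℕ => A p * v (p.1 + p.2) := by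
  have hgeom := summable_geometric_of_lt_one (norm_nonneg q) hq
  refine summable_of_isBigO (hgeom.mul_of_nonneg hgeom (fun _ => by positivity)
    (fun _ => by positivity)) (.mono ?_ le_top)
  simpa only [one_mul, Function.comp_def, pow_add] using
    hA.mul (hv.comp_tendsto (k := fun p : ℕ × ℕ => p.1 + p.2) tendsto_top)

theorem tsum_tsum_mul_eq_tsum_antidiagonal (hq : ‖q‖ < 1) {A : ℕ × ℕ → ℂ} {v : ℕ → ℂ}
    (hA : A =O[⊤] fun _ => (1 : ℝ)) (hv : v =O[⊤] fun n => ‖q‖ ^ n) :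
    ∑' i, ∑' j, A (i, j) * v (i + j) = ∑' n, (∑ p ∈ antidiagonal n, A p) * v n := by
  have hs := summable_mul_of_isBigO_pow hq hA hv
  have hs' := (HasAntidiagonal.sigmaAntidiagonalEquivProd (A := ℕ)).summable_iff.2 hs
  rw [← hs.tsum_prod, ← (HasAntidiagonal.sigmaAntidiagonalEquivProd (A := ℕ)).tsum_eq]
  refine (hs'.tsum_sigma' fun n => (hasSum_fintype _).summable).trans (tsum_congr fun n => ?_)
  rw [tsum_fintype, sum_mul, ← sum_coe_sort (antidiagonal n)]
  refine Fintype.sum_congr _ _ fun p => ?_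
  simp only [Function.comp_apply, HasAntidiagonal.sigmaAntidiagonalEquivProd_apply]
  rw [mem_antidiagonal.1 p.2]

theorem tsum_tsum_mul_eq_of_sum_antidiagonal (hq : ‖q‖ < 1) {A : ℕ × ℕ → ℂ} {v : ℕ → ℂ}
    (hA : A =O[⊤] fun _ => (1 : ℝ)) (hv : v =O[⊤] fun n => ‖q‖ ^ n)
    (hδ : ∀ n, ∑ p ∈ antidiagonal n, A p = if n = 0 then 1 else 0) :
    ∑' i, ∑' j, A (i, j) * v (i + j) = v 0 := by
  simp only [tsum_tsum_mul_eq_tsum_antidiagonal hq hA hv, hδ, ite_mul, one_mul, zero_mul]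
  exact tsum_ite_eq 0 v

theorem tendsto_sum_antidiagonal_mul {f g : ℕ → ℂ} {l : ℂ} (hf : Summable fun n => ‖f n‖)
    (hg : Tendsto g atTop (𝓝 l)) :
    Tendsto (fun n => ∑ p ∈ antidiagonal n, f p.1 * g p.2) atTop (𝓝 ((∑' n, f n) * l)) := by
  obtain ⟨C, hC⟩ := (Metric.isBounded_range_of_tendsto _ hg).exists_norm_le
  have hC0 : 0 ≤ C := (norm_nonneg _).trans (hC _ ⟨0, rfl⟩)
  have hsum : ∀ n, ∑ p ∈ antidiagonal n, f p.1 * g p.2 =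
      ∑' i, if i ≤ n then f i * g (n - i) else 0 := by
    intro n
    rw [Nat.sum_antidiagonal_eq_sum_range_succ_mk, tsum_eq_sum (s := range (n + 1))]
    · exact sum_congr rfl fun i hi => (if_pos (Nat.lt_succ_iff.1 (mem_range.1 hi))).symm
    · exact fun i hi => if_neg (by simpa [Nat.lt_succ_iff] using hi)
  simp only [hsum, ← tsum_mul_right]
  refine tendsto_tsum_of_dominated_convergence (hf.mul_right C) (fun i => ?_)
    (.of_forall fun n i => ?_)
  · refine ((hg.comp (tendsto_sub_atTop_nat i)).const_mul (f i)).congr' ?_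
    filter_upwards [eventually_ge_atTop i] with n hn
    rw [if_pos hn, Function.comp_apply]
  · split_ifs
    · rw [norm_mul]
      exact mul_le_mul_of_nonneg_left (hC _ ⟨_, rfl⟩) (norm_nonneg _)
    · rw [norm_zero]; positivity

end Growth

/-! ### Euler's identities and the chain of a polygon -/

section Euler

variable {q : ℂ}

theorem summable_norm_qTri_mul_pow (hq : ‖q‖ < 1) (N : ℕ) :
    Summable fun j : ℕ => ‖qTri q j * q ^ (N * j) * (qPoch q j)⁻¹‖ := by
  have hcoeff := isBigO_one_mul (isBigO_one_of_norm_le_one fun j : ℕ => norm_pow_le_one hq (N * j))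
    (inv_qPoch_isBigO_one hq)
  exact summable_norm_of_isBigO_pow hq <|
    (isBigO_one_mul_pow hcoeff (qTri_isBigO_pow hq)).congr_left fun j => by ring

theorem summable_norm_pow_mul_inv_qPoch (hq : ‖q‖ < 1) (N : ℕ) :
    Summable fun b : ℕ => ‖q ^ ((N + 1) * b) * (qPoch q b)⁻¹‖ := by
  have hpow : (fun b : ℕ => q ^ b) =O[⊤] fun b => ‖q‖ ^ b :=
    .of_bound' <| .of_forall fun b => by simp
  have hcoeff := isBigO_one_mul (isBigO_one_of_norm_le_one fun b : ℕ => norm_pow_le_one hq (N * b))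
    (inv_qPoch_isBigO_one hq)
  exact summable_norm_of_isBigO_pow hq <|
    (isBigO_one_mul_pow hcoeff hpow).congr_left fun b => by ring

/-- Euler's second identity at `z = q ^ (N + 1)`: let `j → ∞` in `sum_qTri_mul_pow`. -/
theorem qPoch_mul_tsum_qTri_mul_pow (hq : ‖q‖ < 1) (N : ℕ) :
    qPoch q N * ∑' j : ℕ, qTri q j * q ^ (N * j) * (qPoch q j)⁻¹ = qPochInf q := by
  have hsum := (tendsto_sum_antidiagonal_mul (summable_norm_qTri_mul_pow hq N)
    (tendsto_inv_qPoch hq)).const_mul (qPoch q N)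
  simp only [sum_qTri_mul_pow hq] at hsum
  have hprod := (tendsto_qPoch_add hq N).mul (tendsto_inv_qPoch hq)
  refine mul_right_cancel₀ (inv_ne_zero (qPochInf_ne_zero hq)) ?_
  rw [mul_assoc, tendsto_nhds_unique hsum hprod]

/-- Euler's first identity at `z = q ^ (N + 1)`: the Cauchy product with the second one is `1`. -/
theorem tsum_pow_mul_inv_qPoch (hq : ‖q‖ < 1) (N : ℕ) :
    ∑' b : ℕ, q ^ ((N + 1) * b) * (qPoch q b)⁻¹ = qPoch q N * (qPochInf q)⁻¹ := by
  have hcoeff : ∀ n, ∑ p ∈ antidiagonal n, qTri q p.1 * q ^ (N * p.1) * (qPoch q p.1)⁻¹ *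
      (q ^ ((N + 1) * p.2) * (qPoch q p.2)⁻¹) = if n = 0 then 1 else 0 := by
    intro n
    calc _ = q ^ ((N + 1) * n) * ∑ p ∈ antidiagonal n,
            qTriPred q p.1 * (qPoch q p.1)⁻¹ * (qPoch q p.2)⁻¹ := by
          rw [mul_sum]
          refine sum_congr rfl fun p hp => ?_
          rw [← mem_antidiagonal.1 hp, qTri_eq]; ring
      _ = _ := by
          rw [sum_qTriPred hq]
          split_ifs with hn <;> simp [hn]
  have hcauchy := tsum_mul_tsum_eq_tsum_sum_antidiagonal_of_summable_norm
    (summable_norm_qTri_mul_pow hq N) (summable_norm_pow_mul_inv_qPoch hq N)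
  simp only [hcoeff, tsum_ite_eq 0 fun _ => (1 : ℂ)] at hcauchy
  rw [eq_mul_inv_iff_mul_eq₀ (qPochInf_ne_zero hq), ← qPoch_mul_tsum_qTri_mul_pow hq N,
    mul_left_comm, mul_comm (∑' b : ℕ, _), hcauchy, mul_one]

end Euler

section ShiftSum

variable {q : ℂ} {v : ℕ → ℂ}

/-- The operator `v ↦ (m ↦ ∑ᵢ v (m + i) / (q)ᵢ)`, which describes the passage from one vertex of a
polygon to the next one. -/
def qShiftSum (q : ℂ) (v : ℕ → ℂ) (m : ℕ) : ℂ := ∑' i, v (m + i) * (qPoch q i)⁻¹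

theorem qShiftSum_add (q : ℂ) (v : ℕ → ℂ) (m n : ℕ) :
    qShiftSum q v (m + n) = qShiftSum q (fun i => v (m + i)) n := by
  simp only [qShiftSum, add_assoc]

theorem qShiftSum_isBigO_one (hq : ‖q‖ < 1) (hv : v =O[⊤] fun n => ‖q‖ ^ n) :
    qShiftSum q v =O[⊤] fun _ => (1 : ℝ) := by
  obtain ⟨K, hK⟩ := isBigO_top.1 (inv_qPoch_isBigO_one hq)
  have hsum := summable_norm_of_isBigO_pow hq hv
  have hK0 : 0 ≤ K := by simpa using (norm_nonneg _).trans (hK 0)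
  refine .of_bound ((∑' i, ‖v i‖) * K) (.of_forall fun m => ?_)
  have hshift : Summable fun i => ‖v (m + i)‖ := by
    simpa only [add_comm m] using (summable_nat_add_iff m).2 hsum
  calc ‖qShiftSum q v m‖ ≤ (∑' i, ‖v (m + i)‖) * K := by
        refine tsum_of_norm_bounded (hshift.hasSum.mul_right K) fun i => ?_
        rw [norm_mul]
        exact mul_le_mul_of_nonneg_left (by simpa using hK i) (norm_nonneg _)
    _ ≤ (∑' i, ‖v i‖) * K :=
        mul_le_mul_of_nonneg_right (hshift.tsum_le_tsum_of_inj (m + ·) (add_right_injective m)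
          (fun _ _ => norm_nonneg _) (fun _ => le_rfl) hsum) hK0
    _ = _ := by simp

theorem tsum_mul_qShiftSum (hq : ‖q‖ < 1) {a : ℕ → ℂ} (ha : a =O[⊤] fun _ => (1 : ℝ))
    (hv : v =O[⊤] fun n => ‖q‖ ^ n) :
    ∑' i, a i * qShiftSum q v i =
      ∑' n, (∑ p ∈ antidiagonal n, a p.1 * (qPoch q p.2)⁻¹) * v n := by
  have hA := isBigO_one_mul (isBigO_one_comp ha (Prod.fst : ℕ × ℕ → ℕ))
    (isBigO_one_comp (inv_qPoch_isBigO_one hq) Prod.snd)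
  rw [← tsum_tsum_mul_eq_tsum_antidiagonal hq hA hv]
  refine tsum_congr fun i => ?_
  rw [qShiftSum, ← tsum_mul_left]
  exact tsum_congr fun j => by ring

theorem tsum_qTriPred_mul_qShiftSum (hq : ‖q‖ < 1) (hv : v =O[⊤] fun n => ‖q‖ ^ n) :
    ∑' a, qTriPred q a * (qPoch q a)⁻¹ * qShiftSum q v a = v 0 := by
  rw [tsum_mul_qShiftSum hq (isBigO_one_mul (isBigO_one_of_norm_le_one (norm_qTriPred_le_one hq))
    (inv_qPoch_isBigO_one hq)) hv]
  simp only [sum_qTriPred hq, ite_mul, one_mul, zero_mul]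
  exact tsum_ite_eq 0 v

theorem tsum_mul_qPoch_add (hq : ‖q‖ < 1) (hv : v =O[⊤] fun n => ‖q‖ ^ n) (N : ℕ) :
    ∑' j, qPoch q (N + j) * (qPoch q j)⁻¹ * v j =
      qPoch q N * ∑' i, qTri q i * q ^ (N * i) * (qPoch q i)⁻¹ * qShiftSum q v i := by
  have hcoeff := isBigO_one_mul (isBigO_one_mul (isBigO_one_of_norm_le_one (norm_qTri_le_one hq))
    (isBigO_one_of_norm_le_one fun i => norm_pow_le_one hq (N * i))) (inv_qPoch_isBigO_one hq)
  rw [tsum_mul_qShiftSum hq hcoeff hv, ← tsum_mul_left]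
  exact tsum_congr fun j => by rw [← mul_assoc, sum_qTri_mul_pow hq]

theorem tsum_pow_mul_tsum_pow_mul (hq : ‖q‖ < 1) (hv : v =O[⊤] fun n => ‖q‖ ^ n) (N : ℕ) :
    ∑' n : ℕ, q ^ ((N + 1) * n) * (qPoch q n)⁻¹ * ∑' j : ℕ, v j * q ^ (n * j) * (qPoch q j)⁻¹ =
      (qPochInf q)⁻¹ * ∑' j, qPoch q (N + j) * (qPoch q j)⁻¹ * v j := by
  set F : ℕ → ℕ → ℂ := fun n j =>
    q ^ ((N + 1) * n) * (qPoch q n)⁻¹ * (v j * q ^ (n * j) * (qPoch q j)⁻¹) with hF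
  have hs : Summable (Function.uncurry F) := by
    have hbound : (fun p : ℕ × ℕ => q ^ (p.1 * p.2)) =O[⊤] fun _ => (1 : ℝ) :=
      isBigO_one_of_norm_le_one fun p => norm_pow_le_one hq _
    have hvs : Summable fun j => ‖v j * (qPoch q j)⁻¹‖ := by
      refine summable_norm_of_isBigO_pow hq ?_
      simpa only [mul_comm] using isBigO_one_mul_pow (inv_qPoch_isBigO_one hq) hv
    refine summable_of_isBigO (summable_mul_of_summable_norm
      (summable_norm_pow_mul_inv_qPoch hq N) hvs).norm (.mono ?_ le_top)
    refine (hbound.mul (isBigO_refl _ _).norm_right).congr (fun p => ?_) fun p => one_mul _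
    simp only [hF, Function.uncurry]
    ring
  calc _ = ∑' n, ∑' j, F n j := by simp only [hF, tsum_mul_left]
    _ = ∑' j, ∑' n, F n j := hs.tsum_comm.symm
    _ = ∑' j, v j * (qPoch q j)⁻¹ *
          ∑' n, q ^ ((N + j + 1) * n) * (qPoch q n)⁻¹ := by
        refine tsum_congr fun j => ?_
        rw [← tsum_mul_left]
        exact tsum_congr fun n => by simp only [hF]; ring
    _ = _ := by
        rw [← tsum_mul_left]
        exact tsum_congr fun j => by rw [tsum_pow_mul_inv_qPoch hq]; ring

end ShiftSum

section Chain

variable {q : ℂ}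

/-- The sequences obtained from `qTri` by iterating `v ↦ qTri * qShiftSum v`; the value of the
`r`-th one at `0` is the partial theta function `hSeries (r + 2)`. -/
def chainSeq (q : ℂ) : ℕ → ℕ → ℂ
  | 0, m => qTri q m
  | r + 1, m => qTri q m * qShiftSum q (chainSeq q r) m

theorem chainSeq_isBigO_pow (hq : ‖q‖ < 1) (r : ℕ) : chainSeq q r =O[⊤] fun m => ‖q‖ ^ m := by
  induction r with
  | zero => exact qTri_isBigO_pow hq
  | succ r ih =>
    simpa only [chainSeq, mul_comm] using
      isBigO_one_mul_pow (qShiftSum_isBigO_one hq ih) (qTri_isBigO_pow hq)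

/-- The value at `N + p` of the left eigenvector, supported on `[N, ∞)` and with eigenvalue
`qTri q N`, of the iteration that defines `chainSeq`. -/
def leftEigen (q : ℂ) (N p : ℕ) : ℂ :=
  qPoch q (N + p) * (qPoch q (2 * N + 1 + p))⁻¹ * (qPoch q p)⁻¹

theorem leftEigen_isBigO_one (hq : ‖q‖ < 1) :
    (fun x : ℕ × ℕ => leftEigen q x.1 x.2) =O[⊤] fun _ => (1 : ℝ) :=
  isBigO_one_mul (isBigO_one_mul
    (isBigO_one_comp (qPoch_isBigO_one hq) fun x : ℕ × ℕ => x.1 + x.2)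
    (isBigO_one_comp (inv_qPoch_isBigO_one hq) fun x : ℕ × ℕ => 2 * x.1 + 1 + x.2))
    (isBigO_one_comp (inv_qPoch_isBigO_one hq) Prod.snd)

theorem leftEigen_mul_qTri_isBigO_pow (hq : ‖q‖ < 1) (N : ℕ) :
    (fun p => leftEigen q N p * qTri q (N + p)) =O[⊤] fun p => ‖q‖ ^ p :=
  isBigO_one_mul_pow (isBigO_one_comp (leftEigen_isBigO_one hq) (Prod.mk N))
    (isBigO_pow_shift hq (qTri_isBigO_pow hq) N)

theorem tendsto_leftEigen (hq : ‖q‖ < 1) (N : ℕ) :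
    Tendsto (leftEigen q N) atTop (𝓝 (qPochInf q)⁻¹) := by
  have h := ((tendsto_qPoch_add hq N).mul ((tendsto_qPoch_add hq (2 * N + 1)).inv₀
    (qPochInf_ne_zero hq))).mul (tendsto_inv_qPoch hq)
  rwa [mul_inv_cancel₀ (qPochInf_ne_zero hq), one_mul] at h

theorem sum_leftEigen (hq : ‖q‖ < 1) (N M : ℕ) :
    ∑ p ∈ antidiagonal M, leftEigen q N p.1 * qTri q (N + p.1) * (qPoch q p.2)⁻¹ =
      qTri q N * leftEigen q N M := by
  have hN := qPoch_ne_zero hq N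
  have hvandermonde := sum_qTri_vandermonde hq N M N
  calc _ = qTri q N * ∑ p ∈ antidiagonal M, qTri q p.1 * q ^ (p.1 * N) * qPoch q (N + p.1) *
          (qPoch q (N + N + 1 + p.1))⁻¹ * (qPoch q p.1)⁻¹ * (qPoch q p.2)⁻¹ := by
        rw [mul_sum]
        refine sum_congr rfl fun p _ => ?_
        rw [leftEigen, qTri_add, two_mul]; ring
    _ = _ := by
        rw [hvandermonde, leftEigen, two_mul]
        field_simp

theorem tsum_leftEigen_qTri (hq : ‖q‖ < 1) (N : ℕ) :
    ∑' p, leftEigen q N p * qTri q (N + p) = qTri q N := by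
  have hsum := tendsto_sum_antidiagonal_mul
    (summable_norm_of_isBigO_pow hq (leftEigen_mul_qTri_isBigO_pow hq N)) (tendsto_inv_qPoch hq)
  simp only [sum_leftEigen hq] at hsum
  exact mul_right_cancel₀ (inv_ne_zero (qPochInf_ne_zero hq))
    (tendsto_nhds_unique hsum ((tendsto_leftEigen hq N).const_mul _))

theorem tsum_leftEigen_chainSeq (hq : ‖q‖ < 1) (r N : ℕ) :
    ∑' p, leftEigen q N p * chainSeq q r (N + p) = qTri q N ^ (r + 1) := by
  induction r with
  | zero => simpa only [zero_add, pow_one, chainSeq] using tsum_leftEigen_qTri hq N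
  | succ r ih =>
    have hcoeff : (fun p => leftEigen q N p * qTri q (N + p)) =O[⊤] fun _ => (1 : ℝ) :=
      isBigO_one_mul (isBigO_one_comp (leftEigen_isBigO_one hq) (Prod.mk N))
        (isBigO_one_of_norm_le_one fun p => norm_qTri_le_one hq (N + p))
    simp only [chainSeq, qShiftSum_add, ← mul_assoc]
    rw [tsum_mul_qShiftSum hq hcoeff (isBigO_pow_shift hq (chainSeq_isBigO_pow hq r) N)]
    simp only [sum_leftEigen hq]
    simp only [mul_assoc]
    rw [tsum_mul_left, ih, ← pow_succ']

/-- The telescoped partial sums of the unit Bailey pair. -/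
theorem sum_range_unit_pair (hq : ‖q‖ < 1) (n : ℕ) : ∀ t : ℕ,
    (1 - q ^ (n + t)) * ∑ N ∈ range n, qTriPred q N * (1 - q ^ (2 * N + 1)) *
      ((qPoch q (n + t - N))⁻¹ * (qPoch q (n + t + N + 1))⁻¹) =
      -(qTriPred q n * (1 - q ^ n) * ((qPoch q t)⁻¹ * (qPoch q (n + t + n))⁻¹)) := by
  induction n with
  | zero => simp
  | succ n ih =>
    intro t
    rw [sum_range_succ, mul_add, show n + 1 + t = n + (t + 1) by ring, ih (t + 1),
      Nat.add_sub_cancel_left, ← one_sub_pow_mul_inv_qPoch_succ hq t,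
      show n + (t + 1) + (n + 1) = n + (t + 1) + n + 1 by ring,
      ← one_sub_pow_mul_inv_qPoch_succ hq (n + (t + 1) + n), qTriPred_succ]
    ring

theorem sum_unit_pair (hq : ‖q‖ < 1) (m : ℕ) :
    ∑ p ∈ antidiagonal m, qTriPred q p.1 * (1 - q ^ (2 * p.1 + 1)) * leftEigen q p.1 p.2 =
      if m = 0 then 1 else 0 := by
  rcases m with _ | n
  · simpa [leftEigen] using one_sub_pow_mul_inv_qPoch_succ hq 0
  · rw [if_neg n.succ_ne_zero, Nat.sum_antidiagonal_eq_sum_range_succ_mk]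
    have hterm : ∀ N ∈ range (n + 1 + 1), qTriPred q N * (1 - q ^ (2 * N + 1)) *
        leftEigen q N (n + 1 - N) = qPoch q (n + 1) * (qTriPred q N * (1 - q ^ (2 * N + 1)) *
          ((qPoch q (n + 1 + 0 - N))⁻¹ * (qPoch q (n + 1 + 0 + N + 1))⁻¹)) := by
      intro N hN
      have hle := Nat.lt_succ_iff.1 (mem_range.1 hN)
      rw [leftEigen, Nat.add_sub_cancel' hle,
        show 2 * N + 1 + (n + 1 - N) = n + 1 + 0 + N + 1 by omega, add_zero]
      ring
    rw [sum_congr rfl hterm, ← mul_sum]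
    refine mul_eq_zero_of_right _ (mul_left_cancel₀ (one_sub_pow_ne_zero hq n) ?_)
    have hpartial := sum_range_unit_pair hq (n + 1) 0
    rw [add_zero] at hpartial ⊢
    rw [sum_range_succ, mul_add, hpartial, mul_zero, Nat.sub_self,
      ← one_sub_pow_mul_inv_qPoch_succ hq (n + 1 + (n + 1))]
    ring

theorem chainSeq_zero_eq_tsum (hq : ‖q‖ < 1) (r : ℕ) :
    chainSeq q r 0 = ∑' N, qTriPred q N * (1 - q ^ (2 * N + 1)) * qTri q N ^ (r + 1) := by
  have hfactor : (fun N : ℕ => 1 - q ^ (2 * N + 1)) =O[⊤] fun _ => (1 : ℝ) :=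
    .sub (isBigO_one_of_norm_le_one fun _ => norm_one.le)
      (isBigO_one_of_norm_le_one fun N : ℕ => norm_pow_le_one hq (2 * N + 1))
  have hcoeff := isBigO_one_mul (isBigO_one_comp (isBigO_one_mul
    (isBigO_one_of_norm_le_one (norm_qTriPred_le_one hq)) hfactor) Prod.fst)
    (leftEigen_isBigO_one hq)
  rw [← tsum_tsum_mul_eq_of_sum_antidiagonal hq hcoeff (chainSeq_isBigO_pow hq r)
    (sum_unit_pair hq)]
  refine tsum_congr fun N => ?_
  simp only [mul_assoc _ (leftEigen q N _)]
  rw [tsum_mul_left, tsum_leftEigen_chainSeq hq]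

end Chain

section PartialTheta

variable {q : ℂ}

theorem epsilon_natCast (b n : ℕ) : epsilon b n = ((-1) ^ n) ^ b := by
  unfold epsilon
  split_ifs with hb hn
  · rw [zpow_natCast, ← pow_mul, mul_comm, pow_mul, hb.neg_one_pow]
  · rw [← pow_mul, ((Nat.not_odd_iff_even.1 hb).mul_left n).neg_one_pow]
  · omega

theorem epsilon_neg_natCast_add_one (b n : ℕ) :
    epsilon b (-((n : ℤ) + 1)) = -((-1) ^ n) ^ b := by
  unfold epsilon
  split_ifs with hb hn
  · rw [← pow_mul, mul_comm, pow_mul, hb.neg_one_pow, zpow_neg, ← Nat.cast_succ, zpow_natCast,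
      ← inv_pow, inv_neg_one, pow_succ]
    ring
  · omega
  · rw [← pow_mul, ((Nat.not_odd_iff_even.1 hb).mul_left n).neg_one_pow]

theorem natCast_mul_succ_div_two (n : ℕ) : (n : ℤ) * ((n : ℤ) + 1) / 2 = n.choose 2 + n := by
  have h : (n + 1).choose 2 = n.choose 2 + n := by
    rw [Nat.choose_succ_succ', Nat.choose_one_right, add_comm]
  rw [← Nat.cast_add, ← h, Nat.choose_two_right, Nat.add_sub_cancel, mul_comm]
  norm_cast

theorem hSeries_term_natCast (q : ℂ) (r n : ℕ) : epsilon (r + 2) n *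
    q ^ (((r + 2 : ℕ) : ℤ) * ((n : ℤ) * ((n : ℤ) + 1) / 2) - n) =
      qTriPred q n * qTri q n ^ (r + 1) := by
  have hexp : ((r + 2 : ℕ) : ℤ) * ((n : ℤ) * ((n : ℤ) + 1) / 2) - n =
      ((n.choose 2 + (n.choose 2 + n) * (r + 1) : ℕ) : ℤ) := by
    rw [natCast_mul_succ_div_two]; push_cast; ring
  rw [hexp, zpow_natCast, epsilon_natCast, qTri_eq, qTriPred]
  ring

theorem hSeries_term_neg (q : ℂ) (r n : ℕ) : epsilon (r + 2) (-((n : ℤ) + 1)) *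
    q ^ (((r + 2 : ℕ) : ℤ) * (-((n : ℤ) + 1) * (-((n : ℤ) + 1) + 1) / 2) - -((n : ℤ) + 1)) =
      -(q ^ (2 * n + 1) * (qTriPred q n * qTri q n ^ (r + 1))) := by
  have hexp : ((r + 2 : ℕ) : ℤ) * (-((n : ℤ) + 1) * (-((n : ℤ) + 1) + 1) / 2) - -((n : ℤ) + 1) =
      ((2 * n + 1 + n.choose 2 + (n.choose 2 + n) * (r + 1) : ℕ) : ℤ) := by
    rw [show -((n : ℤ) + 1) * (-((n : ℤ) + 1) + 1) = n * (n + 1) by ring,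
      natCast_mul_succ_div_two]
    push_cast; ring
  rw [hexp, zpow_natCast, epsilon_neg_natCast_add_one, qTri_eq, qTriPred]
  ring

theorem hSeries_eq_tsum (hq : ‖q‖ < 1) (r : ℕ) :
    hSeries (r + 2) q = ∑' N, qTriPred q N * (1 - q ^ (2 * N + 1)) * qTri q N ^ (r + 1) := by
  have hnonneg : Summable fun N => qTriPred q N * qTri q N ^ (r + 1) := by
    have hcoeff : ∀ N, ‖qTriPred q N * qTri q N ^ r‖ ≤ 1 := fun N => by
      rw [norm_mul, norm_pow]
      exact mul_le_one₀ (norm_qTriPred_le_one hq N) (by positivity)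
        (pow_le_one₀ (norm_nonneg _) (norm_qTri_le_one hq N))
    exact (summable_norm_of_isBigO_pow hq <|
      (isBigO_one_mul_pow (isBigO_one_of_norm_le_one hcoeff) (qTri_isBigO_pow hq)).congr_left
        fun N => by ring).of_norm
  have hneg : Summable fun N => q ^ (2 * N + 1) * (qTriPred q N * qTri q N ^ (r + 1)) := by
    refine .of_norm_bounded hnonneg.norm fun N => ?_
    rw [norm_mul]
    exact mul_le_of_le_one_left (norm_nonneg _) (norm_pow_le_one hq _)
  rw [hSeries, tsum_of_nat_of_neg_add_one (by simpa only [hSeries_term_natCast] using hnonneg)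
    (by simpa only [hSeries_term_neg] using hneg.neg)]
  simp only [hSeries_term_natCast, hSeries_term_neg]
  rw [← hnonneg.tsum_add hneg.neg]
  exact tsum_congr fun N => by ring

theorem chainSeq_zero (hq : ‖q‖ < 1) (r : ℕ) : chainSeq q r 0 = hSeries (r + 2) q := by
  rw [chainSeq_zero_eq_tsum hq, hSeries_eq_tsum hq]

theorem hSeries_two (hq : ‖q‖ < 1) : hSeries 2 q = 1 := by
  rw [← chainSeq_zero hq 0, chainSeq, qTri_zero]

end PartialTheta

/-! ### The weight of a polygon -/

section Polygon

variable {q : ℂ}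

/-- The weight of a path of vertices with the variables `l` in a face with the variable `a`; the
path starts next to a vertex with the variable `y`. -/
def pathWeight (q : ℂ) (a : ℕ) : List ℕ → ℕ → ℂ
  | [], _ => 1
  | b :: l, y => qTri q a * (q ^ ((a + y + 1) * b) * (qPoch q b)⁻¹ * (qPoch q (a + b))⁻¹) *
      pathWeight q a l b

theorem norm_pathWeight_le (hq : ‖q‖ < 1) {K : ℝ} (hK : ∀ n, ‖(qPoch q n)⁻¹‖ ≤ K) (a : ℕ)
    (l : List ℕ) : ∀ y, ‖pathWeight q a l y‖ ≤ (K * K) ^ l.length * ‖q‖ ^ l.sum := by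
  have hK0 : 0 ≤ K := (norm_nonneg _).trans (hK 0)
  induction l with
  | nil => intro y; simp [pathWeight]
  | cons b l ih =>
    intro y
    have hpow : ‖q‖ ^ ((a + y + 1) * b) ≤ ‖q‖ ^ b :=
      pow_le_pow_of_le_one (norm_nonneg _) hq.le (Nat.le_mul_of_pos_left b (Nat.succ_pos _))
    rw [pathWeight, norm_mul, norm_mul, norm_mul, norm_mul, norm_pow, List.length_cons,
      List.sum_cons, pow_succ, pow_add]
    calc _ ≤ 1 * (‖q‖ ^ b * K * K) * ((K * K) ^ l.length * ‖q‖ ^ l.sum) := by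
          gcongr
          · exact norm_qTri_le_one hq a
          · exact hK _
          · exact hK _
          · exact ih _
      _ = _ := by ring

theorem exists_norm_inv_qPoch_le (hq : ‖q‖ < 1) : ∃ K : ℝ, ∀ n, ‖(qPoch q n)⁻¹‖ ≤ K := by
  simpa using isBigO_top.1 (inv_qPoch_isBigO_one hq)

theorem summable_pow_sum (hq : ‖q‖ < 1) (r : ℕ) :
    Summable fun b : Fin r → ℕ => ‖q‖ ^ (List.ofFn b).sum := by
  induction r with
  | zero => exact (hasSum_fintype _).summable
  | succ r ih =>
    rw [← (Fin.consEquiv fun _ : Fin (r + 1) => ℕ).summable_iff]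
    have hprod := (summable_geometric_of_lt_one (norm_nonneg q) hq).mul_of_nonneg ih
      (fun _ => by positivity) (fun _ => by positivity)
    refine hprod.congr fun p => ?_
    simp [Fin.consEquiv, List.ofFn_succ, pow_add]

theorem summable_pathWeight (hq : ‖q‖ < 1) (a r y : ℕ) :
    Summable fun b : Fin r → ℕ => pathWeight q a (List.ofFn b) y := by
  obtain ⟨K, hK⟩ := exists_norm_inv_qPoch_le hq
  refine .of_norm_bounded ((summable_pow_sum hq r).mul_left ((K * K) ^ r)) fun b => ?_
  simpa using norm_pathWeight_le hq hK a (List.ofFn b) y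

theorem tsum_pathWeight_succ (hq : ‖q‖ < 1) (a r y : ℕ) :
    ∑' b : Fin (r + 1) → ℕ, pathWeight q a (List.ofFn b) y =
      ∑' n : ℕ, q ^ ((a + y + 1) * n) * (qPoch q n)⁻¹ * ((qPoch q (a + n))⁻¹ *
        (qTri q a * ∑' b : Fin r → ℕ, pathWeight q a (List.ofFn b) n)) := by
  have hs := (Fin.consEquiv fun _ : Fin (r + 1) => ℕ).summable_iff.2
    (summable_pathWeight hq a (r + 1) y)
  rw [← (Fin.consEquiv fun _ : Fin (r + 1) => ℕ).tsum_eq]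
  refine hs.tsum_prod.trans (tsum_congr fun n => ?_)
  rw [← tsum_mul_left, ← tsum_mul_left, ← tsum_mul_left]
  refine tsum_congr fun b => ?_
  simp only [Function.comp, Fin.consEquiv, Equiv.coe_fn_mk, List.ofFn_succ, Fin.cons_zero,
    Fin.cons_succ, pathWeight]
  ring

/-- One more vertex on the path is one more link of the chain: Euler's first identity carries out
the sum over the new variable. -/
theorem tsum_pathWeight (hq : ‖q‖ < 1) (a r : ℕ) : ∀ y : ℕ,
    qTri q a * ∑' b : Fin r → ℕ, pathWeight q a (List.ofFn b) y =
      qPoch q (a + y) * (qPochInf q)⁻¹ ^ (r + 1) *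
        ∑' j : ℕ, chainSeq q r (a + j) * q ^ (y * j) * (qPoch q j)⁻¹ := by
  induction r with
  | zero =>
    intro y
    have hterm : ∀ j : ℕ, chainSeq q 0 (a + j) * q ^ (y * j) * (qPoch q j)⁻¹ =
        qTri q a * (qTri q j * q ^ ((a + y) * j) * (qPoch q j)⁻¹) := by
      intro j; rw [chainSeq, qTri_add]; ring
    simp only [hterm, tsum_mul_left]
    calc _ = qTri q a * ((qPochInf q)⁻¹ * qPochInf q) := by
          rw [inv_mul_cancel₀ (qPochInf_ne_zero hq), tsum_fintype]
          simp [pathWeight]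
      _ = _ := by
          rw [← qPoch_mul_tsum_qTri_mul_pow hq (a + y)]
          ring
  | succ r ih =>
    intro y
    have hv := isBigO_pow_shift hq (chainSeq_isBigO_pow hq r) a
    have hpath : ∀ n : ℕ, (qPoch q (a + n))⁻¹ *
        (qTri q a * ∑' b : Fin r → ℕ, pathWeight q a (List.ofFn b) n) =
        (qPochInf q)⁻¹ ^ (r + 1) *
          ∑' j : ℕ, chainSeq q r (a + j) * q ^ (n * j) * (qPoch q j)⁻¹ := fun n => by
      rw [ih n, ← mul_assoc, ← mul_assoc, inv_mul_cancel₀ (qPoch_ne_zero hq _), one_mul]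
    have hchain : ∀ i : ℕ, chainSeq q (r + 1) (a + i) * q ^ (y * i) * (qPoch q i)⁻¹ =
        qTri q a * (qTri q i * q ^ ((a + y) * i) * (qPoch q i)⁻¹ *
          qShiftSum q (fun j => chainSeq q r (a + j)) i) := fun i => by
      rw [chainSeq, qTri_add, qShiftSum_add]; ring
    calc _ = qTri q a * ((qPochInf q)⁻¹ ^ (r + 1) *
          ∑' n : ℕ, q ^ ((a + y + 1) * n) * (qPoch q n)⁻¹ *
            ∑' j : ℕ, chainSeq q r (a + j) * q ^ (n * j) * (qPoch q j)⁻¹) := by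
          rw [tsum_pathWeight_succ hq, ← tsum_mul_left (a := (qPochInf q)⁻¹ ^ (r + 1))]
          simp only [hpath, mul_left_comm]
      _ = qTri q a * ((qPochInf q)⁻¹ ^ (r + 1) * ((qPochInf q)⁻¹ * (qPoch q (a + y) *
          ∑' i, qTri q i * q ^ ((a + y) * i) * (qPoch q i)⁻¹ *
            qShiftSum q (fun j => chainSeq q r (a + j)) i))) := by
          rw [tsum_pow_mul_tsum_pow_mul hq hv, tsum_mul_qPoch_add hq hv]
      _ = _ := by
          simp only [hchain, tsum_mul_left]
          ring

/-- The weight of a polygon with a vertex of variable `0`, a vertex of variable `y` and a path of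
further vertices, in a face with the variable `a`. -/
def polygonWeight (q : ℂ) (y a : ℕ) (l : List ℕ) : ℂ :=
  qTriPred q a * q ^ (a * y) * (qPoch q a)⁻¹ * (qPoch q (a + y))⁻¹ *
    (qTri q a * pathWeight q a l y)

theorem exists_polygonWeight_bound (hq : ‖q‖ < 1) (r : ℕ) :
    ∃ C : ℝ, ∀ y a (b : Fin r → ℕ),
      ‖polygonWeight q y a (List.ofFn b)‖ ≤ C * (‖q‖ ^ a * ‖q‖ ^ (List.ofFn b).sum) := by
  obtain ⟨K, hK⟩ := exists_norm_inv_qPoch_le hq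
  have hK0 : 0 ≤ K := (norm_nonneg _).trans (hK 0)
  refine ⟨K * K * (K * K) ^ r, fun y a b => ?_⟩
  rw [polygonWeight, norm_mul, norm_mul, norm_mul, norm_mul, norm_mul]
  calc _ ≤ 1 * 1 * K * K * (‖q‖ ^ a * ((K * K) ^ r * ‖q‖ ^ (List.ofFn b).sum)) := by
        gcongr
        · exact norm_qTriPred_le_one hq _
        · exact norm_pow_le_one hq _
        · exact hK _
        · exact hK _
        · exact norm_qTri_le hq _
        · simpa using norm_pathWeight_le hq hK a (List.ofFn b) y
    _ = _ := by ring

theorem summable_pow_mul_pow_sum (hq : ‖q‖ < 1) (r : ℕ) :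
    Summable fun p : ℕ × (Fin r → ℕ) => ‖q‖ ^ p.1 * ‖q‖ ^ (List.ofFn p.2).sum :=
  Summable.mul_of_nonneg (f := fun n : ℕ => ‖q‖ ^ n)
    (g := fun b : Fin r → ℕ => ‖q‖ ^ (List.ofFn b).sum)
    (summable_geometric_of_lt_one (norm_nonneg q) hq) (summable_pow_sum hq r)
    (fun _ => pow_nonneg (norm_nonneg _) _) (fun _ => pow_nonneg (norm_nonneg _) _)

theorem tsum_polygonWeight (hq : ‖q‖ < 1) (r y a : ℕ) :
    ∑' b : Fin r → ℕ, polygonWeight q y a (List.ofFn b) = (qPochInf q)⁻¹ ^ (r + 1) *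
      (qTriPred q a * (qPoch q a)⁻¹ * qShiftSum q (fun n => q ^ (y * n) * chainSeq q r n) a) := by
  have hshift : qShiftSum q (fun n => q ^ (y * n) * chainSeq q r n) a =
      q ^ (a * y) * ∑' j : ℕ, chainSeq q r (a + j) * q ^ (y * j) * (qPoch q j)⁻¹ := by
    rw [qShiftSum, ← tsum_mul_left]
    exact tsum_congr fun j => by ring
  simp only [polygonWeight, tsum_mul_left]
  rw [tsum_pathWeight hq, hshift]
  field_simp [qPoch_ne_zero hq (a + y)]

theorem hasSum_polygonWeight (hq : ‖q‖ < 1) (r y : ℕ) :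
    HasSum (fun p : ℕ × (Fin r → ℕ) => polygonWeight q y p.1 (List.ofFn p.2))
      ((qPochInf q)⁻¹ ^ (r + 1) * hSeries (r + 2) q) := by
  obtain ⟨C, hC⟩ := exists_polygonWeight_bound hq r
  have hs : Summable fun p : ℕ × (Fin r → ℕ) => polygonWeight q y p.1 (List.ofFn p.2) :=
    .of_norm_bounded ((summable_pow_mul_pow_sum hq r).mul_left C) fun p => hC y p.1 p.2
  have hv : (fun n => q ^ (y * n) * chainSeq q r n) =O[⊤] fun n => ‖q‖ ^ n :=
    isBigO_one_mul_pow (isBigO_one_of_norm_le_one fun n => norm_pow_le_one hq (y * n))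
      (chainSeq_isBigO_pow hq r)
  convert hs.hasSum using 1
  rw [hs.tsum_prod]
  simp only [tsum_polygonWeight hq, tsum_mul_left]
  rw [tsum_qTriPred_mul_qShiftSum hq hv, chainSeq_zero hq, mul_zero, pow_zero, one_mul]

end Polygon

/-! ### Face systems and their cells -/

/-- `1 / (q)_n`, which vanishes for negative `n`. -/
def qPochInv (q : ℂ) (n : ℤ) : ℂ := if 0 ≤ n then (qPoch q n.toNat)⁻¹ else 0

theorem qPochInv_natCast (q : ℂ) (n : ℕ) : qPochInv q n = (qPoch q n)⁻¹ := by simp [qPochInv]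

theorem qPochInv_of_neg (q : ℂ) {n : ℤ} (h : n < 0) : qPochInv q n = 0 := if_neg (not_le.2 h)

/-- The combinatorial data of a multisum: the pairs of an `A`-face and a `B`-face that are separated
by an arc, the pairs of `B`-faces that meet at a crossing, the `B`-faces, and the `A`-faces. -/
@[ext]
structure FaceSystem (ι : Type) where
  arcs : Multiset (ι × ι)
  crossings : Multiset (Sym2 ι)
  bFaces : Multiset ι
  aFaces : Multiset ι

namespace FaceSystem

variable {ι : Type}

instance [DecidableEq ι] : DecidableEq (FaceSystem ι) := fun _ _ =>
  decidable_of_iff _ FaceSystem.ext_iff.symm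

instance : Zero (FaceSystem ι) := ⟨⟨0, 0, 0, 0⟩⟩

instance : Add (FaceSystem ι) :=
  ⟨fun S T => ⟨S.arcs + T.arcs, S.crossings + T.crossings, S.bFaces + T.bFaces,
    S.aFaces + T.aFaces⟩⟩

instance : AddCommMonoid (FaceSystem ι) where
  add_assoc _ _ _ := FaceSystem.ext (add_assoc _ _ _) (add_assoc _ _ _) (add_assoc _ _ _)
    (add_assoc _ _ _)
  zero_add _ := FaceSystem.ext (zero_add _) (zero_add _) (zero_add _) (zero_add _)
  add_zero _ := FaceSystem.ext (add_zero _) (add_zero _) (add_zero _) (add_zero _)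
  add_comm _ _ := FaceSystem.ext (add_comm _ _) (add_comm _ _) (add_comm _ _) (add_comm _ _)
  nsmul := nsmulRec

@[simp]
theorem arcs_add (S T : FaceSystem ι) : (S + T).arcs = S.arcs + T.arcs := rfl

@[simp]
theorem crossings_add (S T : FaceSystem ι) : (S + T).crossings = S.crossings + T.crossings := rfl

@[simp]
theorem bFaces_add (S T : FaceSystem ι) : (S + T).bFaces = S.bFaces + T.bFaces := rfl

@[simp]
theorem aFaces_add (S T : FaceSystem ι) : (S + T).aFaces = S.aFaces + T.aFaces := rfl

/-- Twice the exponent of `q` in the summand of the multisum. -/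
def twoExponent (S : FaceSystem ι) (s : ι → ℤ) : ℤ :=
  (S.arcs.map fun p => s p.1 * (s p.1 + 1) + 2 * (s p.1 * s p.2)).sum +
    2 * (S.crossings.map fun e => (e.map s).mul).sum + 2 * (S.bFaces.map s).sum -
    2 * (S.aFaces.map s).sum

/-- The summand of the multisum. -/
def weight (q : ℂ) (S : FaceSystem ι) (s : ι → ℤ) : ℂ :=
  (-1) ^ (S.arcs.map fun p => s p.1).sum * q ^ (S.twoExponent s / 2) *
    (S.arcs.map fun p => qPochInv q (s p.1 + s p.2)).prod

/-- All arcs have nonnegative values. -/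
def Admissible (S : FaceSystem ι) (s : ι → ℤ) : Prop := ∀ p ∈ S.arcs, 0 ≤ s p.1 + s p.2

/-- Only faces from the set `V` occur. -/
def On (S : FaceSystem ι) (V : Set ι) : Prop :=
  (∀ p ∈ S.arcs, p.1 ∈ V ∧ p.2 ∈ V) ∧ (∀ e ∈ S.crossings, ∀ i ∈ e, i ∈ V) ∧
    (∀ i ∈ S.bFaces, i ∈ V) ∧ ∀ i ∈ S.aFaces, i ∈ V

theorem admissible_add {S T : FaceSystem ι} {s : ι → ℤ} :
    (S + T).Admissible s ↔ S.Admissible s ∧ T.Admissible s := by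
  simp only [Admissible, arcs_add, Multiset.mem_add, or_imp, forall_and]

theorem twoExponent_add (S T : FaceSystem ι) (s : ι → ℤ) :
    (S + T).twoExponent s = S.twoExponent s + T.twoExponent s := by
  simp only [twoExponent, arcs_add, crossings_add, bFaces_add, aFaces_add, Multiset.map_add,
    Multiset.sum_add]
  ring

theorem two_dvd_twoExponent (S : FaceSystem ι) (s : ι → ℤ) : 2 ∣ S.twoExponent s := by
  refine dvd_sub (dvd_add (dvd_add (Multiset.dvd_sum fun x hx => ?_) (dvd_mul_right _ _))
    (dvd_mul_right _ _)) (dvd_mul_right _ _)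
  obtain ⟨p, -, rfl⟩ := Multiset.mem_map.1 hx
  exact dvd_add (Int.even_mul_succ_self _).two_dvd (dvd_mul_right _ _)

theorem weight_of_twoExponent_eq (q : ℂ) {S : FaceSystem ι} {s : ι → ℤ} {n : ℕ}
    (h : S.twoExponent s = 2 * n) :
    S.weight q s = (-1) ^ (S.arcs.map fun p => s p.1).sum * q ^ n *
      (S.arcs.map fun p => qPochInv q (s p.1 + s p.2)).prod := by
  rw [weight, h, Int.mul_ediv_cancel_left _ two_ne_zero, zpow_natCast]

theorem weight_eq_zero {q : ℂ} {S : FaceSystem ι} {s : ι → ℤ} (h : ¬ S.Admissible s) :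
    S.weight q s = 0 := by
  simp only [Admissible, not_forall, not_le] at h
  obtain ⟨p, hp, hn⟩ := h
  exact mul_eq_zero_of_right _
    (Multiset.prod_eq_zero (Multiset.mem_map.2 ⟨p, hp, qPochInv_of_neg q hn⟩))

/-- The exponents have to be nonnegative because `q` may be `0`. -/
theorem weight_add {q : ℂ} {S T : FaceSystem ι} {s : ι → ℤ}
    (hS : S.Admissible s → T.Admissible s → 0 ≤ S.twoExponent s)
    (hT : S.Admissible s → T.Admissible s → 0 ≤ T.twoExponent s) :
    (S + T).weight q s = S.weight q s * T.weight q s := by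
  by_cases hSs : S.Admissible s
  · by_cases hTs : T.Admissible s
    · obtain ⟨m, hm⟩ := Int.eq_ofNat_of_zero_le (Int.ediv_nonneg (hS hSs hTs) two_pos.le)
      obtain ⟨n, hn⟩ := Int.eq_ofNat_of_zero_le (Int.ediv_nonneg (hT hSs hTs) two_pos.le)
      unfold weight
      rw [twoExponent_add, Int.add_ediv_of_dvd_left (S.two_dvd_twoExponent s), hm, hn,
        ← Nat.cast_add]
      simp only [zpow_natCast, arcs_add, Multiset.map_add, Multiset.sum_add, Multiset.prod_add]
      rw [zpow_add₀ (by norm_num), pow_add]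
      ring
    · rw [weight_eq_zero hTs, mul_zero, weight_eq_zero fun h => hTs (admissible_add.1 h).2]
  · rw [weight_eq_zero hSs, zero_mul, weight_eq_zero fun h => hSs (admissible_add.1 h).1]

theorem On.add {S T : FaceSystem ι} {V : Set ι} (hS : S.On V) (hT : T.On V) : (S + T).On V := by
  refine ⟨fun p hp => ?_, fun p hp => ?_, fun p hp => ?_, fun p hp => ?_⟩ <;>
    rcases Multiset.mem_add.1 hp with h | h
  exacts [hS.1 p h, hT.1 p h, hS.2.1 p h, hT.2.1 p h, hS.2.2.1 p h, hT.2.2.1 p h, hS.2.2.2 p h,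
    hT.2.2.2 p h]

theorem On.weight_congr (q : ℂ) {S : FaceSystem ι} {V : Set ι} (h : S.On V) {s s' : ι → ℤ}
    (hs : ∀ i ∈ V, s i = s' i) : S.weight q s = S.weight q s' := by
  obtain ⟨harcs, hcrossings, hbFaces, haFaces⟩ := h
  have hpair {β : Type} (g : ℤ → ℤ → β) : S.arcs.map (fun p => g (s p.1) (s p.2)) =
      S.arcs.map fun p => g (s' p.1) (s' p.2) :=
    Multiset.map_congr rfl fun p hp => by rw [hs _ (harcs p hp).1, hs _ (harcs p hp).2]
  have hcross : (S.crossings.map fun e => (e.map s).mul) =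
      S.crossings.map fun e => (e.map s').mul :=
    Multiset.map_congr rfl fun e he => by
      rw [Sym2.map_congr fun i hi => hs i (hcrossings e he i hi)]
  unfold weight twoExponent
  rw [hpair fun x _ => x, hpair fun x y => qPochInv q (x + y),
    hpair fun x y => x * (x + 1) + 2 * (x * y), hcross,
    Multiset.map_congr rfl fun i hi => hs i (hbFaces i hi),
    Multiset.map_congr rfl fun i hi => hs i (haFaces i hi)]

end FaceSystem

open FaceSystem

theorem choose_two_add_succ_choose_two (a : ℕ) : a.choose 2 + (a + 1).choose 2 = a * a := by
  induction a with
  | zero => rfl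
  | succ a ih =>
    have h₁ := Nat.choose_succ_succ' a 1
    have h₂ := Nat.choose_succ_succ' (a + 1) 1
    simp only [Nat.choose_one_right, Nat.reduceAdd] at h₁ h₂
    linarith

theorem two_mul_succ_choose_two (a : ℕ) : 2 * (a + 1).choose 2 = a * (a + 1) := by
  have h := Nat.choose_succ_succ' a 1
  simp only [Nat.choose_one_right, Nat.reduceAdd] at h
  linarith [choose_two_add_succ_choose_two a]

theorem qTriPred_mul_qTri (q : ℂ) (a : ℕ) : qTriPred q a * qTri q a = q ^ (a * a) := by
  rw [qTriPred, qTri, mul_mul_mul_comm, ← mul_pow, neg_one_mul, neg_neg, one_pow, one_mul,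
    ← pow_add, choose_two_add_succ_choose_two]

/-- The pieces from which a plane graph is assembled: a bigon in the face `f` doubles an edge `u v`;
a polygon in the face `f` adds the path `xs` of new vertices from `w` to the base vertex. -/
inductive Cell (ι : Type)
  | bigon (f u v : ι)
  | polygon (f w : ι) (xs : List ι)

namespace Cell

variable {ι : Type}

/-- The number of vertices which a cell adds. -/
def rank : Cell ι → ℕ
  | bigon _ _ _ => 0
  | polygon _ _ xs => xs.length

/-- The faces whose variables a cell adds. -/
def vars : Cell ι → List ι
  | bigon f _ _ => [f]
  | polygon f _ xs => f :: xs

/-- The vertices which a cell adds. -/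
def verts : Cell ι → List ι
  | bigon _ _ _ => []
  | polygon _ _ xs => xs

/-- The vertices at which a cell is attached, apart from the base vertex of a polygon. -/
def refs : Cell ι → List ι
  | bigon _ u v => [u, v]
  | polygon _ w _ => [w]

/-- The condition under which the variables of a cell can be summed. -/
def Attachable (s : ι → ℤ) : Cell ι → Prop
  | bigon _ _ _ => True
  | polygon _ w _ => 0 ≤ s w

/-- The part of the face system that belongs to an edge `w x` of a path in the face `f` and to its
new vertex `x`; on its other side the path has the face `f₀`. -/
def linkSystem (f₀ f w x : ι) : FaceSystem ι := ⟨{(f, x), (f₀, x)}, {s(w, x)}, {x}, 0⟩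

/-- The part of the face system that belongs to a path in the face `f`, from `w` to `v₀`. -/
def pathSystem (f₀ v₀ f : ι) : List ι → ι → FaceSystem ι
  | [], w => ⟨0, {s(w, v₀)}, 0, 0⟩
  | x :: xs, w => linkSystem f₀ f w x + pathSystem f₀ v₀ f xs x

/-- The part of the face system that belongs to the face `f` of a polygon and to its two vertices
`v₀` and `w` that are already present. -/
def cornerSystem (v₀ f w : ι) : FaceSystem ι := ⟨{(f, v₀), (f, w)}, 0, 0, {f}⟩

/-- The part of the face system that belongs to a cell. -/
def system (f₀ v₀ : ι) : Cell ι → FaceSystem ι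
  | bigon f u v => ⟨{(f, u), (f, v)}, {s(u, v)}, 0, {f}⟩
  | polygon f w xs => cornerSystem v₀ f w + pathSystem f₀ v₀ f xs w

variable {f₀ v₀ f : ι} {q : ℂ} {s : ι → ℤ}

theorem mem_arcs_pathSystem {x : ι} {xs : List ι} (hx : x ∈ xs) (w : ι) :
    (f₀, x) ∈ (pathSystem f₀ v₀ f xs w).arcs := by
  induction xs generalizing w with
  | nil => simp at hx
  | cons z xs ih =>
    rcases List.mem_cons.1 hx with rfl | hx
    · simp [pathSystem, linkSystem]
    · exact Multiset.mem_add.2 (Or.inr (ih hx z))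

theorem mem_arcs_system {x : ι} {c : Cell ι} (hx : x ∈ c.verts) :
    (f₀, x) ∈ (c.system f₀ v₀).arcs := by
  cases c with
  | bigon f u v => simp [verts] at hx
  | polygon f w xs => exact Multiset.mem_add.2 (Or.inr (mem_arcs_pathSystem hx w))

theorem system_bigon_comm (f u v : ι) :
    (bigon f u v).system f₀ v₀ = (bigon f v u).system f₀ v₀ := by
  simp only [system, Multiset.pair_comm (f, u) (f, v), Sym2.eq_swap (a := u)]

theorem twoExponent_linkSystem (hf₀ : s f₀ = 0) (w x : ι) :
    (linkSystem f₀ f w x).twoExponent s = s f * (s f + 1) + 2 * ((s f + s w + 1) * s x) := by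
  simp [linkSystem, twoExponent, hf₀]
  ring

theorem twoExponent_cornerSystem (hv₀ : s v₀ = 0) (w : ι) :
    (cornerSystem v₀ f w).twoExponent s = 2 * (s f * s f + s f * s w) := by
  simp [cornerSystem, twoExponent, hv₀]
  ring

theorem twoExponent_bigon (u v : ι) :
    ((bigon f u v).system f₀ v₀).twoExponent s = 2 * ((s f + s u) * (s f + s v)) := by
  simp [system, twoExponent]
  ring

theorem twoExponent_linkSystem_nonneg (hf₀ : s f₀ = 0) (hf : 0 ≤ s f) {w x : ι} (hw : 0 ≤ s w)
    (hx : 0 ≤ s x) : 0 ≤ (linkSystem f₀ f w x).twoExponent s := by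
  rw [twoExponent_linkSystem hf₀]
  positivity

theorem twoExponent_pathSystem_nonneg (hf₀ : s f₀ = 0) (hv₀ : s v₀ = 0) (hf : 0 ≤ s f)
    {xs : List ι} (hxs : ∀ x ∈ xs, 0 ≤ s x) {w : ι} (hw : 0 ≤ s w) :
    0 ≤ (pathSystem f₀ v₀ f xs w).twoExponent s := by
  induction xs generalizing w with
  | nil => simp [pathSystem, twoExponent, hv₀]
  | cons x xs ih =>
    obtain ⟨hx, hxs⟩ := List.forall_mem_cons.1 hxs
    rw [pathSystem, twoExponent_add]
    exact add_nonneg (twoExponent_linkSystem_nonneg hf₀ hf hw hx) (ih hxs hx)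

theorem nonneg_of_admissible_pathSystem (hf₀ : s f₀ = 0) {xs : List ι} {w : ι}
    (h : (pathSystem f₀ v₀ f xs w).Admissible s) : ∀ x ∈ xs, 0 ≤ s x := fun x hx => by
  simpa [hf₀] using h _ (mem_arcs_pathSystem hx w)

theorem twoExponent_nonneg {c : Cell ι} (hf₀ : s f₀ = 0) (hv₀ : s v₀ = 0) (hc : c.Attachable s)
    (h : (c.system f₀ v₀).Admissible s) : 0 ≤ (c.system f₀ v₀).twoExponent s := by
  cases c with
  | bigon f u v =>
    rw [twoExponent_bigon]
    exact mul_nonneg two_pos.le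
      (mul_nonneg (h (f, u) (by simp [system])) (h (f, v) (by simp [system])))
  | polygon f w xs =>
    obtain ⟨hcorner, hpath⟩ := admissible_add.1 h
    have hf : 0 ≤ s f := by simpa [hv₀] using hcorner (f, v₀) (by simp [cornerSystem])
    have hw : 0 ≤ s w := hc
    rw [system, twoExponent_add, twoExponent_cornerSystem hv₀]
    exact add_nonneg (by positivity)
      (twoExponent_pathSystem_nonneg hf₀ hv₀ hf (nonneg_of_admissible_pathSystem hf₀ hpath) hw)

theorem weight_linkSystem (hf₀ : s f₀ = 0) {a b y : ℕ} {w x : ι} (ha : s f = a) (hw : s w = y)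
    (hx : s x = b) : (linkSystem f₀ f w x).weight q s =
      qTri q a * (q ^ ((a + y + 1) * b) * (qPoch q b)⁻¹ * (qPoch q (a + b))⁻¹) := by
  have hexp : (linkSystem f₀ f w x).twoExponent s =
      2 * (((a + 1).choose 2 + (a + y + 1) * b : ℕ) : ℤ) := by
    have htri : (2 * ((a + 1).choose 2 : ℕ) : ℤ) = a * (a + 1) :=
      mod_cast two_mul_succ_choose_two a
    rw [twoExponent_linkSystem hf₀, ha, hw, hx]
    push_cast
    linear_combination -htri
  rw [weight_of_twoExponent_eq q hexp, pow_add, qTri]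
  simp only [linkSystem, Multiset.insert_eq_cons, Multiset.map_cons, Multiset.map_singleton,
    Multiset.sum_cons, Multiset.sum_singleton, Multiset.prod_cons, Multiset.prod_singleton,
    hf₀, ha, hx, add_zero, zero_add, zpow_natCast, qPochInv_natCast, ← Nat.cast_add]
  ring

theorem nonneg_of_map_eq_natCast {xs : List ι} {l : List ℕ} (hl : xs.map s = l.map Nat.cast) :
    ∀ x ∈ xs, 0 ≤ s x := fun x hx => by
  obtain ⟨n, -, hn⟩ := List.mem_map.1 (hl ▸ List.mem_map_of_mem (f := s) hx)
  exact hn ▸ n.cast_nonneg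

theorem weight_pathSystem (hf₀ : s f₀ = 0) (hv₀ : s v₀ = 0) {a : ℕ} (ha : s f = a) {xs : List ι}
    {l : List ℕ} (hl : xs.map s = l.map Nat.cast) {w : ι} {y : ℕ} (hw : s w = y) :
    (pathSystem f₀ v₀ f xs w).weight q s = pathWeight q a l y := by
  induction xs generalizing l w y with
  | nil =>
    obtain rfl : l = [] := by simpa using hl.symm
    simp [pathSystem, weight, twoExponent, hv₀, pathWeight]
  | cons x xs ih =>
    obtain _ | ⟨b, l⟩ := l
    · simp at hl
    obtain ⟨hx, hxs⟩ := List.cons.inj hl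
    have hf_nonneg : 0 ≤ s f := ha ▸ a.cast_nonneg
    have hw_nonneg : 0 ≤ s w := hw ▸ y.cast_nonneg
    have hx_nonneg : 0 ≤ s x := hx ▸ b.cast_nonneg
    rw [pathSystem, weight_add
      (fun _ _ => twoExponent_linkSystem_nonneg hf₀ hf_nonneg hw_nonneg hx_nonneg)
      (fun _ _ => twoExponent_pathSystem_nonneg hf₀ hv₀ hf_nonneg (nonneg_of_map_eq_natCast hxs)
        hx_nonneg), weight_linkSystem hf₀ ha hw hx, ih hxs hx, pathWeight]

theorem weight_polygon (hf₀ : s f₀ = 0) (hv₀ : s v₀ = 0) {a y : ℕ} {w : ι} {xs : List ι}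
    {l : List ℕ} (ha : s f = a) (hw : s w = y) (hl : xs.map s = l.map Nat.cast) :
    ((polygon f w xs).system f₀ v₀).weight q s = polygonWeight q y a l := by
  have hf_nonneg : 0 ≤ s f := ha ▸ a.cast_nonneg
  have hw_nonneg : 0 ≤ s w := hw ▸ y.cast_nonneg
  have hexp : (cornerSystem v₀ f w).twoExponent s = 2 * ((a * a + a * y : ℕ) : ℤ) := by
    rw [twoExponent_cornerSystem hv₀, ha, hw]
    push_cast
    rfl
  have hsign : (-1 : ℂ) ^ (a + a) = 1 := Even.neg_one_pow ⟨a, rfl⟩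
  rw [system, weight_add (fun _ _ => by rw [hexp]; positivity)
    (fun _ _ => twoExponent_pathSystem_nonneg hf₀ hv₀ hf_nonneg (nonneg_of_map_eq_natCast hl)
      hw_nonneg), weight_pathSystem hf₀ hv₀ ha hl hw, polygonWeight,
    weight_of_twoExponent_eq q hexp, pow_add, ← qTriPred_mul_qTri]
  simp only [cornerSystem, Multiset.insert_eq_cons, Multiset.map_cons, Multiset.map_singleton,
    Multiset.sum_cons, Multiset.sum_singleton, Multiset.prod_cons, Multiset.prod_singleton,
    hv₀, ha, hw, add_zero, ← Nat.cast_add, zpow_natCast, hsign, qPochInv_natCast]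
  ring

theorem weight_bigon (u v : ι) {n d : ℕ} (hu : s f + s u = n) (hv : s f + s v = n + d) :
    ((bigon f u v).system f₀ v₀).weight q s = polygonWeight q d n [] := by
  have hexp : ((bigon f u v).system f₀ v₀).twoExponent s = 2 * ((n * n + n * d : ℕ) : ℤ) := by
    rw [twoExponent_bigon, hu, hv]
    push_cast
    ring
  have hsign : (-1 : ℂ) ^ (s f + s f) = 1 := Even.neg_one_zpow ⟨s f, rfl⟩
  rw [weight_of_twoExponent_eq q hexp, polygonWeight, pathWeight, mul_one, pow_add,
    ← qTriPred_mul_qTri]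
  simp only [system, Multiset.insert_eq_cons, Multiset.map_cons, Multiset.map_singleton,
    Multiset.sum_cons, Multiset.sum_singleton, Multiset.prod_cons, Multiset.prod_singleton, hu, hv,
    hsign, qPochInv_natCast, ← Nat.cast_add]
  ring

end Cell

theorem hasSum_mul_of_fiberwise {α β : Type*} {f : α → ℂ} {g : α → β → ℂ} {A B : ℂ} {K : ℝ}
    (hf : HasSum f A) (hg : ∀ a, f a ≠ 0 → HasSum (g a) B ∧ ∑' b, ‖g a b‖ ≤ K) :
    HasSum (fun p : α × β => f p.1 * g p.1 p.2) (A * B) := by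
  have hfiber : ∀ a, HasSum (fun b => f a * g a b) (f a * B) := fun a => by
    by_cases ha : f a = 0
    · simp [ha]
    · exact (hg a ha).1.mul_left (f a)
  have hnorm : Summable fun a => ∑' b, ‖f a * g a b‖ := by
    refine .of_nonneg_of_le (fun a => tsum_nonneg fun b => norm_nonneg _) (fun a => ?_)
      (hf.summable.norm.mul_right K)
    by_cases ha : f a = 0
    · simp [ha]
    · simp only [norm_mul]
      rw [tsum_mul_left]
      exact mul_le_mul_of_nonneg_left (hg a ha).2 (norm_nonneg _)
  have hs : Summable fun p : α × β => f p.1 * g p.1 p.2 :=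
    .of_norm ((summable_prod_of_nonneg fun _ => norm_nonneg _).2
      ⟨fun a => (hfiber a).summable.norm, hnorm⟩)
  have hsum := hs.hasSum.prod_fiberwise hfiber
  rw [(hf.mul_right B).unique hsum]
  exact hs.hasSum

/-- The bound `K` is uniform in `y`, which stands for a variable outside the polygon. -/
theorem exists_hasSum_of_polygonWeight {q : ℂ} (hq : ‖q‖ < 1) (r : ℕ) :
    ∃ K : ℝ, ∀ {β : Type} (F : β → ℂ) (y : ℕ) (φ : ℕ × (Fin r → ℕ) → β), Function.Injective φ →
      (∀ x ∉ Set.range φ, F x = 0) → (∀ p, F (φ p) = polygonWeight q y p.1 (List.ofFn p.2)) →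
      HasSum F ((qPochInf q)⁻¹ ^ (r + 1) * hSeries (r + 2) q) ∧ ∑' x, ‖F x‖ ≤ K := by
  obtain ⟨C, hC⟩ := exists_polygonWeight_bound hq r
  refine ⟨C * ∑' p : ℕ × (Fin r → ℕ), ‖q‖ ^ p.1 * ‖q‖ ^ (List.ofFn p.2).sum,
    fun F y φ hφ hzero hF => ⟨?_, ?_⟩⟩
  · rw [← hφ.hasSum_iff hzero, show F ∘ φ = _ from funext hF]
    exact hasSum_polygonWeight hq r y
  · have hsupp : Function.support (fun x => ‖F x‖) ⊆ Set.range φ := fun x hx =>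
      not_imp_comm.1 (hzero x) (norm_ne_zero_iff.1 hx)
    rw [← hφ.tsum_eq hsupp, ← tsum_mul_left]
    simp only [hF]
    exact Summable.tsum_le_tsum (fun p => hC y p.1 p.2) (hasSum_polygonWeight hq r y).summable.norm
      ((summable_pow_mul_pow_sum hq r).mul_left C)

section ExtendGet

variable {ι β : Type*} {U : List ι}

theorem extend_get_apply (hU : U.Nodup) (t : Fin U.length → β) (s : ι → β) (k : Fin U.length) :
    Function.extend U.get t s (U.get k) = t k :=
  (List.nodup_iff_injective_get.1 hU).extend_apply t s k

theorem extend_get_of_notMem (t : Fin U.length → β) (s : ι → β) {i : ι} (hi : i ∉ U) :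
    Function.extend U.get t s i = s i :=
  Function.extend_apply' _ _ _ fun ⟨k, hk⟩ => hi (hk ▸ List.get_mem U k)

theorem map_extend_get_cons {f : ι} {xs : List ι} (h : (f :: xs).Nodup)
    (t : Fin (xs.length + 1) → β) (s : ι → β) :
    xs.map (Function.extend (f :: xs).get t s) = List.ofFn fun i => t i.succ :=
  List.ext_getElem (by simp) fun n hn _ => by
    rw [List.length_map] at hn
    simpa using extend_get_apply h t s (Fin.succ ⟨n, hn⟩)

end ExtendGet

namespace Cell

variable {ι : Type} {f₀ v₀ : ι} {q : ℂ}

/-- With `n = s f + s u` in place of `s f`, a bigon is a polygon without new vertices. -/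
theorem exists_hasSum_bigon_of_le (hq : ‖q‖ < 1) (f : ι) : ∃ K : ℝ, ∀ (u v : ι) (s : ι → ℤ),
    u ≠ f → v ≠ f → s u ≤ s v →
    HasSum (fun t : Fin 1 → ℤ => ((bigon f u v).system f₀ v₀).weight q
      (Function.extend [f].get t s)) ((qPochInf q)⁻¹ ^ (0 + 1) * hSeries (0 + 2) q) ∧
    ∑' t : Fin 1 → ℤ,
      ‖((bigon f u v).system f₀ v₀).weight q (Function.extend [f].get t s)‖ ≤ K := by
  obtain ⟨K, hK⟩ := exists_hasSum_of_polygonWeight hq 0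
  refine ⟨K, fun u v s hu hv huv => ?_⟩
  have hextf (t : Fin 1 → ℤ) : Function.extend [f].get t s f = t 0 :=
    extend_get_apply (List.nodup_singleton f) t s 0
  have hext (t : Fin 1 → ℤ) {i : ι} (hi : i ≠ f) : Function.extend [f].get t s i = s i :=
    extend_get_of_notMem t s (mt List.mem_singleton.1 hi)
  obtain ⟨d, hd⟩ := Int.eq_ofNat_of_zero_le (sub_nonneg.2 huv)
  refine hK (fun t : Fin 1 → ℤ => ((bigon f u v).system f₀ v₀).weight q
    (Function.extend [f].get t s)) d (fun p _ => p.1 - s u) ?injective ?zero ?weight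
  case injective =>
    rintro ⟨a, b⟩ ⟨a', b'⟩ h
    have ha := congrFun h 0
    simp only [sub_left_inj, Nat.cast_inj] at ha
    exact Prod.ext ha (Subsingleton.elim _ _)
  case zero =>
    refine fun t ht => weight_eq_zero fun h => ht ?_
    have hn : 0 ≤ t 0 + s u := by simpa only [hextf, hext t hu] using h (f, u) (by simp [system])
    refine ⟨((t 0 + s u).toNat, Fin.elim0), funext fun i => ?_⟩
    rw [Subsingleton.elim i 0]
    simp [hn]
  case weight =>
    rintro ⟨a, b⟩
    rw [List.ofFn_zero]
    refine weight_bigon u v ?_ ?_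
    · rw [hextf, hext _ hu]; simp
    · rw [hextf, hext _ hv]; linear_combination hd

theorem exists_hasSum_bigon (hq : ‖q‖ < 1) {f u v : ι} (hu : u ≠ f) (hv : v ≠ f) :
    ∃ K : ℝ, ∀ s : ι → ℤ,
      HasSum (fun t : Fin 1 → ℤ => ((bigon f u v).system f₀ v₀).weight q
        (Function.extend [f].get t s)) ((qPochInf q)⁻¹ ^ (0 + 1) * hSeries (0 + 2) q) ∧
      ∑' t : Fin 1 → ℤ,
        ‖((bigon f u v).system f₀ v₀).weight q (Function.extend [f].get t s)‖ ≤ K := by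
  obtain ⟨K, hK⟩ := exists_hasSum_bigon_of_le (f₀ := f₀) (v₀ := v₀) hq f
  refine ⟨K, fun s => ?_⟩
  rcases le_total (s u) (s v) with h | h
  · exact hK u v s hu hv h
  · rw [system_bigon_comm]
    exact hK v u s hv hu h

theorem exists_hasSum_polygon (hq : ‖q‖ < 1) {f w : ι} {xs : List ι} (hnd : (f :: xs).Nodup)
    (hf₀ : f₀ ∉ f :: xs) (hv₀ : v₀ ∉ f :: xs) (hw : w ∉ f :: xs) :
    ∃ K : ℝ, ∀ s : ι → ℤ, s f₀ = 0 → s v₀ = 0 → 0 ≤ s w →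
      HasSum (fun t : Fin (xs.length + 1) → ℤ => ((polygon f w xs).system f₀ v₀).weight q
        (Function.extend (f :: xs).get t s))
        ((qPochInf q)⁻¹ ^ (xs.length + 1) * hSeries (xs.length + 2) q) ∧
      ∑' t : Fin (xs.length + 1) → ℤ,
        ‖((polygon f w xs).system f₀ v₀).weight q (Function.extend (f :: xs).get t s)‖ ≤ K := by
  obtain ⟨K, hK⟩ := exists_hasSum_of_polygonWeight hq xs.length
  refine ⟨K, fun s hsf₀ hsv₀ hsw => ?_⟩
  obtain ⟨y, hy⟩ := Int.eq_ofNat_of_zero_le hsw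
  have hextf (t : Fin (xs.length + 1) → ℤ) : Function.extend (f :: xs).get t s f = t 0 :=
    extend_get_apply hnd t s 0
  have hextf₀ (t) : Function.extend (f :: xs).get t s f₀ = 0 :=
    (extend_get_of_notMem t s hf₀).trans hsf₀
  have hextv₀ (t) : Function.extend (f :: xs).get t s v₀ = 0 :=
    (extend_get_of_notMem t s hv₀).trans hsv₀
  refine hK (fun t : Fin (xs.length + 1) → ℤ => ((polygon f w xs).system f₀ v₀).weight q
    (Function.extend (f :: xs).get t s)) y
    (fun p => Fin.cons (p.1 : ℤ) fun i => (p.2 i : ℤ)) ?injective ?zero ?weight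
  case injective =>
    rintro ⟨a, b⟩ ⟨a', b'⟩ h
    obtain ⟨ha, hb⟩ := Fin.cons_injective2 h
    exact Prod.ext (Nat.cast_inj.1 ha) (funext fun i => Nat.cast_inj.1 (congrFun hb i))
  case zero =>
    refine fun t ht => weight_eq_zero fun h => ht ?_
    have hf : 0 ≤ t 0 := by
      simpa only [hextf, hextv₀, add_zero] using h (f, v₀) (by simp [system, cornerSystem])
    have hxs (i : Fin xs.length) : 0 ≤ t i.succ := by
      rw [← extend_get_apply hnd t s i.succ]
      exact nonneg_of_admissible_pathSystem (hextf₀ t) (admissible_add.1 h).2 _ (List.get_mem xs i)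
    refine ⟨((t 0).toNat, fun i => (t i.succ).toNat), funext fun i => ?_⟩
    refine Fin.cases ?_ (fun i => ?_) i
    · simp [hf]
    · simp [hxs]
  case weight =>
    rintro ⟨a, b⟩
    refine weight_polygon (hextf₀ _) (hextv₀ _) (hextf _) ?_ ?_
    · rw [extend_get_of_notMem _ _ hw, hy]
    · rw [map_extend_get_cons hnd, List.map_ofFn]
      rfl

theorem exists_hasSum (hq : ‖q‖ < 1) (c : Cell ι) (hnd : c.vars.Nodup) (hf₀ : f₀ ∉ c.vars)
    (hv₀ : v₀ ∉ c.vars) (hr : ∀ i ∈ c.refs, i ∉ c.vars) :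
    ∃ K : ℝ, ∀ s : ι → ℤ, s f₀ = 0 → s v₀ = 0 → c.Attachable s →
      HasSum (fun t : Fin c.vars.length → ℤ => (c.system f₀ v₀).weight q
        (Function.extend c.vars.get t s)) ((qPochInf q)⁻¹ ^ (c.rank + 1) * hSeries (c.rank + 2) q) ∧
      ∑' t : Fin c.vars.length → ℤ,
        ‖(c.system f₀ v₀).weight q (Function.extend c.vars.get t s)‖ ≤ K := by
  cases c with
  | bigon f u v =>
    obtain ⟨K, hK⟩ := exists_hasSum_bigon (f₀ := f₀) (v₀ := v₀) hq
      (mt List.mem_singleton.2 (hr u (by simp [refs])))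
      (mt List.mem_singleton.2 (hr v (by simp [refs])))
    exact ⟨K, fun s _ _ _ => hK s⟩
  | polygon f w xs => exact exists_hasSum_polygon hq hnd hf₀ hv₀ (hr w (by simp [refs]))

end Cell

/-! ### Assembling cells -/

section Assembly

variable {ι : Type} (f₀ v₀ w₀ : ι)

/-- The variables of the graph assembled from an edge `v₀ w₀` and a list of cells, other than those
of `v₀` and of the face `f₀` with which the edge starts; the last cell added comes first. -/
def cellVars : List (Cell ι) → List ι
  | [] => [w₀]
  | c :: L => c.vars ++ cellVars L

/-- The vertices of the assembled graph other than `v₀`. -/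
def cellVerts : List (Cell ι) → List ι
  | [] => [w₀]
  | c :: L => c.verts ++ cellVerts L

/-- The face system of the assembled graph. -/
def cellSystem : List (Cell ι) → FaceSystem ι
  | [] => ⟨{(f₀, v₀), (f₀, w₀)}, {s(v₀, w₀)}, {v₀, w₀}, {f₀}⟩
  | c :: L => c.system f₀ v₀ + cellSystem L

/-- The number of edges of the assembled graph. -/
def cellEdges (L : List (Cell ι)) : ℕ := (L.map fun c => c.rank + 1).sum + 1

/-- Every cell is attached to vertices that are present. -/
def ValidCells : List (Cell ι) → Prop
  | [] => True
  | .bigon _ u v :: L => (u ∈ v₀ :: cellVerts w₀ L ∧ v ∈ v₀ :: cellVerts w₀ L) ∧ ValidCells L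
  | .polygon _ w _ :: L => w ∈ cellVerts w₀ L ∧ ValidCells L

variable {f₀ v₀ w₀} {q : ℂ} {c : Cell ι} {L : List (Cell ι)} {s : ι → ℤ} {V : Set ι}

theorem cellVerts_subset (L : List (Cell ι)) : cellVerts w₀ L ⊆ cellVars w₀ L := by
  induction L with
  | nil => exact List.Subset.refl _
  | cons c L ih =>
    have hc : c.verts ⊆ c.vars := by cases c <;> simp [Cell.verts, Cell.vars]
    exact List.append_subset.2 ⟨List.Subset.trans hc (List.subset_append_left _ _),
      List.Subset.trans ih (List.subset_append_right _ _)⟩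

theorem mem_arcs_cellSystem {x : ι} (hx : x ∈ cellVerts w₀ L) :
    (f₀, x) ∈ (cellSystem f₀ v₀ w₀ L).arcs := by
  induction L with
  | nil => obtain rfl := List.mem_singleton.1 hx; simp [cellSystem]
  | cons c L ih =>
    rcases List.mem_append.1 hx with h | h
    · exact Multiset.mem_add.2 (Or.inl (Cell.mem_arcs_system h))
    · exact Multiset.mem_add.2 (Or.inr (ih h))

theorem ValidCells.tail (h : ValidCells v₀ w₀ (c :: L)) : ValidCells v₀ w₀ L := by
  cases c <;> exact h.2

theorem ValidCells.refs (h : ValidCells v₀ w₀ (c :: L)) :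
    ∀ i ∈ c.refs, i ∈ v₀ :: cellVars w₀ L := by
  have hsub : v₀ :: cellVerts w₀ L ⊆ v₀ :: cellVars w₀ L :=
    List.cons_subset_cons _ (cellVerts_subset L)
  cases c with
  | bigon f u v => simpa [Cell.refs] using And.intro (hsub h.1.1) (hsub h.1.2)
  | polygon f w xs => simpa [Cell.refs] using hsub (List.mem_cons_of_mem _ h.1)

theorem ValidCells.attachable (h : ValidCells v₀ w₀ (c :: L)) (hf₀ : s f₀ = 0)
    (hs : (cellSystem f₀ v₀ w₀ L).Admissible s) : c.Attachable s := by
  cases c with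
  | bigon f u v => trivial
  | polygon f w xs => simpa [Cell.Attachable, hf₀] using hs _ (mem_arcs_cellSystem h.1)

theorem twoExponent_cellSystem_nonneg (hf₀ : s f₀ = 0) (hv₀ : s v₀ = 0) (hL : ValidCells v₀ w₀ L)
    (h : (cellSystem f₀ v₀ w₀ L).Admissible s) : 0 ≤ (cellSystem f₀ v₀ w₀ L).twoExponent s := by
  induction L with
  | nil =>
    have hw₀ := h (f₀, w₀) (by simp [cellSystem])
    simp only [hf₀, zero_add] at hw₀
    simpa [cellSystem, twoExponent, hf₀, hv₀] using hw₀
  | cons c L ih =>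
    obtain ⟨hadm_c, hadm_L⟩ := admissible_add.1 h
    rw [cellSystem, twoExponent_add]
    exact add_nonneg (Cell.twoExponent_nonneg hf₀ hv₀ (hL.attachable hf₀ hadm_L) hadm_c)
      (ih hL.tail hadm_L)

theorem weight_cellSystem_cons (hf₀ : s f₀ = 0) (hv₀ : s v₀ = 0)
    (hL : ValidCells v₀ w₀ (c :: L)) : (cellSystem f₀ v₀ w₀ (c :: L)).weight q s =
      (cellSystem f₀ v₀ w₀ L).weight q s * (c.system f₀ v₀).weight q s := by
  rw [cellSystem, weight_add, mul_comm]
  · exact fun hc h => Cell.twoExponent_nonneg hf₀ hv₀ (hL.attachable hf₀ h) hc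
  · exact fun _ h => twoExponent_cellSystem_nonneg hf₀ hv₀ hL.tail h

theorem Cell.pathSystem_on {f : ι} (hf₀ : f₀ ∈ V) (hv₀ : v₀ ∈ V) (hf : f ∈ V) {xs : List ι}
    (hxs : ∀ x ∈ xs, x ∈ V) {w : ι} (hw : w ∈ V) : (pathSystem f₀ v₀ f xs w).On V := by
  induction xs generalizing w with
  | nil => simp [pathSystem, FaceSystem.On, hw, hv₀]
  | cons x xs ih =>
    obtain ⟨hx, hxs⟩ := List.forall_mem_cons.1 hxs
    exact FaceSystem.On.add (by simp [linkSystem, FaceSystem.On, hw, hx, hf₀, hf]) (ih hxs hx)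

theorem Cell.system_on (hf₀ : f₀ ∈ V) (hv₀ : v₀ ∈ V) (hc : ∀ i ∈ c.vars, i ∈ V)
    (hr : ∀ i ∈ c.refs, i ∈ V) : (c.system f₀ v₀).On V := by
  cases c with
  | bigon f u v =>
    simp only [vars, refs, List.mem_cons, List.not_mem_nil, or_false, forall_eq_or_imp,
      forall_eq] at hc hr
    simp [system, FaceSystem.On, hc, hr]
  | polygon f w xs =>
    simp only [vars, refs, List.mem_cons, List.not_mem_nil, or_false, forall_eq_or_imp,
      forall_eq] at hc hr
    exact FaceSystem.On.add (by simp [cornerSystem, FaceSystem.On, hc.1, hr, hv₀])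
      (pathSystem_on hf₀ hv₀ hc.1 hc.2 hr)

theorem cellSystem_on (hf₀ : f₀ ∈ V) (hv₀ : v₀ ∈ V) (hL : ValidCells v₀ w₀ L)
    (hV : ∀ i ∈ cellVars w₀ L, i ∈ V) : (cellSystem f₀ v₀ w₀ L).On V := by
  induction L with
  | nil => simp [cellSystem, FaceSystem.On, hf₀, hv₀, hV w₀ (by simp [cellVars])]
  | cons c L ih =>
    obtain ⟨hc, hVL⟩ := List.forall_mem_append.1 hV
    exact FaceSystem.On.add (Cell.system_on hf₀ hv₀ hc fun i hi =>
      List.forall_mem_cons.2 ⟨hv₀, hVL⟩ i (hL.refs i hi)) (ih hL.tail hVL)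

/-- The assignments that vanish outside a list of faces. -/
abbrev SupportedOn (V : List ι) : Type := {s : ι → ℤ // ∀ i ∉ V, s i = 0}

namespace SupportedOn

variable {U V : List ι}

/-- Extension of an assignment by the values of further variables. -/
def extend (U : List ι) {V : List ι} (p : SupportedOn V × (Fin U.length → ℤ)) :
    SupportedOn (U ++ V) :=
  ⟨Function.extend U.get p.2 p.1.1, fun i hi => by
    rw [List.mem_append, not_or] at hi
    rw [extend_get_of_notMem _ _ hi.1, p.1.2 i hi.2]⟩

theorem extend_injective (hU : U.Nodup) (hUV : U.Disjoint V) :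
    Function.Injective (extend U (V := V)) := by
  rintro ⟨s, t⟩ ⟨s', t'⟩ h
  have hval : Function.extend U.get t s.1 = Function.extend U.get t' s'.1 :=
    congrArg Subtype.val h
  refine Prod.ext (Subtype.ext (funext fun i => ?_)) (funext fun k => ?_)
  · by_cases hi : i ∈ U
    · rw [s.2 i (hUV hi), s'.2 i (hUV hi)]
    · simpa only [extend_get_of_notMem _ _ hi] using congrFun hval i
  · simpa only [extend_get_apply hU] using congrFun hval (U.get k)

theorem extend_surjective (hU : U.Nodup) : Function.Surjective (extend U (V := V)) := by
  classical
  rintro ⟨s, hs⟩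
  refine ⟨(⟨fun i => if i ∈ U then 0 else s i, fun i hi => ?_⟩, fun k => s (U.get k)),
    Subtype.ext (funext fun i => ?_)⟩
  · dsimp only
    split_ifs with hiU
    · rfl
    · exact hs i (by simp [hiU, hi])
  · by_cases hi : i ∈ U
    · obtain ⟨k, rfl⟩ := List.mem_iff_get.1 hi
      exact extend_get_apply hU _ _ k
    · exact (extend_get_of_notMem _ _ hi).trans (if_neg hi)

end SupportedOn

theorem hasSum_weight_nil (hq : ‖q‖ < 1) (hf₀ : f₀ ≠ w₀) (hv₀ : v₀ ≠ w₀) :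
    HasSum (fun s : SupportedOn [w₀] => (cellSystem f₀ v₀ w₀ []).weight q s.1) (qPochInf q)⁻¹ := by
  classical
  have hzero (s : SupportedOn [w₀]) {i : ι} (hi : i ≠ w₀) : s.1 i = 0 :=
    s.2 i (mt List.mem_singleton.1 hi)
  let φ (n : ℕ) : SupportedOn [w₀] :=
    ⟨fun i => if i = w₀ then n else 0, fun i hi => if_neg (by simpa using hi)⟩
  have hφ : Function.Injective φ := fun m n h => by
    simpa [φ] using congrFun (congrArg Subtype.val h) w₀
  rw [← hφ.hasSum_iff]
  · have heuler := (summable_norm_pow_mul_inv_qPoch hq 0).of_norm.hasSum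
    rw [tsum_pow_mul_inv_qPoch hq 0, qPoch_zero, one_mul] at heuler
    suffices hterm : ∀ n, (cellSystem f₀ v₀ w₀ []).weight q (φ n).1 =
        q ^ ((0 + 1) * n) * (qPoch q n)⁻¹ by simpa only [Function.comp_def, hterm] using heuler
    intro n
    have hw₀ : (φ n).1 w₀ = n := if_pos rfl
    have hexp : (cellSystem f₀ v₀ w₀ []).twoExponent (φ n).1 = 2 * n := by
      simp [cellSystem, twoExponent, hzero _ hf₀, hzero _ hv₀, hw₀]
    rw [weight_of_twoExponent_eq q hexp]
    simp [cellSystem, hzero _ hf₀, hzero _ hv₀, hw₀, qPochInv, qPoch_zero]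
  · refine fun s hs => weight_eq_zero fun h => hs ?_
    have hw₀ : 0 ≤ s.1 w₀ := by
      simpa only [hzero s hf₀, zero_add] using h (f₀, w₀) (by simp [cellSystem])
    refine ⟨(s.1 w₀).toNat, Subtype.ext (funext fun i => ?_)⟩
    by_cases hi : i = w₀
    · simp [φ, hi, hw₀]
    · simp [φ, hi, hzero s hi]

theorem weight_cellSystem_extend (hL : ValidCells v₀ w₀ (c :: L))
    (hnd : (f₀ :: v₀ :: cellVars w₀ (c :: L)).Nodup) (s : SupportedOn (cellVars w₀ L))
    (t : Fin c.vars.length → ℤ) :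
    (cellSystem f₀ v₀ w₀ (c :: L)).weight q (Function.extend c.vars.get t s.1) =
      (cellSystem f₀ v₀ w₀ L).weight q s.1 *
        (c.system f₀ v₀).weight q (Function.extend c.vars.get t s.1) := by
  simp only [cellVars, List.nodup_cons, List.mem_cons, List.mem_append, not_or,
    List.nodup_append'] at hnd
  obtain ⟨⟨-, hf₀c, hf₀L⟩, ⟨hv₀c, hv₀L⟩, -, -, hdisj⟩ := hnd
  have hext {i : ι} (hi : i ∉ c.vars) : Function.extend c.vars.get t s.1 i = s.1 i :=
    extend_get_of_notMem t s.1 hi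
  rw [weight_cellSystem_cons ((hext hf₀c).trans (s.2 _ hf₀L)) ((hext hv₀c).trans (s.2 _ hv₀L)) hL]
  congr 1
  refine FaceSystem.On.weight_congr q (V := {i | i = f₀ ∨ i = v₀ ∨ i ∈ cellVars w₀ L})
    (cellSystem_on (by simp) (by simp) hL.tail fun i hi => Or.inr (Or.inr hi)) fun i hi => ?_
  rcases hi with rfl | rfl | hi
  · exact hext hf₀c
  · exact hext hv₀c
  · exact hext fun h => hdisj h hi

/-- Each cell contributes a factor: by induction the variables of the last cell are summed first. -/
theorem hasSum_weight_cellSystem (hq : ‖q‖ < 1) (hL : ValidCells v₀ w₀ L)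
    (hnd : (f₀ :: v₀ :: cellVars w₀ L).Nodup) :
    HasSum (fun s : SupportedOn (cellVars w₀ L) => (cellSystem f₀ v₀ w₀ L).weight q s.1)
      ((qPochInf q)⁻¹ ^ cellEdges L * (L.map fun c => hSeries (c.rank + 2) q).prod) := by
  induction L with
  | nil =>
    simp only [cellVars, List.nodup_cons, List.mem_cons, List.not_mem_nil, or_false, not_or] at hnd
    simpa [cellEdges, cellVars] using hasSum_weight_nil hq hnd.1.2 hnd.2.1
  | cons c L ih =>
    have hweight := weight_cellSystem_extend (q := q) hL hnd
    simp only [cellVars, List.nodup_cons, List.mem_cons, List.mem_append, not_or,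
      List.nodup_append'] at hnd
    obtain ⟨⟨hf₀v₀, hf₀c, hf₀L⟩, ⟨hv₀c, hv₀L⟩, hnd_c, hnd_L, hdisj⟩ := hnd
    have hrefs : ∀ i ∈ c.refs, i ∉ c.vars := fun i hi hi' => by
      rcases List.mem_cons.1 (hL.refs i hi) with rfl | h
      exacts [hv₀c hi', hdisj hi' h]
    obtain ⟨K, hK⟩ := Cell.exists_hasSum (f₀ := f₀) (v₀ := v₀) hq c hnd_c hf₀c hv₀c hrefs
    have hprod := hasSum_mul_of_fiberwise (g := fun (s : SupportedOn (cellVars w₀ L))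
      (t : Fin c.vars.length → ℤ) => (c.system f₀ v₀).weight q (Function.extend c.vars.get t s.1))
      (ih hL.tail (by simp [hf₀v₀, hf₀L, hv₀L, hnd_L])) fun s hs => hK s.1 (s.2 _ hf₀L) (s.2 _ hv₀L)
        (hL.attachable (s.2 _ hf₀L) (by_contra fun h => hs (weight_eq_zero h)))
    refine (Equiv.ofBijective _ ⟨SupportedOn.extend_injective hnd_c hdisj,
      SupportedOn.extend_surjective hnd_c⟩).hasSum_iff.1 ?_
    convert hprod using 1
    · exact funext fun p => hweight p.1 p.2
    · simp only [cellEdges, List.map_cons, List.sum_cons, List.prod_cons]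
      ring

end Assembly

namespace AlternatingKnotDiagram

variable (D : AlternatingKnotDiagram) {x y : D.Crossing} {k l : Fin 4} {F G : D.Region}

theorem under_end_unique (hk : k = 0 ∨ k = 2) (hl : l = 0 ∨ l = 2) (h : D.pd x k = D.pd y l) :
    (x, k) = (y, l) :=
  (D.under_end (D.pd y l)).unique ⟨hk, h⟩ ⟨hl, rfl⟩

theorem over_end_unique (hk : k = 1 ∨ k = 3) (hl : l = 1 ∨ l = 3) (h : D.pd x k = D.pd y l) :
    (x, k) = (y, l) :=
  (D.over_end (D.pd y l)).unique ⟨hk, h⟩ ⟨hl, rfl⟩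

/-! ### Colours of the corners -/

theorem cornerStep_parity {d e : D.Crossing × Fin 4} (h : CornerStep D.pd d e) :
    (d.2 = 1 ∨ d.2 = 3) ↔ (e.2 = 1 ∨ e.2 = 3) := by
  obtain ⟨x, k⟩ := d
  obtain ⟨y, l⟩ := e
  obtain ⟨harc, hends⟩ := h
  have hunder : ¬ ((k + 1 = 0 ∨ k + 1 = 2) ∧ (l = 0 ∨ l = 2)) :=
    fun h => hends (D.under_end_unique h.1 h.2 harc)
  have hover : ¬ ((k + 1 = 1 ∨ k + 1 = 3) ∧ (l = 1 ∨ l = 3)) :=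
    fun h => hends (D.over_end_unique h.1 h.2 harc)
  clear harc hends
  dsimp only
  revert k l
  decide

theorem corner_parity (h : D.corner x k = D.corner y l) : (k = 1 ∨ k = 3) ↔ (l = 1 ∨ l = 3) := by
  have hparity {d e} (h : Relation.EqvGen (CornerStep D.pd) d e) :
      (d.2 = 1 ∨ d.2 = 3) ↔ (e.2 = 1 ∨ e.2 = 3) := by
    induction h with
    | rel d e h => exact D.cornerStep_parity h
    | refl d => exact Iff.rfl
    | symm d e _ ih => exact ih.symm
    | trans d e f _ _ ih ih' => exact ih.trans ih'
  exact hparity ((D.corner_eq_iff (x, k) (y, l)).1 h)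

theorem isA_corner_iff : D.IsA (D.corner x k) ↔ k = 1 ∨ k = 3 := by
  constructor
  · rintro ⟨y, h | h⟩
    · exact (D.corner_parity h).1 (by decide)
    · exact (D.corner_parity h).1 (by decide)
  · rintro (rfl | rfl)
    exacts [⟨x, Or.inl rfl⟩, ⟨x, Or.inr rfl⟩]

theorem corner_zero_ne (hF : D.IsA F) : D.corner x 0 ≠ F := by
  rintro rfl
  exact absurd (D.isA_corner_iff.1 hF) (by decide)

theorem corner_two_ne (hF : D.IsA F) : D.corner x 2 ≠ F := by
  rintro rfl
  exact absurd (D.isA_corner_iff.1 hF) (by decide)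

theorem corner_one_ne (hF : ¬ D.IsA F) : D.corner x 1 ≠ F := by
  rintro rfl
  exact hF (D.isA_corner_iff.2 (by decide))

theorem corner_three_ne (hF : ¬ D.IsA F) : D.corner x 3 ≠ F := by
  rintro rfl
  exact hF (D.isA_corner_iff.2 (by decide))

/-! ### The two sides of an arc -/

theorem corner_overpass (h : D.pd y l = D.pd x k) (hne : k ≠ l) :
    D.corner x (k - 1) = D.corner y l ∧ D.corner y (l - 1) = D.corner x k :=
  ⟨(D.corner_eq_iff (x, k - 1) (y, l)).2 (.rel _ _ ⟨by simpa using h.symm,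
    by simpa using fun _ => hne⟩), (D.corner_eq_iff (y, l - 1) (x, k)).2 (.rel _ _
      ⟨by simpa using h, by simpa using fun _ => hne.symm⟩)⟩

theorem bounds_iff (hk : k = 0 ∨ k = 2) :
    D.Bounds (D.pd x k) F ↔ D.corner x k = F ∨ D.corner x (k - 1) = F := by
  refine ⟨?_, fun h => ⟨x, k, rfl, h⟩⟩
  rintro ⟨y, l, h, hF⟩
  by_cases hl : l = 0 ∨ l = 2
  · obtain ⟨rfl, rfl⟩ := Prod.mk.inj (D.under_end_unique hl hk h)
    exact hF
  · have hkl : k ≠ l := fun h => hl (h ▸ hk)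
    obtain ⟨hright, hleft⟩ := D.corner_overpass h hkl
    rw [hright, ← hleft]
    exact hF.symm

theorem bounds_zero : D.Bounds (D.pd x 0) F ↔ D.corner x 0 = F ∨ D.corner x 3 = F :=
  D.bounds_iff (Or.inl rfl)

theorem bounds_two : D.Bounds (D.pd x 2) F ↔ D.corner x 2 = F ∨ D.corner x 1 = F :=
  D.bounds_iff (Or.inr rfl)

theorem underArc_bijective : Function.Bijective
    (Sum.elim (fun x => D.pd x 0) fun x => D.pd x 2 : D.Crossing ⊕ D.Crossing → D.Arc) := by
  constructor
  · rintro (x | x) (y | y) h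
    · exact congrArg _ (Prod.mk.inj (D.under_end_unique (Or.inl rfl) (Or.inl rfl) h)).1
    · exact absurd (Prod.mk.inj (D.under_end_unique (Or.inl rfl) (Or.inr rfl) h)).2 (by decide)
    · exact absurd (Prod.mk.inj (D.under_end_unique (Or.inr rfl) (Or.inl rfl) h)).2 (by decide)
    · exact congrArg _ (Prod.mk.inj (D.under_end_unique (Or.inr rfl) (Or.inr rfl) h)).1
  · intro a
    obtain ⟨⟨x, k⟩, ⟨rfl | rfl, ha⟩, -⟩ := D.under_end a
    exacts [⟨.inl x, ha⟩, ⟨.inr x, ha⟩]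

@[to_additive]
theorem prod_arc {M : Type*} [CommMonoid M] (h : D.Arc → M) :
    ∏ a, h a = (∏ x, h (D.pd x 0)) * ∏ x, h (D.pd x 2) := by
  rw [← D.underArc_bijective.prod_comp, Fintype.prod_sum_type]
  rfl

theorem forall_arc {P : D.Arc → Prop} : (∀ a, P a) ↔ ∀ x, P (D.pd x 0) ∧ P (D.pd x 2) := by
  refine ⟨fun h x => ⟨h _, h _⟩, fun h a => ?_⟩
  obtain ⟨x | x, rfl⟩ := D.underArc_bijective.2 a
  exacts [(h x).1, (h x).2]

theorem edgeValue_zero (s : D.Region → ℤ) (x : D.Crossing) :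
    D.edgeValue s (D.pd x 0) = s (D.corner x 3) + s (D.corner x 0) := by
  have hne : D.corner x 3 ≠ D.corner x 0 := D.corner_three_ne (by simp [isA_corner_iff])
  have hfaces : (univ.filter fun F => D.Bounds (D.pd x 0) F) = {D.corner x 3, D.corner x 0} := by
    ext F; simp [bounds_zero, eq_comm, or_comm]
  rw [edgeValue, hfaces, sum_pair hne]

theorem edgeValue_two (s : D.Region → ℤ) (x : D.Crossing) :
    D.edgeValue s (D.pd x 2) = s (D.corner x 1) + s (D.corner x 2) := by
  have hne : D.corner x 1 ≠ D.corner x 2 := D.corner_one_ne (by simp [isA_corner_iff])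
  have hfaces : (univ.filter fun F => D.Bounds (D.pd x 2) F) = {D.corner x 1, D.corner x 2} := by
    ext F; simp [bounds_two, eq_comm, or_comm]
  rw [edgeValue, hfaces, sum_pair hne]

/-! ### The multisum as a sum over crossings -/

/-- The face system of a diagram: each crossing contributes its two underpassing arcs, with the
`A`-face before the `B`-face, and the pair of its `B`-faces. -/
def faceSystem : FaceSystem D.Region where
  arcs := (univ.val.map fun x => (D.corner x 3, D.corner x 0)) +
    univ.val.map fun x => (D.corner x 1, D.corner x 2)
  crossings := univ.val.map fun x => s(D.corner x 0, D.corner x 2)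
  bFaces := (univ.filter fun F => ¬ D.IsA F).val
  aFaces := (univ.filter fun F => D.IsA F).val

/-- The indicator of the face at a corner of a crossing. -/
def cornerIndicator (x : D.Crossing) (k : Fin 4) (F : D.Region) : ℤ :=
  if D.corner x k = F then 1 else 0

/-- The contribution of a crossing to the matrix `Q`. -/
def crossingForm (x : D.Crossing) (F G : D.Region) : ℤ :=
  let χ := D.cornerIndicator x
  χ 3 F * χ 3 G + χ 1 F * χ 1 G + (χ 0 F * χ 2 G + χ 2 F * χ 0 G) +
    (χ 3 F * χ 0 G + χ 0 F * χ 3 G) + (χ 1 F * χ 2 G + χ 2 F * χ 1 G)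

theorem cornerIndicator_of_isA (hF : D.IsA F) (x : D.Crossing) :
    D.cornerIndicator x 0 F = 0 ∧ D.cornerIndicator x 2 F = 0 :=
  ⟨if_neg (D.corner_zero_ne hF), if_neg (D.corner_two_ne hF)⟩

theorem cornerIndicator_of_not_isA (hF : ¬ D.IsA F) (x : D.Crossing) :
    D.cornerIndicator x 1 F = 0 ∧ D.cornerIndicator x 3 F = 0 :=
  ⟨if_neg (D.corner_one_ne hF), if_neg (D.corner_three_ne hF)⟩

theorem cornerIndicator_mul_self (x : D.Crossing) (k : Fin 4) (F : D.Region) :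
    D.cornerIndicator x k F * D.cornerIndicator x k F = D.cornerIndicator x k F := by
  simp [cornerIndicator]

theorem cornerIndicator_mul_eq_zero (x : D.Crossing) (k : Fin 4) (hFG : F ≠ G) :
    D.cornerIndicator x k F * D.cornerIndicator x k G = 0 := by
  unfold cornerIndicator
  split_ifs with hF hG
  · exact absurd (hF.symm.trans hG) hFG
  all_goals rfl

theorem sum_cornerIndicator_mul (x : D.Crossing) (k : Fin 4) (s : D.Region → ℤ) :
    ∑ F, D.cornerIndicator x k F * s F = s (D.corner x k) := by
  simp [cornerIndicator]

theorem edgeCount_eq_sum (hF : D.IsA F) :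
    (D.edgeCount F : ℤ) = ∑ x, (D.cornerIndicator x 3 F + D.cornerIndicator x 1 F) := by
  rw [edgeCount, card_filter, sum_arc, sum_add_distrib]
  push_cast
  simp only [bounds_zero, bounds_two, D.corner_zero_ne hF, D.corner_two_ne hF, false_or,
    cornerIndicator]

theorem commonEdges_eq_sum (hF : D.IsA F) (hG : ¬ D.IsA G) :
    (D.commonEdges F G : ℤ) = ∑ x, (D.cornerIndicator x 3 F * D.cornerIndicator x 0 G +
      D.cornerIndicator x 1 F * D.cornerIndicator x 2 G) := by
  rw [commonEdges, card_filter, sum_arc, sum_add_distrib]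
  push_cast
  simp only [bounds_zero, bounds_two, D.corner_zero_ne hF, D.corner_two_ne hF, D.corner_one_ne hG,
    D.corner_three_ne hG, false_or, or_false, cornerIndicator, ite_and, boole_mul]

theorem commonEdges_comm (F G : D.Region) : D.commonEdges F G = D.commonEdges G F := by
  simp only [commonEdges, and_comm]

theorem incident_iff (hF : ¬ D.IsA F) : D.Incident x F ↔ D.corner x 0 = F ∨ D.corner x 2 = F := by
  constructor
  · rintro ⟨k, h⟩
    fin_cases k
    exacts [Or.inl h, (D.corner_one_ne hF h).elim, Or.inr h, (D.corner_three_ne hF h).elim]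
  · rintro (h | h)
    exacts [⟨0, h⟩, ⟨2, h⟩]

theorem commonVertices_eq_sum (hne : ∀ x, D.corner x 0 ≠ D.corner x 2) (hF : ¬ D.IsA F)
    (hG : ¬ D.IsA G) (hFG : F ≠ G) : (D.commonVertices F G : ℤ) =
      ∑ x, (D.cornerIndicator x 0 F * D.cornerIndicator x 2 G +
        D.cornerIndicator x 2 F * D.cornerIndicator x 0 G) := by
  rw [commonVertices, card_filter]
  push_cast
  refine sum_congr rfl fun x _ => ?_
  have := hne x
  simp only [incident_iff D hF, incident_iff D hG, cornerIndicator]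
  grind

theorem Q_eq_sum (hne : ∀ x, D.corner x 0 ≠ D.corner x 2) (F G : D.Region) :
    D.Q F G = ∑ x, D.crossingForm x F G := by
  have hA {H} (hH : D.IsA H) := D.cornerIndicator_of_isA hH
  have hB {H} (hH : ¬ D.IsA H) := D.cornerIndicator_of_not_isA hH
  by_cases hF : D.IsA F <;> by_cases hG : D.IsA G
  · by_cases hFG : F = G
    · subst hFG
      simp [Q, hF, D.edgeCount_eq_sum hF, crossingForm, hA hF, cornerIndicator_mul_self]
    · simp [Q, hFG, hF, hG, crossingForm, hA hF, hA hG, D.cornerIndicator_mul_eq_zero _ _ hFG]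
  · have hFG : F ≠ G := fun h => hG (h ▸ hF)
    simp [Q, hFG, hF, hG, D.commonEdges_eq_sum hF hG, crossingForm, hA hF, hB hG]
  · have hFG : F ≠ G := fun h => hF (h ▸ hG)
    simp [Q, hFG, hF, hG, D.commonEdges_comm F G, D.commonEdges_eq_sum hG hF, crossingForm, hA hG,
      hB hF, mul_comm]
  · by_cases hFG : F = G
    · subst hFG
      have hzero (x) : D.cornerIndicator x 0 F * D.cornerIndicator x 2 F = 0 := by
        have := hne x
        unfold cornerIndicator
        grind
      simp [Q, hF, crossingForm, hB hF, hzero, mul_comm (D.cornerIndicator _ 2 F)]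
    · simp [Q, hFG, hF, hG, D.commonVertices_eq_sum hne hF hG hFG, crossingForm, hB hF, hB hG]

theorem sum_sum_cornerIndicator_mul (s : D.Region → ℤ) (x : D.Crossing) (k l : Fin 4) :
    ∑ F, ∑ G, D.cornerIndicator x k F * D.cornerIndicator x l G * s F * s G =
      s (D.corner x k) * s (D.corner x l) := by
  rw [← D.sum_cornerIndicator_mul x k s, ← D.sum_cornerIndicator_mul x l s, sum_mul_sum]
  exact sum_congr rfl fun F _ => sum_congr rfl fun G _ => by ring

theorem twoQ'_eq_sum (hne : ∀ x, D.corner x 0 ≠ D.corner x 2) (s : D.Region → ℤ) :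
    D.twoQ' s = ∑ x, (s (D.corner x 3) * s (D.corner x 3) + s (D.corner x 1) * s (D.corner x 1) +
      2 * (s (D.corner x 0) * s (D.corner x 2)) + 2 * (s (D.corner x 3) * s (D.corner x 0)) +
      2 * (s (D.corner x 1) * s (D.corner x 2))) :=
  calc D.twoQ' s = ∑ F, ∑ G, ∑ x, D.crossingForm x F G * s F * s G := by
        simp only [twoQ', D.Q_eq_sum hne, sum_mul]
    _ = ∑ x, ∑ F, ∑ G, D.crossingForm x F G * s F * s G :=
        (sum_congr rfl fun _ _ => sum_comm).trans sum_comm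
    _ = _ := sum_congr rfl fun x _ => by
        simp only [crossingForm, add_mul, sum_add_distrib, sum_sum_cornerIndicator_mul]
        ring

theorem twoL_eq_sum (F : D.Region) :
    D.twoL F = ∑ x, (D.cornerIndicator x 3 F + D.cornerIndicator x 1 F) +
      2 * ((if ¬ D.IsA F then 1 else 0) - if D.IsA F then 1 else 0) := by
  by_cases hF : D.IsA F
  · simp only [twoL, hF, if_true, D.edgeCount_eq_sum hF, not_true, if_false]
    ring
  · simp [twoL, hF, D.cornerIndicator_of_not_isA hF]

theorem twoL'_eq_sum (s : D.Region → ℤ) :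
    D.twoL' s = (∑ x, s (D.corner x 3)) + (∑ x, s (D.corner x 1)) +
      2 * ((∑ F with ¬ D.IsA F, s F) - ∑ F with D.IsA F, s F) := by
  have hcorner (k : Fin 4) : ∑ F, ∑ x, D.cornerIndicator x k F * s F = ∑ x, s (D.corner x k) := by
    simp only [sum_comm (s := univ (α := D.Region)), sum_cornerIndicator_mul]
  simp only [twoL', twoL_eq_sum, add_mul, sum_add_distrib, sum_mul, hcorner, mul_assoc, sub_mul,
    ite_mul, one_mul, zero_mul, ← mul_sum, sum_sub_distrib, sum_filter]

theorem twoExponent_faceSystem (hne : ∀ x, D.corner x 0 ≠ D.corner x 2) (s : D.Region → ℤ) :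
    D.faceSystem.twoExponent s = D.twoQ' s + D.twoL' s := by
  rw [D.twoQ'_eq_sum hne, D.twoL'_eq_sum]
  simp only [faceSystem, twoExponent, Multiset.map_add, Multiset.map_map, Function.comp_def,
    Multiset.sum_add, Sym2.map_mk, Sym2.mul_mk]
  simp only [← sum_eq_multiset_sum, sum_add_distrib, mul_add, ← mul_sum, mul_one]
  ring

theorem weight_faceSystem (hne : ∀ x, D.corner x 0 ≠ D.corner x 2) (q : ℂ) {s : D.Region → ℤ}
    (hs : ∀ a, 0 ≤ D.edgeValue s a) : D.faceSystem.weight q s = D.term q s := by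
  have hinv (a : D.Arc) : qPochInv q (D.edgeValue s a) = (qPoch q (D.edgeValue s a).toNat)⁻¹ :=
    if_pos (hs a)
  have hsq : ((-1 : ℂ) ^ (2 : ℤ)) = 1 := by norm_num
  unfold weight term exponent
  rw [D.twoExponent_faceSystem hne, D.twoL'_eq_sum, prod_arc, zpow_add₀ (by norm_num), zpow_mul]
  simp only [faceSystem, Multiset.map_add, Multiset.map_map, Function.comp_def, Multiset.sum_add,
    Multiset.prod_add]
  simp only [← sum_eq_multiset_sum, ← prod_eq_multiset_prod, ← edgeValue_zero, ← edgeValue_two,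
    hinv, prod_inv_distrib]
  rw [hsq, one_zpow, mul_one, div_eq_mul_inv, mul_inv]

theorem admissible_faceSystem (s : D.Region → ℤ) :
    D.faceSystem.Admissible s ↔ ∀ a, 0 ≤ D.edgeValue s a := by
  simp [FaceSystem.Admissible, faceSystem, forall_arc, edgeValue_zero, edgeValue_two, or_imp,
    forall_and]

end AlternatingKnotDiagram

section CellFaces

variable {ι : Type} {f₀ v₀ w₀ : ι}

namespace FaceSystem

/-- The faces of a system, with multiplicity. -/
def faces (S : FaceSystem ι) : Multiset ι := S.bFaces + S.aFaces

theorem faces_add (S T : FaceSystem ι) : (S + T).faces = S.faces + T.faces := by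
  simp only [faces, bFaces_add, aFaces_add]
  abel

end FaceSystem

theorem Cell.faces_pathSystem (f : ι) (xs : List ι) (w : ι) :
    (pathSystem f₀ v₀ f xs w).faces = xs := by
  induction xs generalizing w with
  | nil => simp [pathSystem, FaceSystem.faces]
  | cons x xs ih =>
    rw [pathSystem, faces_add, ih]
    simp [linkSystem, FaceSystem.faces]

theorem Cell.faces_system (c : Cell ι) : (c.system f₀ v₀).faces = c.vars := by
  cases c with
  | bigon f u v => simp [system, vars, FaceSystem.faces]
  | polygon f w xs =>
    rw [system, faces_add, faces_pathSystem]
    simp [vars, cornerSystem, FaceSystem.faces]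

theorem faces_cellSystem (L : List (Cell ι)) :
    (cellSystem f₀ v₀ w₀ L).faces = (f₀ :: v₀ :: cellVars w₀ L : List ι) := by
  induction L with
  | nil =>
    simp only [cellSystem, cellVars, FaceSystem.faces, Multiset.insert_eq_cons, add_comm,
      Multiset.singleton_add, ← Multiset.cons_coe]
    rfl
  | cons c L ih =>
    rw [cellSystem, faces_add, c.faces_system, ih, Multiset.coe_add, Multiset.coe_eq_coe]
    simpa [cellVars] using List.perm_middle.trans (List.perm_middle.cons f₀)

theorem Cell.card_crossings_pathSystem (f : ι) (xs : List ι) (w : ι) :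
    (pathSystem f₀ v₀ f xs w).crossings.card = xs.length + 1 := by
  induction xs generalizing w with
  | nil => simp [pathSystem]
  | cons x xs ih => simp [pathSystem, linkSystem, ih, add_comm]

theorem Cell.card_crossings_system (c : Cell ι) :
    (c.system f₀ v₀).crossings.card = c.rank + 1 := by
  cases c with
  | bigon f u v => simp [system, rank]
  | polygon f w xs => simp [system, rank, cornerSystem, card_crossings_pathSystem]

theorem card_crossings_cellSystem (L : List (Cell ι)) :
    (cellSystem f₀ v₀ w₀ L).crossings.card = cellEdges L := by
  induction L with
  | nil => simp [cellSystem, cellEdges]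
  | cons c L ih => simp [cellSystem, cellEdges, ih, c.card_crossings_system, add_assoc]

end CellFaces

namespace AlternatingKnotDiagram

variable (D : AlternatingKnotDiagram) {f₀ v₀ w₀ Fstar : D.Region} {L : List (Cell D.Region)} {q : ℂ}

theorem faces_faceSystem : D.faceSystem.faces = univ.val :=
  (add_comm _ _).trans (Multiset.filter_add_not (fun F => D.IsA F) univ.val)

theorem mem_Lam_iff (hF : f₀ = D.exterior ∧ v₀ = Fstar ∨ f₀ = Fstar ∧ v₀ = D.exterior)
    (s : D.Region → ℤ) :
    s ∈ D.Lam Fstar ↔ s f₀ = 0 ∧ s v₀ = 0 ∧ D.faceSystem.Admissible s := by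
  rw [admissible_faceSystem]
  rcases hF with ⟨rfl, rfl⟩ | ⟨rfl, rfl⟩
  exacts [Iff.rfl, and_left_comm]

/-- The faces other than `f₀` and `v₀` are the variables of the assembly, so `Λ` is the set of
assignments supported on them that are admissible. -/
theorem hasSum_term (hne : ∀ x, D.corner x 0 ≠ D.corner x 2) (hL : ValidCells v₀ w₀ L)
    (hD : D.faceSystem = cellSystem f₀ v₀ w₀ L)
    (hF : f₀ = D.exterior ∧ v₀ = Fstar ∨ f₀ = Fstar ∧ v₀ = D.exterior) (hq : ‖q‖ < 1) :
    HasSum (fun s : D.Lam Fstar => D.term q s)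
      ((qPochInf q)⁻¹ ^ cellEdges L * (L.map fun c => hSeries (c.rank + 2) q).prod) := by
  have huniv : (univ.val : Multiset D.Region) = (f₀ :: v₀ :: cellVars w₀ L : List D.Region) := by
    rw [← faces_faceSystem, hD, faces_cellSystem]
  have hnd : (f₀ :: v₀ :: cellVars w₀ L).Nodup := by
    rw [← Multiset.coe_nodup, ← huniv]
    exact univ.nodup
  have hcover (F) : F = f₀ ∨ F = v₀ ∨ F ∈ cellVars w₀ L := by
    have hF := mem_univ F
    rw [← mem_val, huniv] at hF
    simpa only [Multiset.mem_coe, List.mem_cons] using hF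
  have hLam := D.mem_Lam_iff hF
  let φ (s : D.Lam Fstar) : SupportedOn (cellVars w₀ L) := ⟨s.1, fun F hF => by
    obtain ⟨hf₀, hv₀, -⟩ := (hLam s.1).1 s.2
    rcases hcover F with rfl | rfl | h
    exacts [hf₀, hv₀, (hF h).elim]⟩
  have hφ : Function.Injective φ := fun s t h => Subtype.ext (Subtype.mk.inj h)
  have hsum := hasSum_weight_cellSystem hq hL hnd
  rw [← hD, ← hφ.hasSum_iff] at hsum
  · convert hsum using 2 with s
    exact (D.weight_faceSystem hne q s.2.2.2).symm
  · simp only [List.nodup_cons, List.mem_cons, not_or] at hnd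
    exact fun s hs => weight_eq_zero fun h =>
      hs ⟨⟨s.1, (hLam s.1).2 ⟨s.2 _ hnd.1.2, s.2 _ hnd.2.1, h⟩⟩, rfl⟩

theorem summable_and_Phi_eq (hne : ∀ x, D.corner x 0 ≠ D.corner x 2) (hL : ValidCells v₀ w₀ L)
    (hD : D.faceSystem = cellSystem f₀ v₀ w₀ L)
    (hF : f₀ = D.exterior ∧ v₀ = Fstar ∨ f₀ = Fstar ∧ v₀ = D.exterior) (hq : ‖q‖ < 1) :
    Summable (fun s : D.Lam Fstar => D.term q s) ∧
      D.Phi Fstar q = (L.map fun c => hSeries (c.rank + 2) q).prod := by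
  have hsum := D.hasSum_term hne hL hD hF hq
  have hcard : Fintype.card D.Crossing = cellEdges L := by
    rw [← card_crossings_cellSystem (f₀ := f₀) (v₀ := v₀) (w₀ := w₀), ← hD]
    simp [faceSystem]
  refine ⟨hsum.summable, ?_⟩
  rw [Phi, hsum.tsum_eq, hcard, ← mul_assoc, ← mul_pow, mul_inv_cancel₀ (qPochInf_ne_zero hq),
    one_pow, one_mul]

end AlternatingKnotDiagram

/-! ### Diagrams with finitely many faces -/

instance decidableValidCells {ι : Type} [DecidableEq ι] (v₀ w₀ : ι) :
    (L : List (Cell ι)) → Decidable (ValidCells v₀ w₀ L)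
  | [] => .isTrue trivial
  | .bigon _ u v :: L =>
    have := decidableValidCells v₀ w₀ L
    inferInstanceAs (Decidable ((u ∈ v₀ :: cellVerts w₀ L ∧ v ∈ v₀ :: cellVerts w₀ L) ∧
      ValidCells v₀ w₀ L))
  | .polygon _ w _ :: L =>
    have := decidableValidCells v₀ w₀ L
    inferInstanceAs (Decidable (w ∈ cellVerts w₀ L ∧ ValidCells v₀ w₀ L))

/-- A way to assemble a graph from an edge `v₀ w₀` in the face `f₀` and a list of cells. -/
structure Assembly (ι : Type) where
  f₀ : ι
  v₀ : ι
  w₀ : ι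
  cells : List (Cell ι)

namespace AlternatingKnotDiagram

variable (D : AlternatingKnotDiagram)

instance : DecidablePred D.IsBase := fun F => by unfold IsBase; infer_instance

/-- The graph of the `B`-faces of `D` is assembled as described by `a`, starting at the exterior and
at the face `F`. -/
def IsAssembly (F : D.Region) (a : Assembly D.Region) : Prop :=
  (a.f₀ = D.exterior ∧ a.v₀ = F ∨ a.f₀ = F ∧ a.v₀ = D.exterior) ∧ ValidCells a.v₀ a.w₀ a.cells ∧
    D.faceSystem = cellSystem a.f₀ a.v₀ a.w₀ a.cells

instance (F : D.Region) (a : Assembly D.Region) : Decidable (D.IsAssembly F a) := by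
  unfold IsAssembly; infer_instance

theorem prod_hSeries_filter_pos {q : ℂ} (hq : ‖q‖ < 1) (r : List ℕ) :
    ((r.filter (0 < ·)).map fun n => hSeries (n + 2) q).prod =
      (r.map fun n => hSeries (n + 2) q).prod := by
  induction r with
  | nil => rfl
  | cons n r ih =>
    rcases Nat.eq_zero_or_pos n with rfl | hn
    · simp [ih, hSeries_two hq]
    · simp [hn, ih]

/-- Every admissible choice of `F*` has an assembly in the list `as`, and its polygons have the
ranks `r`. -/
def HasAssemblies (as : List (Assembly D.Region)) (r : List ℕ) : Prop :=
  (∀ x, D.corner x 0 ≠ D.corner x 2) ∧ ∀ F, D.IsBase F →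
    ∃ a ∈ as, D.IsAssembly F a ∧ (a.cells.map Cell.rank).filter (0 < ·) = r

instance (as : List (Assembly D.Region)) (r : List ℕ) : Decidable (D.HasAssemblies as r) := by
  unfold HasAssemblies; infer_instance

theorem phiEq_of_hasAssemblies {as : List (Assembly D.Region)} {r : List ℕ} {f : ℂ → ℂ}
    (h : decide (D.HasAssemblies as r) = true)
    (hf : ∀ q, (r.map fun n => hSeries (n + 2) q).prod = f q) : D.PhiEq f := by
  obtain ⟨hne, hassemble⟩ := of_decide_eq_true h
  intro F hF q hq
  obtain ⟨a, -, ⟨hstart, hcells, hD⟩, rfl⟩ := hassemble F hF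
  rw [← hf, prod_hSeries_filter_pos hq, List.map_map]
  exact D.summable_and_Phi_eq hne hcells hD hstart hq

end AlternatingKnotDiagram

theorem phiEq_knot_6_2 : knot_6_2.PhiEq fun q => hSeries 3 q * hSeries 4 q :=
  knot_6_2.phiEq_of_hasAssemblies (as :=
    ([⟨0, 3, 4, [.polygon 1 4 [5], .polygon 2 4 [6, 7]]⟩,
     ⟨0, 4, 3, [.polygon 1 3 [5], .polygon 2 3 [7, 6]]⟩] : List (Assembly (Fin 8))))
    (r := [1, 2]) (by decide +kernel) fun q => by simp

theorem phiEq_knot_6_2_mirror : knot_6_2.mirror.PhiEq fun q => hSeries 3 q :=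
  knot_6_2.mirror.phiEq_of_hasAssemblies (as :=
    ([⟨3, 0, 1, [.bigon 5 0 1, .bigon 6 0 2, .bigon 7 0 2, .polygon 4 1 [2]]⟩,
     ⟨4, 0, 1, [.bigon 5 0 1, .bigon 6 0 2, .bigon 7 0 2, .polygon 3 1 [2]]⟩] :
     List (Assembly (Fin 8))))
    (r := [1]) (by decide +kernel) fun q => by simp

theorem phiEq_knot_6_3 : knot_6_3.PhiEq fun q => hSeries 3 q ^ 2 :=
  knot_6_3.phiEq_of_hasAssemblies (as :=
    ([⟨0, 6, 4, [.bigon 2 5 6, .polygon 1 4 [5], .polygon 3 4 [7]]⟩] : List (Assembly (Fin 8))))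
    (r := [1, 1]) (by decide +kernel) fun q => by simp [pow_succ]

theorem phiEq_knot_6_3_mirror : knot_6_3.mirror.PhiEq fun q => hSeries 3 q ^ 2 :=
  knot_6_3.mirror.phiEq_of_hasAssemblies (as :=
    ([⟨6, 0, 1, [.bigon 7 0 3, .polygon 4 1 [3], .polygon 5 1 [2]]⟩] : List (Assembly (Fin 8))))
    (r := [1, 1]) (by decide +kernel) fun q => by simp [pow_succ]

theorem phiEq_knot_7_3 : knot_7_3.PhiEq fun q => hSeries 5 q :=
  knot_7_3.phiEq_of_hasAssemblies (as :=
    ([⟨0, 4, 5, [.bigon 1 4 5, .bigon 3 4 5, .polygon 2 5 [6, 7, 8]]⟩,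
     ⟨0, 5, 4, [.bigon 1 4 5, .bigon 3 4 5, .polygon 2 4 [8, 7, 6]]⟩] : List (Assembly (Fin 9))))
    (r := [3]) (by decide +kernel) fun q => by simp

theorem phiEq_knot_7_3_mirror : knot_7_3.mirror.PhiEq fun q => hSeries 4 q :=
  knot_7_3.mirror.phiEq_of_hasAssemblies (as :=
    ([⟨4, 0, 1, [.bigon 6 0 2, .bigon 7 0 2, .bigon 8 0 2, .polygon 5 1 [3, 2]]⟩,
     ⟨5, 0, 1, [.bigon 6 0 2, .bigon 7 0 2, .bigon 8 0 2, .polygon 4 1 [3, 2]]⟩] :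
     List (Assembly (Fin 9))))
    (r := [2]) (by decide +kernel) fun q => by simp

theorem phiEq_knot_7_4 : knot_7_4.PhiEq fun q => hSeries 4 q ^ 2 :=
  knot_7_4.phiEq_of_hasAssemblies (as :=
    ([⟨0, 4, 7, [.polygon 1 7 [8, 3], .polygon 2 7 [6, 5]]⟩,
     ⟨0, 7, 4, [.polygon 1 4 [3, 8], .polygon 2 4 [5, 6]]⟩] : List (Assembly (Fin 9))))
    (r := [2, 2]) (by decide +kernel) fun q => by simp [pow_succ]

theorem phiEq_knot_7_4_mirror : knot_7_4.mirror.PhiEq fun q => hSeries 3 q :=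
  knot_7_4.mirror.phiEq_of_hasAssemblies (as :=
    ([⟨4, 0, 1, [.bigon 3 0 1, .bigon 5 0 2, .bigon 6 0 2, .bigon 8 0 1, .polygon 7 1 [2]]⟩,
     ⟨7, 0, 1, [.bigon 3 0 1, .bigon 5 0 2, .bigon 6 0 2, .bigon 8 0 1, .polygon 4 1 [2]]⟩] :
     List (Assembly (Fin 9))))
    (r := [1]) (by decide +kernel) fun q => by simp

theorem phiEq_knot_7_5 : knot_7_5.PhiEq fun q => hSeries 3 q * hSeries 4 q :=
  knot_7_5.phiEq_of_hasAssemblies (as :=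
    ([⟨0, 4, 8, [.bigon 3 4 6, .polygon 1 6 [5], .polygon 2 8 [7, 6]]⟩,
     ⟨0, 6, 7, [.bigon 3 4 6, .polygon 1 4 [5], .polygon 2 7 [8, 4]]⟩] :
     List (Assembly (Fin 9))))
    (r := [1, 2]) (by decide +kernel) fun q => by simp

theorem phiEq_knot_7_5_mirror : knot_7_5.mirror.PhiEq fun q => hSeries 4 q :=
  knot_7_5.mirror.phiEq_of_hasAssemblies (as :=
    ([⟨4, 0, 1, [.bigon 5 0 1, .bigon 7 0 2, .bigon 8 0 2, .polygon 6 1 [3, 2]]⟩,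
     ⟨6, 0, 1, [.bigon 5 0 1, .bigon 7 0 2, .bigon 8 0 2, .polygon 4 1 [3, 2]]⟩] :
     List (Assembly (Fin 9))))
    (r := [2]) (by decide +kernel) fun q => by simp

theorem phiEq_knot_7_6 : knot_7_6.PhiEq fun q => hSeries 3 q * hSeries 4 q :=
  knot_7_6.phiEq_of_hasAssemblies (as :=
    ([⟨0, 4, 5, [.bigon 3 8 4, .polygon 1 5 [6], .polygon 2 5 [7, 8]]⟩] :
     List (Assembly (Fin 9))))
    (r := [1, 2]) (by decide +kernel) fun q => by simp

theorem phiEq_knot_7_6_mirror : knot_7_6.mirror.PhiEq fun q => hSeries 3 q ^ 2 :=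
  knot_7_6.mirror.phiEq_of_hasAssemblies (as :=
    ([⟨4, 0, 2, [.bigon 6 0 1, .bigon 7 0 2, .polygon 5 2 [1], .polygon 8 2 [3]]⟩] :
     List (Assembly (Fin 9))))
    (r := [1, 1]) (by decide +kernel) fun q => by simp [pow_succ]

theorem phiEq_knot_7_7 : knot_7_7.PhiEq fun q => hSeries 3 q ^ 3 :=
  knot_7_7.phiEq_of_hasAssemblies (as :=
    ([⟨0, 5, 7, [.polygon 1 4 [6], .polygon 2 7 [4], .polygon 3 7 [8]]⟩] :
     List (Assembly (Fin 9))))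
    (r := [1, 1, 1]) (by decide +kernel) fun q => by simp [pow_succ, mul_assoc]

theorem phiEq_knot_7_7_mirror : knot_7_7.mirror.PhiEq fun q => hSeries 3 q ^ 2 :=
  knot_7_7.mirror.phiEq_of_hasAssemblies (as :=
    ([⟨5, 0, 3, [.bigon 6 0 1, .bigon 8 0 3, .polygon 4 2 [1], .polygon 7 3 [2]]⟩] :
     List (Assembly (Fin 9))))
    (r := [1, 1]) (by decide +kernel) fun q => by simp [pow_succ]

theorem phiEq_knot_8_2 : knot_8_2.PhiEq fun q => hSeries 3 q * hSeries 6 q :=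
  knot_8_2.phiEq_of_hasAssemblies (as :=
    ([⟨0, 3, 4, [.polygon 1 4 [5], .polygon 2 4 [6, 7, 8, 9]]⟩,
     ⟨0, 4, 3, [.polygon 1 3 [5], .polygon 2 3 [9, 8, 7, 6]]⟩] : List (Assembly (Fin 10))))
    (r := [1, 4]) (by decide +kernel) fun q => by simp

theorem phiEq_knot_8_2_mirror : knot_8_2.mirror.PhiEq fun q => hSeries 3 q :=
  knot_8_2.mirror.phiEq_of_hasAssemblies (as :=
    ([⟨3, 0, 1, [.bigon 5 0 1, .bigon 6 0 2, .bigon 7 0 2, .bigon 8 0 2, .bigon 9 0 2,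
       .polygon 4 1 [2]]⟩,
     ⟨4, 0, 1, [.bigon 5 0 1, .bigon 6 0 2, .bigon 7 0 2, .bigon 8 0 2, .bigon 9 0 2,
       .polygon 3 1 [2]]⟩] : List (Assembly (Fin 10))))
    (r := [1]) (by decide +kernel) fun q => by simp

theorem phiEq_knot_8_3 : knot_8_3.PhiEq fun q => hSeries 5 q :=
  knot_8_3.phiEq_of_hasAssemblies (as :=
    ([⟨0, 6, 5, [.bigon 2 6 7, .bigon 3 6 7, .bigon 4 6 7, .polygon 1 5 [8, 9, 7]]⟩,
     ⟨0, 7, 6, [.bigon 2 6 7, .bigon 3 6 7, .bigon 4 6 7, .polygon 1 6 [5, 8, 9]]⟩] :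
     List (Assembly (Fin 10))))
    (r := [3]) (by decide +kernel) fun q => by simp

theorem phiEq_knot_8_3_mirror : knot_8_3.mirror.PhiEq fun q => hSeries 5 q :=
  knot_8_3.mirror.phiEq_of_hasAssemblies (as :=
    ([⟨6, 0, 1, [.bigon 5 0 1, .bigon 8 0 1, .bigon 9 0 1, .polygon 7 1 [4, 2, 3]]⟩,
     ⟨7, 0, 1, [.bigon 5 0 1, .bigon 8 0 1, .bigon 9 0 1, .polygon 6 1 [4, 2, 3]]⟩] :
     List (Assembly (Fin 10))))
    (r := [3]) (by decide +kernel) fun q => by simp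

theorem phiEq_knot_8_4 : knot_8_4.PhiEq fun q => hSeries 3 q :=
  knot_8_4.phiEq_of_hasAssemblies (as :=
    ([⟨0, 8, 7, [.bigon 1 8 7, .bigon 2 8 9, .bigon 3 8 9, .bigon 5 8 7, .bigon 6 8 7,
       .polygon 4 7 [9]]⟩] : List (Assembly (Fin 10))))
    (r := [1]) (by decide +kernel) fun q => by simp

theorem phiEq_knot_8_4_mirror : knot_8_4.mirror.PhiEq fun q => hSeries 4 q * hSeries 5 q :=
  knot_8_4.mirror.phiEq_of_hasAssemblies (as :=
    ([⟨8, 0, 4, [.polygon 7 4 [6, 5, 1], .polygon 9 4 [2, 3]]⟩] : List (Assembly (Fin 10))))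
    (r := [3, 2]) (by decide +kernel) fun q => by simp [mul_comm]

theorem phiEq_knot_8_5_mirror : knot_8_5.mirror.PhiEq fun q => hSeries 3 q :=
  knot_8_5.mirror.phiEq_of_hasAssemblies (as :=
    ([⟨4, 0, 1, [.bigon 3 0 1, .bigon 5 1 2, .bigon 7 0 1, .bigon 8 0 2, .bigon 9 0 2,
       .polygon 6 1 [2]]⟩,
     ⟨6, 0, 1, [.bigon 3 0 1, .bigon 5 1 2, .bigon 7 0 1, .bigon 8 0 2, .bigon 9 0 2,
       .polygon 4 1 [2]]⟩] : List (Assembly (Fin 10))))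
    (r := [1]) (by decide +kernel) fun q => by simp

/-! ### Cycles and parallel edges -/

section CyclesAndParallelEdges

variable {ι : Type}

/-- The face system of a cycle with vertices `V` and edges `E` which separates the faces `f₀` and
`f`. -/
def cycleSystem (f₀ f : ι) (V : Multiset ι) (E : Multiset (Sym2 ι)) : FaceSystem ι :=
  ⟨V.map (fun x => (f, x)) + V.map (fun x => (f₀, x)), E, V, {f, f₀}⟩

theorem Cell.pathSystem_range' (f₀ f : ι) (g : ℕ → ι) (k a : ℕ) :
    pathSystem f₀ (g (a + k + 1)) f ((List.range' (a + 1) k).map g) (g a) =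
      ⟨(List.range' (a + 1) k : Multiset ℕ).map (fun i => (f, g i)) +
          (List.range' (a + 1) k : Multiset ℕ).map (fun i => (f₀, g i)),
        (List.range' a (k + 1) : Multiset ℕ).map (fun i => s(g i, g (i + 1))),
        (List.range' (a + 1) k : Multiset ℕ).map g, 0⟩ := by
  induction k generalizing a with
  | zero => simp [pathSystem]
  | succ k ih =>
    rw [List.range'_succ (s := a + 1), List.map_cons, pathSystem,
      show a + (k + 1) + 1 = a + 1 + k + 1 by ring, ih (a + 1), List.range'_succ (s := a)]
    apply FaceSystem.ext <;>
      simp only [linkSystem, arcs_add, crossings_add, bFaces_add, aFaces_add,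
        ← Multiset.cons_coe, ← Multiset.singleton_add, Multiset.map_add, Multiset.map_singleton,
        Multiset.insert_eq_cons, add_zero]
    all_goals abel

theorem cellSystem_closedPath (f₀ f : ι) {g : ℕ → ι} {k : ℕ} (hg : g (k + 2) = g 0) :
    cellSystem f₀ (g 0) (g 1) [.polygon f (g 1) ((List.range' 2 k).map g)] =
      cycleSystem f₀ f ((Multiset.range (k + 2)).map g)
        ((Multiset.range (k + 2)).map fun i => s(g i, g (i + 1))) := by
  have hpath := Cell.pathSystem_range' f₀ f g k 1
  rw [show 1 + k + 1 = k + 2 by ring, hg, one_add_one_eq_two] at hpath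
  have hrange : Multiset.range (k + 2) = 0 ::ₘ (List.range' 1 (k + 1) : Multiset ℕ) := by
    rw [Multiset.range, List.range_eq_range', List.range'_succ]
    rfl
  have hrange' : (List.range' 1 (k + 1) : Multiset ℕ) = 1 ::ₘ (List.range' 2 k : Multiset ℕ) := rfl
  rw [hrange]
  apply FaceSystem.ext <;>
    simp only [cellSystem, Cell.system, Cell.cornerSystem, hpath, cycleSystem, arcs_add,
      crossings_add, bFaces_add, aFaces_add, hrange', ← Multiset.singleton_add, Multiset.map_add,
      Multiset.map_singleton, Multiset.map_map, Function.comp_def, Multiset.insert_eq_cons]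
  all_goals abel

section Cycle

variable {N : ℕ}

theorem map_range_add_eq_univ_val [NeZero N] (j : ZMod N) :
    (Multiset.range N).map (fun i : ℕ => j + i) = (univ : Finset (ZMod N)).val := by
  have hinj : Set.InjOn (fun i : ℕ => j + (i : ZMod N)) (range N) := by
    intro a ha b hb hab
    have hcast : (a : ZMod N) = b := add_left_cancel hab
    rwa [ZMod.natCast_eq_natCast_iff', Nat.mod_eq_of_lt (mem_range.1 ha),
      Nat.mod_eq_of_lt (mem_range.1 hb)] at hcast
  rw [← eq_univ_of_card ((range N).image fun i : ℕ => j + (i : ZMod N))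
    (by rw [card_image_of_injOn hinj, card_range, ZMod.card]), image_val_of_injOn hinj]
  rfl

/-- The cell by which the edge from `h j` to `h (j + 1)` is completed to the cycle through all
`h i`. -/
def cycleCell (f : ι) (h : ZMod N → ι) (j : ZMod N) : Cell ι :=
  .polygon f (h (j + 1)) ((List.range' 2 (N - 2)).map fun i : ℕ => h (j + i))

theorem rank_cycleCell (f : ι) (h : ZMod N → ι) (j : ZMod N) : (cycleCell f h j).rank = N - 2 := by
  simp [cycleCell, Cell.rank]

theorem cellSystem_cycleCell [NeZero N] (hN : 2 ≤ N) (f₀ f : ι) (h : ZMod N → ι) (j : ZMod N) :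
    cellSystem f₀ (h j) (h (j + 1)) [cycleCell f h j] =
      cycleSystem f₀ f (univ.val.map h) (univ.val.map fun x => s(h x, h (x + 1))) := by
  obtain ⟨k, rfl⟩ := Nat.exists_eq_add_of_le' hN
  have hclosed : h (j + (k + 2 : ℕ)) = h (j + (0 : ℕ)) := by
    rw [CharP.cast_eq_zero, Nat.cast_zero]
  have hpath := cellSystem_closedPath f₀ f (g := fun i : ℕ => h (j + i)) hclosed
  simpa only [cycleCell, zero_add, ← map_range_add_eq_univ_val j, Multiset.map_map,
    Function.comp_def, Nat.cast_zero, Nat.cast_one, Nat.cast_succ, add_zero, add_assoc,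
    Nat.add_sub_cancel] using hpath

theorem mem_cycleCell [NeZero N] (f : ι) (h : ZMod N → ι) (j i : ZMod N) :
    h i ∈ h j :: cellVerts (h (j + 1)) [cycleCell f h j] := by
  obtain ⟨n, hn, rfl⟩ := Multiset.mem_map.1
    ((map_range_add_eq_univ_val j).symm ▸ mem_univ_val i :
      i ∈ (Multiset.range N).map fun n : ℕ => j + n)
  have hn' := Multiset.mem_range.1 hn
  obtain rfl | rfl | hn2 : n = 0 ∨ n = 1 ∨ 2 ≤ n := by omega
  · simp
  · simp [cellVerts]
  · refine List.mem_cons_of_mem _ (List.mem_append_left _ (List.mem_map.2 ⟨n, ?_, rfl⟩))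
    rw [List.mem_range'_1]
    omega

theorem validCells_cycleCell (f : ι) (h : ZMod N → ι) (j : ZMod N) :
    ValidCells (h j) (h (j + 1)) [cycleCell f h j] :=
  ⟨List.mem_singleton_self _, trivial⟩

end Cycle

/-- The face system of parallel edges `u v`, one for each of the faces `F` which they enclose. -/
def parallelSystem (u v : ι) (F : Multiset ι) : FaceSystem ι :=
  ⟨F.map (fun f => (f, u)) + F.map (fun f => (f, v)), F.map fun _ => s(u, v), 0, F⟩

theorem cellSystem_bigons (f₀ v₀ w₀ u v : ι) (l : List ι) (L : List (Cell ι)) :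
    cellSystem f₀ v₀ w₀ (l.map (fun f => .bigon f u v) ++ L) =
      parallelSystem u v l + cellSystem f₀ v₀ w₀ L := by
  induction l with
  | nil => exact (zero_add _).symm
  | cons f l ih =>
    rw [List.map_cons, List.cons_append, cellSystem, ih, ← add_assoc, Cell.system]
    congr 1
    apply FaceSystem.ext <;>
      simp only [parallelSystem, arcs_add, crossings_add, bFaces_add, aFaces_add,
        ← Multiset.cons_coe, ← Multiset.singleton_add, Multiset.map_add, Multiset.map_singleton,
        Multiset.insert_eq_cons, add_zero]
    all_goals abel

theorem cellSystem_parallelEdges (u v f : ι) (l : List ι) :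
    cellSystem f u v (l.map (fun g => .bigon g u v) ++ []) =
      parallelSystem u v (f ::ₘ l) + ⟨0, 0, {u, v}, 0⟩ := by
  rw [cellSystem_bigons]
  apply FaceSystem.ext <;>
    simp only [parallelSystem, cellSystem, arcs_add, crossings_add, bFaces_add, aFaces_add,
      ← Multiset.singleton_add, Multiset.map_add, Multiset.map_singleton, Multiset.insert_eq_cons,
      add_zero]
  all_goals abel

theorem cellVerts_bigons (w₀ u v : ι) (l : List ι) (L : List (Cell ι)) :
    cellVerts w₀ (l.map (fun f => .bigon f u v) ++ L) = cellVerts w₀ L := by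
  induction l with
  | nil => rfl
  | cons _ _ ih => exact ih

theorem validCells_bigons {v₀ w₀ u v : ι} (l : List ι) {L : List (Cell ι)} (h : ValidCells v₀ w₀ L)
    (hu : u ∈ v₀ :: cellVerts w₀ L) (hv : v ∈ v₀ :: cellVerts w₀ L) :
    ValidCells v₀ w₀ (l.map (fun f => .bigon f u v) ++ L) := by
  induction l with
  | nil => exact h
  | cons _ l ih =>
    rw [← cellVerts_bigons w₀ u v l L] at hu hv
    exact ⟨⟨hu, hv⟩, ih⟩

theorem prod_hSeries_bigons {q : ℂ} (hq : ‖q‖ < 1) (u v : ι) (l : List ι) (L : List (Cell ι)) :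
    ((l.map (fun f => Cell.bigon f u v) ++ L).map fun c => hSeries (c.rank + 2) q).prod =
      (L.map fun c => hSeries (c.rank + 2) q).prod := by
  simp [Cell.rank, Function.comp_def, hSeries_two hq]

end CyclesAndParallelEdges

/-! ### Mirror images -/

namespace AlternatingKnotDiagram

variable (D : AlternatingKnotDiagram) {F G : D.Region}

theorem mirror_isA_iff : D.mirror.IsA F ↔ ¬ D.IsA F := by
  obtain ⟨x, k, rfl⟩ := D.corner_surjective F
  have hshift : D.mirror.corner x (k - 1) = D.corner x k :=
    congrArg (D.corner x) (sub_add_cancel k 1)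
  have hmirror : D.mirror.IsA (D.corner x k) ↔ k - 1 = 1 ∨ k - 1 = 3 :=
    hshift ▸ D.mirror.isA_corner_iff
  rw [hmirror, isA_corner_iff]
  clear hshift hmirror
  revert k
  decide

theorem faceSystem_mirror : D.mirror.faceSystem =
    ⟨(univ.val.map fun x => (D.corner x 0, D.corner x 1)) +
        univ.val.map fun x => (D.corner x 2, D.corner x 3),
      univ.val.map fun x => s(D.corner x 1, D.corner x 3),
      D.faceSystem.aFaces, D.faceSystem.bFaces⟩ := by
  have hfilter : ∀ {P R : D.Region → Prop} {_ : DecidablePred P} {_ : DecidablePred R},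
      (∀ F, P F ↔ R F) → (univ.filter P).val = (univ.filter R).val :=
    fun h => congrArg Finset.val (filter_congr fun F _ => h F)
  exact FaceSystem.ext rfl rfl (hfilter fun _ => not_iff_comm.1 D.mirror_isA_iff.symm)
    (hfilter fun _ => D.mirror_isA_iff)

theorem commonEdges_pos_iff (hF : D.IsA F) (hG : ¬ D.IsA G) :
    0 < D.commonEdges F G ↔ ∃ x, D.corner x 3 = F ∧ D.corner x 0 = G ∨
      D.corner x 1 = F ∧ D.corner x 2 = G := by
  have harc : (∃ a, D.Bounds a F ∧ D.Bounds a G) ↔ ∃ x,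
      (D.Bounds (D.pd x 0) F ∧ D.Bounds (D.pd x 0) G) ∨
        (D.Bounds (D.pd x 2) F ∧ D.Bounds (D.pd x 2) G) := by
    rw [← not_iff_not]
    simpa only [not_exists, not_or] using
      D.forall_arc (P := fun a => ¬ (D.Bounds a F ∧ D.Bounds a G))
  simp only [commonEdges, card_pos, filter_nonempty_iff, mem_univ, true_and, harc, bounds_zero,
    bounds_two, D.corner_zero_ne hF, D.corner_two_ne hF, D.corner_one_ne hG, D.corner_three_ne hG,
    false_or, or_false]

end AlternatingKnotDiagram

/-! ### Torus knots -/

section SumOfTypes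

variable {α β : Type} [Fintype α] [Fintype β] {P : α ⊕ β → Prop}

theorem filter_val_eq_map_inr {_ : DecidablePred P} (h : ∀ F, P F ↔ ¬ ∃ a, F = .inl a) :
    (univ.filter P).val = univ.val.map Sum.inr := by
  have : univ.filter P = univ.map .inr := by
    ext F
    cases F <;> simp [h]
  rw [this, map_val]
  rfl

theorem filter_val_eq_map_inl {_ : DecidablePred P} (h : ∀ F, P F ↔ ∃ a, F = .inl a) :
    (univ.filter P).val = univ.val.map Sum.inl := by
  have : univ.filter P = univ.map .inl := by
    ext F
    cases F <;> simp [h]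
  rw [this, map_val]
  rfl

end SumOfTypes

theorem map_univ_sub_right {G β : Type} [AddGroup G] [Fintype G] (h : G → β) (g : G) :
    ((univ : Finset G).val.map fun x => h (x - g)) = univ.val.map h := by
  conv_rhs => rw [← Multiset.map_univ_val_equiv (Equiv.subRight g), Multiset.map_map]
  rfl

theorem univ_val_eq_cons_toList_erase {α : Type} [Fintype α] [DecidableEq α] (a : α) :
    (univ : Finset α).val = a ::ₘ ((univ.erase a).toList : Multiset α) := by
  rw [coe_toList, erase_val, Multiset.cons_erase (mem_univ_val a)]

section TorusKnot

variable {p : ℕ}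

theorem torusKnot_isA_iff {F : Bool ⊕ ZMod (2 * p + 1)} :
    (torusKnot p).IsA F ↔ ∃ b, F = .inl b := by
  constructor
  · rintro ⟨x, h | h⟩
    exacts [⟨true, h.symm⟩, ⟨false, h.symm⟩]
  · rintro ⟨_ | _, rfl⟩
    exacts [⟨(0 : ZMod (2 * p + 1)), Or.inr rfl⟩, ⟨(0 : ZMod (2 * p + 1)), Or.inl rfl⟩]

theorem torusKnot_mirror_isA_iff {F : Bool ⊕ ZMod (2 * p + 1)} :
    (torusKnot p).mirror.IsA F ↔ ¬ ∃ b, F = .inl b :=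
  (torusKnot p).mirror_isA_iff.trans torusKnot_isA_iff.not

variable (p)

theorem aFaces_torusKnot : (torusKnot p).faceSystem.aFaces = {Sum.inl true, Sum.inl false} :=
  filter_val_eq_map_inl fun _ => torusKnot_isA_iff

theorem bFaces_torusKnot :
    (torusKnot p).faceSystem.bFaces = (univ : Finset (ZMod (2 * p + 1))).val.map Sum.inr :=
  filter_val_eq_map_inr fun _ => torusKnot_isA_iff.not

theorem torusKnot_faceSystem : (torusKnot p).faceSystem =
    cycleSystem (.inl true) (.inl false) ((univ : Finset (ZMod (2 * p + 1))).val.map Sum.inr)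
      (univ.val.map fun x => s(Sum.inr x, Sum.inr (x + 1))) := by
  refine FaceSystem.ext ?_ ?_ (bFaces_torusKnot p)
    ((aFaces_torusKnot p).trans (Multiset.pair_comm _ _))
  · rw [cycleSystem, Multiset.map_map, Multiset.map_map]
    exact congrArg (· + _) (map_univ_sub_right (fun x : ZMod (2 * p + 1) =>
      ((.inl false, .inr x) : (Bool ⊕ ZMod (2 * p + 1)) × (Bool ⊕ ZMod (2 * p + 1)))) 1)
  · refine Eq.trans ?_ (map_univ_sub_right (fun x : ZMod (2 * p + 1) =>
      s((.inr x : Bool ⊕ ZMod (2 * p + 1)), .inr (x + 1))) 1)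
    simp only [sub_add_cancel]
    rfl

theorem torusKnot_mirror_faceSystem : (torusKnot p).mirror.faceSystem =
    parallelSystem (.inl true) (.inl false) ((univ : Finset (ZMod (2 * p + 1))).val.map Sum.inr) +
      (⟨0, 0, {.inl true, .inl false}, 0⟩ : FaceSystem (Bool ⊕ ZMod (2 * p + 1))) := by
  rw [AlternatingKnotDiagram.faceSystem_mirror, aFaces_torusKnot, bFaces_torusKnot]
  refine FaceSystem.ext ?_ ?_ (zero_add _).symm (add_zero _).symm
  · simp only [arcs_add, parallelSystem, Multiset.map_map, add_zero]
    exact congrArg (· + _) (map_univ_sub_right (fun x : ZMod (2 * p + 1) =>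
      ((.inr x, .inl true) : (Bool ⊕ ZMod (2 * p + 1)) × (Bool ⊕ ZMod (2 * p + 1)))) 1)
  · simp only [crossings_add, parallelSystem, Multiset.map_map, add_zero]
    rfl

variable {p}

theorem phiEq_torusKnot (hp : 0 < p) : (torusKnot p).PhiEq fun q => hSeries (2 * p + 1) q := by
  have : Fact (1 < 2 * p + 1) := ⟨by omega⟩
  rintro (b | j) hF q hq
  · exact absurd (iff_of_true (torusKnot_isA_iff.2 ⟨b, rfl⟩)
      (torusKnot_isA_iff.2 ⟨true, rfl⟩)) hF.1
  · have hD := (torusKnot_faceSystem p).trans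
      (cellSystem_cycleCell (by omega) (.inl true) (.inl false) Sum.inr j).symm
    have hne : ∀ x : ZMod (2 * p + 1),
        (Sum.inr (x - 1) : Bool ⊕ ZMod (2 * p + 1)) ≠ Sum.inr x :=
      fun x h => one_ne_zero (sub_eq_self.1 (Sum.inr_injective h))
    obtain ⟨hsum, hPhi⟩ := (torusKnot p).summable_and_Phi_eq hne (validCells_cycleCell _ _ _) hD
      (Or.inl ⟨rfl, rfl⟩) hq
    have hrank : (cycleCell (.inl false) (Sum.inr : _ → Bool ⊕ ZMod (2 * p + 1)) j).rank + 2 =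
        2 * p + 1 := by
      rw [rank_cycleCell]
      omega
    exact ⟨hsum, hPhi.trans ((mul_one _).trans (congrArg (hSeries · q) hrank))⟩

theorem phiEq_torusKnot_mirror (p : ℕ) : (torusKnot p).mirror.PhiEq fun _ => 1 := by
  rintro (b | j) hF q hq
  · exact absurd (iff_of_false (fun h => torusKnot_mirror_isA_iff.1 h ⟨b, rfl⟩)
      fun h => torusKnot_mirror_isA_iff.1 h ⟨true, rfl⟩) hF.1
  · let l : List (Bool ⊕ ZMod (2 * p + 1)) := (univ.erase j).toList.map Sum.inr
    have hcells : parallelSystem (.inl true) (.inl false)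
          ((univ : Finset (ZMod (2 * p + 1))).val.map Sum.inr) +
          (⟨0, 0, {.inl true, .inl false}, 0⟩ : FaceSystem (Bool ⊕ ZMod (2 * p + 1))) =
        cellSystem (.inr j) (.inl true) (.inl false)
          (l.map (fun f => .bigon f (.inl true) (.inl false)) ++ []) := by
      rw [cellSystem_parallelEdges, univ_val_eq_cons_toList_erase j, Multiset.map_cons,
        Multiset.map_coe]
    have hD := (torusKnot_mirror_faceSystem p).trans hcells
    obtain ⟨hsum, hPhi⟩ := (torusKnot p).mirror.summable_and_Phi_eq
      (fun x h => absurd (Sum.inl_injective h) (by decide))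
      (validCells_bigons l (L := []) trivial List.mem_cons_self
        (List.mem_cons_of_mem _ (List.mem_singleton_self _))) hD (Or.inr ⟨rfl, rfl⟩) hq
    exact ⟨hsum, hPhi.trans (prod_hSeries_bigons hq _ _ _ [])⟩

end TorusKnot

/-! ### Twist knots -/

theorem map_univ_sum_bool {α β : Type} [Fintype α] (g : α ⊕ Bool → β) :
    (univ : Finset (α ⊕ Bool)).val.map g =
      (univ : Finset α).val.map (fun x => g (.inl x)) + ({g (.inr true)} + {g (.inr false)}) := by
  have huniv : (univ : Finset (α ⊕ Bool)).val = univ.val.map Sum.inl + univ.val.map Sum.inr := rfl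
  rw [huniv, Multiset.map_add, Multiset.map_map, Multiset.map_map]
  rfl

theorem map_univ_fin_succ {m : ℕ} {β : Type} (g : Fin (m + 1) → β) :
    (univ : Finset (Fin (m + 1))).val.map g =
      (univ : Finset (Fin m)).val.map (fun x => g x.succ) + {g 0} := by
  rw [Fin.univ_succ, cons_val, map_val, Multiset.map_cons, Multiset.map_map,
    add_comm (Multiset.map _ _), Multiset.singleton_add]
  rfl

theorem map_univ_fin_castSucc {m : ℕ} {β : Type} (g : Fin (m + 1) → β) :
    (univ : Finset (Fin (m + 1))).val.map g =
      (univ : Finset (Fin m)).val.map (fun x => g x.castSucc) + {g (Fin.last m)} := by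
  rw [Fin.univ_castSuccEmb, cons_val, map_val, Multiset.map_cons, Multiset.map_map,
    add_comm (Multiset.map _ _), Multiset.singleton_add]
  rfl

section Clasp

variable {ι : Type} (u v w f g : ι)

/-- The face system of `n` parallel edges `u v` and a path from `u` through `w` to `v`, where `F`
are the faces of colour `A`, among them the two faces `f` and `g` on the sides of the path. -/
def claspSystem (F : Multiset ι) (n : ℕ) : FaceSystem ι :=
  ⟨F.map (fun x => (x, u)) + F.map (fun x => (x, v)) + {(f, w), (g, w)},
    Multiset.replicate n s(u, v) + {s(u, w), s(w, v)}, {u, v, w}, F⟩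

theorem claspSystem_swap (F : Multiset ι) (n : ℕ) :
    claspSystem u v w f g F n = claspSystem u v w g f F n := by
  rw [claspSystem, Multiset.pair_comm, claspSystem]

theorem cellSystem_clasp (l : List ι) :
    cellSystem f u v (l.map (fun h => .bigon h u v) ++ [.polygon g v [w]]) =
      claspSystem u v w f g (f ::ₘ g ::ₘ l) (l.length + 1) := by
  have hchain : (l : Multiset ι).map (fun _ => s(u, v)) = Multiset.replicate l.length s(u, v) := by
    rw [Multiset.map_const', Multiset.coe_card]
  rw [cellSystem_bigons, claspSystem, Multiset.replicate_succ, ← hchain,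
    Sym2.eq_swap (a := u) (b := w), Sym2.eq_swap (a := w) (b := v)]
  apply FaceSystem.ext <;>
    simp only [parallelSystem, cellSystem, Cell.system, Cell.cornerSystem, Cell.pathSystem,
      Cell.linkSystem, arcs_add, crossings_add, bFaces_add, aFaces_add, Multiset.map_add,
      Multiset.map_singleton, Multiset.insert_eq_cons, ← Multiset.singleton_add, add_zero]
  all_goals abel

end Clasp

section TwistDiagram

variable {m : ℕ}

theorem twistDiagram_isA_iff {F : Fin 3 ⊕ Fin (m + 1)} :
    (twistDiagram m).IsA F ↔ ∃ b, F = .inl b := by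
  constructor
  · rintro ⟨x | _ | _, h | h⟩
    exacts [⟨0, h.symm⟩, ⟨1, h.symm⟩, ⟨2, h.symm⟩, ⟨1, h.symm⟩, ⟨0, h.symm⟩, ⟨2, h.symm⟩]
  · rintro ⟨b, rfl⟩
    fin_cases b
    exacts [⟨.inr true, Or.inl rfl⟩, ⟨.inr false, Or.inr rfl⟩, ⟨.inr true, Or.inr rfl⟩]

theorem twistDiagram_mirror_isA_iff {F : Fin 3 ⊕ Fin (m + 1)} :
    (twistDiagram m).mirror.IsA F ↔ ¬ ∃ b, F = .inl b :=
  (twistDiagram m).mirror_isA_iff.trans twistDiagram_isA_iff.not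

theorem twistDiagram_mirror_isA_inr (i : Fin (m + 1)) :
    (twistDiagram m).mirror.IsA (.inr i : Fin 3 ⊕ Fin (m + 1)) :=
  twistDiagram_mirror_isA_iff.2 fun ⟨_, h⟩ => Sum.inr_ne_inl h

theorem not_twistDiagram_mirror_isA_inl (b : Fin 3) :
    ¬ (twistDiagram m).mirror.IsA (.inl b : Fin 3 ⊕ Fin (m + 1)) :=
  fun h => twistDiagram_mirror_isA_iff.1 h ⟨b, rfl⟩

variable (m)

theorem aFaces_twistDiagram :
    (twistDiagram m).faceSystem.aFaces = {Sum.inl 0, Sum.inl 1, Sum.inl 2} :=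
  filter_val_eq_map_inl fun _ => twistDiagram_isA_iff

theorem bFaces_twistDiagram :
    (twistDiagram m).faceSystem.bFaces = (univ : Finset (Fin (m + 1))).val.map Sum.inr :=
  filter_val_eq_map_inr fun _ => twistDiagram_isA_iff.not

theorem twistDiagram_faceSystem (f₀ v₀ : Fin 3 ⊕ Fin (m + 1)) : (twistDiagram m).faceSystem =
    Cell.system f₀ v₀ (.bigon (.inl 2) (.inr (Fin.last m)) (.inr 0)) +
      cycleSystem (.inl 0) (.inl 1) ((univ : Finset (Fin (m + 1))).val.map Sum.inr)
        (univ.val.map fun x => s(Sum.inr x, Sum.inr (x + 1))) := by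
  refine FaceSystem.ext ?_ ?_ ((bFaces_twistDiagram m).trans (zero_add _).symm)
    ((aFaces_twistDiagram m).trans ?_)
  · refine (congrArg₂ (· + ·) (map_univ_sum_bool _) (map_univ_sum_bool _)).trans ?_
    simp only [Cell.system, cycleSystem, Multiset.map_map, Function.comp_def]
    rw [map_univ_fin_castSucc fun x : Fin (m + 1) =>
        ((.inl 1, .inr x) : (Fin 3 ⊕ Fin (m + 1)) × (Fin 3 ⊕ Fin (m + 1))),
      map_univ_fin_succ fun x : Fin (m + 1) =>
        ((.inl 0, .inr x) : (Fin 3 ⊕ Fin (m + 1)) × (Fin 3 ⊕ Fin (m + 1)))]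
    have hperm : ∀ M N a b c d : Multiset ((Fin 3 ⊕ Fin (m + 1)) × (Fin 3 ⊕ Fin (m + 1))),
        M + (a + b) + (N + (c + d)) = a + d + (M + b + (N + c)) := by
      intros
      abel
    exact hperm _ _ _ _ _ _
  · refine (map_univ_sum_bool (α := Fin m) _).trans ?_
    simp only [Cell.system, cycleSystem]
    rw [map_univ_fin_castSucc fun x : Fin (m + 1) =>
      s((.inr x : Fin 3 ⊕ Fin (m + 1)), .inr (x + 1))]
    simp only [Fin.coeSucc_eq_succ, Fin.last_add_one]
    exact add_left_comm _ _ _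
  · exact Multiset.coe_eq_coe.2 (List.reverse_perm [Sum.inl 2, Sum.inl 1, Sum.inl 0])

theorem twistDiagram_mirror_faceSystem : (twistDiagram m).mirror.faceSystem =
    claspSystem (.inl 0) (.inl 1) (.inl 2) (.inr 0) (.inr (Fin.last m))
      ((univ : Finset (Fin (m + 1))).val.map Sum.inr) m := by
  rw [AlternatingKnotDiagram.faceSystem_mirror]
  refine FaceSystem.ext ?_ ?_ (aFaces_twistDiagram m) (bFaces_twistDiagram m)
  · refine (congrArg₂ (· + ·) (map_univ_sum_bool _) (map_univ_sum_bool _)).trans ?_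
    simp only [claspSystem, Multiset.map_map, Function.comp_def]
    rw [map_univ_fin_castSucc fun x : Fin (m + 1) =>
        ((.inr x, .inl 0) : (Fin 3 ⊕ Fin (m + 1)) × (Fin 3 ⊕ Fin (m + 1))),
      map_univ_fin_succ fun x : Fin (m + 1) =>
        ((.inr x, .inl 1) : (Fin 3 ⊕ Fin (m + 1)) × (Fin 3 ⊕ Fin (m + 1)))]
    have hperm : ∀ M N a b c d : Multiset ((Fin 3 ⊕ Fin (m + 1)) × (Fin 3 ⊕ Fin (m + 1))),
        M + (a + b) + (N + (c + d)) = M + a + (N + d) + (c + b) := by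
      intros
      abel
    exact hperm _ _ _ _ _ _
  · refine (map_univ_sum_bool (α := Fin m) _).trans (congrArg (· + _) ?_)
    refine (Multiset.map_const' (univ : Finset (Fin m)).val
      s((.inl 0 : Fin 3 ⊕ Fin (m + 1)), .inl 1)).trans ?_
    rw [card_val, card_univ, Fintype.card_fin]

variable {m}

theorem phiEq_twistDiagram (hm : 0 < m) : (twistDiagram m).PhiEq fun q => hSeries (m + 1) q := by
  rintro (b | j) hF q hq
  · exact absurd (iff_of_true (twistDiagram_isA_iff.2 ⟨b, rfl⟩)
      (twistDiagram_isA_iff.2 ⟨0, rfl⟩)) hF.1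
  · let h : ZMod (m + 1) → Fin 3 ⊕ Fin (m + 1) := fun i => .inr i
    let j' : ZMod (m + 1) := j
    have hD := (twistDiagram_faceSystem m (.inl 0) (h j')).trans (congrArg (_ + ·)
      (cellSystem_cycleCell (by omega) (.inl 0) (.inl 1) h j').symm)
    have hvalid : ValidCells (h j') (h (j' + 1))
        [.bigon (.inl 2) (h (Fin.last m)) (h 0), cycleCell (.inl 1) h j'] :=
      ⟨⟨mem_cycleCell _ _ _ _, mem_cycleCell _ _ _ _⟩, validCells_cycleCell _ _ _⟩
    have hlast : Fin.last m ≠ 0 := Fin.ne_of_val_ne hm.ne'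
    have hne : ∀ x, (twistDiagram m).corner x 0 ≠ (twistDiagram m).corner x 2 := by
      rintro (x | _ | _) h
      exacts [x.castSucc_lt_succ.ne (Sum.inr_injective h), hlast (Sum.inr_injective h),
        hlast (Sum.inr_injective h)]
    obtain ⟨hsum, hPhi⟩ := (twistDiagram m).summable_and_Phi_eq hne hvalid hD (Or.inl ⟨rfl, rfl⟩) hq
    have hrank : (cycleCell (.inl 1) h j').rank + 2 = m + 1 := by
      rw [rank_cycleCell]
      omega
    have hprod : hSeries (0 + 2) q * (hSeries ((cycleCell (.inl 1) h j').rank + 2) q * 1) =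
        hSeries (m + 1) q := by
      rw [hrank, zero_add, hSeries_two hq, one_mul, mul_one]
    exact ⟨hsum, hPhi.trans hprod⟩

theorem twistDiagram_mirror_commonEdges_pos_iff {i : Fin (m + 1)} {b : Fin 3} :
    0 < (twistDiagram m).mirror.commonEdges (.inr i : Fin 3 ⊕ Fin (m + 1)) (.inl b) ↔
      ∃ x, twistCorner m x 0 = .inr i ∧ twistCorner m x 1 = .inl b ∨
        twistCorner m x 2 = .inr i ∧ twistCorner m x 3 = .inl b :=
  (twistDiagram m).mirror.commonEdges_pos_iff (twistDiagram_mirror_isA_inr i)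
    (not_twistDiagram_mirror_isA_inl b)

theorem twistDiagram_mirror_neighbours (i : Fin (m + 1)) :
    (twistDiagram m).mirror.neighbours (.inr i : Fin 3 ⊕ Fin (m + 1)) =
      #{b : Fin 3 | 0 < (twistDiagram m).mirror.commonEdges
        (.inr i : Fin 3 ⊕ Fin (m + 1)) (.inl b)} := by
  refine Eq.trans (congrArg card (Finset.ext fun G => ?_))
    (card_map (Function.Embedding.inl : Fin 3 ↪ Fin 3 ⊕ Fin (m + 1)))
  refine mem_filter.trans (Iff.trans ?_ mem_map.symm)
  have hX : ¬ (twistDiagram m).mirror.IsA (twistDiagram m).mirror.exterior :=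
    not_twistDiagram_mirror_isA_inl 0
  constructor
  · rintro ⟨-, hcolour, hpos⟩
    rcases G with b | k
    · exact ⟨b, mem_filter.2 ⟨mem_univ b, hpos⟩, rfl⟩
    · exact absurd (hcolour.1 (twistDiagram_mirror_isA_inr k)) hX
  · rintro ⟨b, hb, rfl⟩
    exact ⟨mem_univ _, iff_of_false (not_twistDiagram_mirror_isA_inl b) hX, (mem_filter.1 hb).2⟩

theorem twistDiagram_mirror_neighbours_zero (hm : 0 < m) :
    (twistDiagram m).mirror.neighbours (.inr 0 : Fin 3 ⊕ Fin (m + 1)) = 3 := by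
  rw [twistDiagram_mirror_neighbours, filter_true_of_mem, card_univ, Fintype.card_fin]
  intro b _
  rw [twistDiagram_mirror_commonEdges_pos_iff]
  fin_cases b
  exacts [⟨.inl ⟨0, hm⟩, Or.inl ⟨rfl, rfl⟩⟩, ⟨.inr false, Or.inr ⟨rfl, rfl⟩⟩,
    ⟨.inr true, Or.inr ⟨rfl, rfl⟩⟩]

theorem twistDiagram_mirror_neighbours_le_two {i : Fin (m + 1)} (h0 : i ≠ 0)
    (hlast : i ≠ Fin.last m) :
    (twistDiagram m).mirror.neighbours (.inr i : Fin 3 ⊕ Fin (m + 1)) ≤ 2 := by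
  rw [twistDiagram_mirror_neighbours]
  refine (card_le_card fun b hb => ?_ : _ ≤ #({0, 1} : Finset (Fin 3)))
  obtain ⟨x | _ | _, ⟨hi, hb⟩ | ⟨hi, hb⟩⟩ :=
    twistDiagram_mirror_commonEdges_pos_iff.1 (mem_filter.1 hb).2
  · simp [← Sum.inl_injective hb]
  · simp [← Sum.inl_injective hb]
  · exact absurd (Sum.inr_injective hi).symm hlast
  · exact absurd (Sum.inr_injective hi).symm h0
  · exact absurd (Sum.inr_injective hi).symm hlast
  · exact absurd (Sum.inr_injective hi).symm h0

theorem eq_of_twistDiagram_mirror_isBase (hm : 0 < m) {F : Fin 3 ⊕ Fin (m + 1)}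
    (hF : (twistDiagram m).mirror.IsBase F) : F = .inr 0 ∨ F = .inr (Fin.last m) := by
  obtain ⟨hcolour, hmax⟩ := hF
  have hX : ¬ (twistDiagram m).mirror.IsA (twistDiagram m).mirror.exterior :=
    not_twistDiagram_mirror_isA_inl 0
  rcases F with b | i
  · exact absurd (iff_of_false (not_twistDiagram_mirror_isA_inl b) hX) hcolour
  · by_contra hi
    rw [not_or] at hi
    have hle : (twistDiagram m).mirror.neighbours (.inr i : Fin 3 ⊕ Fin (m + 1)) ≤ 2 :=
      twistDiagram_mirror_neighbours_le_two (fun h => hi.1 (congrArg _ h))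
        (fun h => hi.2 (congrArg _ h))
    have hzero := twistDiagram_mirror_neighbours_zero hm
    rcases hmax (.inr 0 : Fin 3 ⊕ Fin (m + 1))
      (fun h => hX (h.1 (twistDiagram_mirror_isA_inr 0))) with h | h <;> omega

theorem twistDiagram_mirror_faceSystem_eq_cellSystem {a b : Fin (m + 1)} (hab : a ≠ b)
    (hends : a = 0 ∧ b = Fin.last m ∨ a = Fin.last m ∧ b = 0) :
    ∃ l : List (Fin 3 ⊕ Fin (m + 1)), (twistDiagram m).mirror.faceSystem =
      cellSystem (.inr a) (.inl 0) (.inl 1) (l.map (fun f => .bigon f (.inl 0) (.inl 1)) ++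
        [.polygon (.inr b) (.inl 1) [.inl 2]]) := by
  obtain ⟨l, hl⟩ : ∃ l : List (Fin (m + 1)),
      (univ : Finset (Fin (m + 1))).val = a ::ₘ b ::ₘ (l : Multiset (Fin (m + 1))) := by
    refine ⟨((univ.erase a).erase b).toList, ?_⟩
    rw [coe_toList, erase_val, Multiset.cons_erase (mem_erase.2 ⟨hab.symm, mem_univ b⟩), erase_val,
      Multiset.cons_erase (mem_univ_val a)]
  have hcard : m = l.length + 1 := by simpa using congrArg Multiset.card hl
  have hclasp : claspSystem (.inl (0 : Fin 3)) (.inl 1) (.inl 2) (.inr 0) (.inr (Fin.last m))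
        ((univ : Finset (Fin (m + 1))).val.map Sum.inr) m =
      claspSystem (.inl 0) (.inl 1) (.inl 2) (.inr a) (.inr b)
        ((univ : Finset (Fin (m + 1))).val.map Sum.inr) m := by
    rcases hends with ⟨rfl, rfl⟩ | ⟨rfl, rfl⟩
    exacts [rfl, claspSystem_swap _ _ _ _ _ _ _]
  have hcells : claspSystem (.inl (0 : Fin 3)) (.inl 1) (.inl 2) (.inr a) (.inr b)
        ((univ : Finset (Fin (m + 1))).val.map Sum.inr) m =
      cellSystem (.inr a) (.inl 0) (.inl 1) ((l.map Sum.inr).map (fun f =>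
        .bigon f (.inl 0) (.inl 1)) ++ [.polygon (.inr b) (.inl 1) [.inl 2]]) := by
    rw [cellSystem_clasp, hl, Multiset.map_cons, Multiset.map_cons, Multiset.map_coe,
      List.length_map, ← hcard]
  exact ⟨l.map Sum.inr, (twistDiagram_mirror_faceSystem m).trans (hclasp.trans hcells)⟩

theorem phiEq_twistDiagram_mirror (hm : 0 < m) :
    (twistDiagram m).mirror.PhiEq fun q => hSeries 3 q := by
  have hne : ∀ x, (twistDiagram m).mirror.corner x 0 ≠ (twistDiagram m).mirror.corner x 2 := by
    rintro (_ | _ | _) h <;> exact absurd (Sum.inl_injective h) (by decide)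
  have hlast : Fin.last m ≠ 0 := Fin.ne_of_val_ne hm.ne'
  intro F hF q hq
  obtain ⟨a, b, hab, hends, rfl⟩ : ∃ a b : Fin (m + 1), a ≠ b ∧
      (a = 0 ∧ b = Fin.last m ∨ a = Fin.last m ∧ b = 0) ∧ F = .inr a := by
    rcases eq_of_twistDiagram_mirror_isBase hm hF with rfl | rfl
    exacts [⟨0, Fin.last m, hlast.symm, Or.inl ⟨rfl, rfl⟩, rfl⟩,
      ⟨Fin.last m, 0, hlast, Or.inr ⟨rfl, rfl⟩, rfl⟩]
  obtain ⟨l, hD⟩ := twistDiagram_mirror_faceSystem_eq_cellSystem hab hends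
  have hvalid := validCells_bigons (v₀ := (.inl 0 : Fin 3 ⊕ Fin (m + 1))) (w₀ := .inl 1)
    (u := .inl 0) (v := .inl 1) l (L := [.polygon (.inr b) (.inl 1) [.inl 2]])
    ⟨List.mem_singleton_self _, trivial⟩ List.mem_cons_self (by simp [cellVerts])
  obtain ⟨hsum, hPhi⟩ :=
    (twistDiagram m).mirror.summable_and_Phi_eq hne hvalid hD (Or.inr ⟨rfl, rfl⟩) hq
  exact ⟨hsum, hPhi.trans ((prod_hSeries_bigons hq _ _ _ _).trans (mul_one _))⟩

end TwistDiagram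

theorem phiEq_twistKnot_of_pos {p : ℤ} (hp : 0 < p) :
    (twistKnot p).PhiEq (fun q => hSeries (2 * p.natAbs) q) ∧
      (twistKnot p).mirror.PhiEq (fun q => hSeries 3 q) := by
  obtain ⟨m, hm⟩ : ∃ m, 2 * p.natAbs = m + 1 := ⟨2 * p.natAbs - 1, by omega⟩
  have hm0 : 0 < m := by omega
  rw [twistKnot, if_pos hp, hm]
  exact ⟨phiEq_twistDiagram hm0, phiEq_twistDiagram_mirror hm0⟩

theorem phiEq_twistKnot_of_neg {p : ℤ} (hp : p < 0) :
    (twistKnot p).PhiEq (fun q => hSeries (2 * p.natAbs + 1) q) ∧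
      (twistKnot p).mirror.PhiEq (fun q => hSeries 3 q) := by
  have hm : 0 < 2 * p.natAbs := by omega
  rw [twistKnot, if_neg hp.not_gt]
  exact ⟨phiEq_twistDiagram hm, phiEq_twistDiagram_mirror hm⟩

end

theorem theorem1p1 :
    knot_3_1.PhiEq (fun q => hSeries 3 q) ∧ knot_3_1.mirror.PhiEq (fun _ => 1) ∧
    knot_4_1.PhiEq (fun q => hSeries 3 q) ∧ knot_4_1.mirror.PhiEq (fun q => hSeries 3 q) ∧
    knot_5_1.PhiEq (fun q => hSeries 5 q) ∧ knot_5_1.mirror.PhiEq (fun _ => 1) ∧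
    knot_5_2.PhiEq (fun q => hSeries 4 q) ∧ knot_5_2.mirror.PhiEq (fun q => hSeries 3 q) ∧
    knot_6_1.PhiEq (fun q => hSeries 5 q) ∧ knot_6_1.mirror.PhiEq (fun q => hSeries 3 q) ∧
    knot_6_2.PhiEq (fun q => hSeries 3 q * hSeries 4 q) ∧
    knot_6_2.mirror.PhiEq (fun q => hSeries 3 q) ∧
    knot_6_3.PhiEq (fun q => hSeries 3 q ^ 2) ∧ knot_6_3.mirror.PhiEq (fun q => hSeries 3 q ^ 2) ∧
    knot_7_1.PhiEq (fun q => hSeries 7 q) ∧ knot_7_1.mirror.PhiEq (fun _ => 1) ∧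
    knot_7_2.PhiEq (fun q => hSeries 6 q) ∧ knot_7_2.mirror.PhiEq (fun q => hSeries 3 q) ∧
    knot_7_3.PhiEq (fun q => hSeries 5 q) ∧ knot_7_3.mirror.PhiEq (fun q => hSeries 4 q) ∧
    knot_7_4.PhiEq (fun q => hSeries 4 q ^ 2) ∧ knot_7_4.mirror.PhiEq (fun q => hSeries 3 q) ∧
    knot_7_5.PhiEq (fun q => hSeries 3 q * hSeries 4 q) ∧
    knot_7_5.mirror.PhiEq (fun q => hSeries 4 q) ∧
    knot_7_6.PhiEq (fun q => hSeries 3 q * hSeries 4 q) ∧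
    knot_7_6.mirror.PhiEq (fun q => hSeries 3 q ^ 2) ∧
    knot_7_7.PhiEq (fun q => hSeries 3 q ^ 3) ∧ knot_7_7.mirror.PhiEq (fun q => hSeries 3 q ^ 2) ∧
    knot_8_1.PhiEq (fun q => hSeries 7 q) ∧ knot_8_1.mirror.PhiEq (fun q => hSeries 3 q) ∧
    knot_8_2.PhiEq (fun q => hSeries 3 q * hSeries 6 q) ∧
    knot_8_2.mirror.PhiEq (fun q => hSeries 3 q) ∧
    knot_8_3.PhiEq (fun q => hSeries 5 q) ∧ knot_8_3.mirror.PhiEq (fun q => hSeries 5 q) ∧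
    knot_8_4.PhiEq (fun q => hSeries 3 q) ∧
    knot_8_4.mirror.PhiEq (fun q => hSeries 4 q * hSeries 5 q) ∧
    knot_8_5.mirror.PhiEq (fun q => hSeries 3 q) ∧
    (∀ p : ℤ, 0 < p → (twistKnot p).PhiEq (fun q => hSeries (2 * p.natAbs) q) ∧
      (twistKnot p).mirror.PhiEq (fun q => hSeries 3 q)) ∧
    (∀ p : ℤ, p < 0 → (twistKnot p).PhiEq (fun q => hSeries (2 * p.natAbs + 1) q) ∧
      (twistKnot p).mirror.PhiEq (fun q => hSeries 3 q)) ∧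
    (∀ p : ℕ, 0 < p → (torusKnot p).PhiEq (fun q => hSeries (2 * p + 1) q) ∧
      (torusKnot p).mirror.PhiEq (fun _ => 1)) := by
  have h41 := phiEq_twistKnot_of_neg (p := -1) (by norm_num)
  have h52 := phiEq_twistKnot_of_pos (p := 2) (by norm_num)
  have h61 := phiEq_twistKnot_of_neg (p := -2) (by norm_num)
  have h72 := phiEq_twistKnot_of_pos (p := 3) (by norm_num)
  have h81 := phiEq_twistKnot_of_neg (p := -3) (by norm_num)
  exact ⟨phiEq_torusKnot (p := 1) (by norm_num), phiEq_torusKnot_mirror 1, h41.1, h41.2,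
    phiEq_torusKnot (p := 2) (by norm_num), phiEq_torusKnot_mirror 2, h52.1, h52.2,
    h61.1, h61.2, phiEq_knot_6_2, phiEq_knot_6_2_mirror, phiEq_knot_6_3, phiEq_knot_6_3_mirror,
    phiEq_torusKnot (p := 3) (by norm_num), phiEq_torusKnot_mirror 3, h72.1, h72.2,
    phiEq_knot_7_3, phiEq_knot_7_3_mirror, phiEq_knot_7_4, phiEq_knot_7_4_mirror,
    phiEq_knot_7_5, phiEq_knot_7_5_mirror, phiEq_knot_7_6, phiEq_knot_7_6_mirror,
    phiEq_knot_7_7, phiEq_knot_7_7_mirror, h81.1, h81.2, phiEq_knot_8_2, phiEq_knot_8_2_mirror,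
    phiEq_knot_8_3, phiEq_knot_8_3_mirror, phiEq_knot_8_4, phiEq_knot_8_4_mirror,
    phiEq_knot_8_5_mirror, fun _ => phiEq_twistKnot_of_pos, fun _ => phiEq_twistKnot_of_neg,
    fun p hp => ⟨phiEq_torusKnot hp, phiEq_torusKnot_mirror p⟩⟩
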